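/- **Theorem (Genus 0 topological recursion, rational form).** Notation. For partitions $\alpha,\beta$ of $d\ge 1$ with $l(\alpha)$ and $l(\beta)$ parts, let $r=l(\alpha)+l(\beta)-2$, let $|\mathrm{Aut}\,\alpha|=\prod_{i\ge1}a_i!$ where $a_i$ is the number of parts of $\alpha$ equal to $i$, and let $H^0_{\alpha,\beta}$ be the genus $0$ double Hurwitz number, i.e. $|\mathrm{Aut}\,\alpha|\,|\mathrm{Aut}\,\beta|/d!$ times the number of tuples $(\sigma,\tau_1,\dots,\tau_r,\gamma)$ of permutations in $\mathfrak S_d$ such that $\sigma$ has cycle type $\beta$, $\gamma$ has cycle type $\alpha$, the $\tau_j$ are transpositions, $\tau_r\cdots\tau_1\sigma=\gamma$, and $\langle\sigma,\tau_1,\dots,\tau_r\rangle$ acts transitively on $\{1,\dots,d\}$. For $m\ge1$ let $$\mathbf H^0_m(x_1,\dots,x_m)=\sum_{d\ge1}\ \sum_{\alpha,\beta\vdash d,\ l(\alpha)=m} m_\alpha(x_1,\dots,x_m)\,q_\beta\,u^{l(\beta)}\,\frac{H^0_{\alpha,\beta}}{r!\,|\mathrm{Aut}\,\beta|},$$ where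 $m_\alpha$ is the monomial symmetric function, $q_\beta=\prod_i q_{\beta_i}$, and $u,q_1,q_2,\dots$ are indeterminates. Put $Q(t)=\sum_{j\ge1}q_jt^j$, $\mu(t)=1/(1-utQ'(t))$, and for indeterminates $w_1,\dots,w_m$ put $Q_i=Q(w_i)$, $\mu_i=\mu(w_i)$. Define the formal power series in $u,w_1,\dots,w_m$, with coefficients in $\mathbb Q[q_1,q_2,\dots]$, $$\mathbf h^0_m(u,w_1,\dots,w_m)=\mathbf H^0_m(w_1e^{-uQ_1},\dots,w_me^{-uQ_m}),\qquad \mathbf h^0_{j,i}=w_i\frac{\partial\mathbf h^0_j}{\partial w_i}.$$ For $\alpha\subseteq\{1,\dots,m\}$ let $|\alpha|$ be its size and $w_\alpha$ the list of the $w_a$ with $a\in\alpha$; let $\overline{\{l\}}=\{1,\dots,m\}\setminus\{l\}$; and let $\Omega_{m,i}$ be the set of unordered pairs $\{\alpha,\zeta\}$ of subsets of $\{1,\dots,m\}$ with $\alpha\cup\zeta=\{1,\dots,m\}$ and $\alpha\cap\zeta=\{i\}$. Claim. For every $m\ge4$, $$\mathbf h^0_m=u^{2-m}\int_0^u\Bigg(\sum_{i=1}^m\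 \sum_{\substack{\{\alpha,\zeta\}\in\Omega_{m,i}\\ |\alpha|,|\zeta|\ge3}}\mu_i^2\,\mathbf h^0_{|\alpha|,i}(u,w_\alpha)\,\mathbf h^0_{|\zeta|,i}(u,w_\zeta)+\sum_{\substack{1\le k,l\le m\\ k\ne l}}\frac{\mu_k^2\,w_l}{w_k-w_l}\,\mathbf h^0_{m-1,k}(u,w_{\overline{\{l\}}})\Bigg)u^{m-3}\,du,$$ where the sum in large parentheses is a formal power series in $u,w_1,\dots,w_m$ (the denominators $w_k-w_l$ cancel in the sum), and the integration is the formal one in $u$, with $w_1,\dots,w_m$ regarded as constants. -/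

import Mathlib

namespace DoubleHurwitz

noncomputable section

/-- For a partition `α` with `a_i` parts equal to `i`, the number `|Aut α| = ∏ a_i!`. -/
def autCard {d : ℕ} (α : d.Partition) : ℕ :=
  ∏ i ∈ α.parts.toFinset, (α.parts.count i).factorial

/-- The number `r = 2g - 2 + l(α) + l(β)` of simple branch points. (For partitions of `d ≥ 1`
the subtraction does not truncate.) -/
def numSimple (g : ℕ) {d : ℕ} (α β : d.Partition) : ℕ :=
  2 * g + Multiset.card α.parts + Multiset.card β.parts - 2

/-- `(σ, τ_1, …, τ_r, γ)` is a transitive ordered factorization: `σ` has cycle type `β`, `γ` has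
cycle type `α`, the `τ_j` are transpositions, `τ_r ⋯ τ_1 σ = γ`, and the group generated by `σ` and
the `τ_j` is transitive on the `d` sheets. -/
def IsTransitiveFactorization {d r : ℕ} (α β : d.Partition) (σ : Equiv.Perm (Fin d))
    (τ : Fin r → Equiv.Perm (Fin d)) (γ : Equiv.Perm (Fin d)) : Prop :=
  σ.partition.parts = β.parts ∧
  γ.partition.parts = α.parts ∧
  (∀ j, (τ j).IsSwap) ∧
  (List.ofFn τ).reverse.prod * σ = γ ∧
  MulAction.IsPretransitive (Subgroup.closure (insert σ (Set.range τ))) (Fin d)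

/-- The genus `g` double Hurwitz number `H^g_{α,β}`, through the monodromy of the covers:
`|Aut α| |Aut β| / d!` times the number of transitive ordered factorizations with
`r = 2g - 2 + l(α) + l(β)` transpositions. -/
def hurwitzNumber (g : ℕ) {d : ℕ} (α β : d.Partition) : ℚ :=
  (autCard α : ℚ) * (autCard β : ℚ) / (d.factorial : ℚ) *
    (Nat.card {x : Equiv.Perm (Fin d) × (Fin (numSimple g α β) → Equiv.Perm (Fin d)) ×
      Equiv.Perm (Fin d) // IsTransitiveFactorization α β x.1 x.2.1 x.2.2} : ℚ)

/-- Polynomials over `ℚ` in the indeterminates `q_1, q_2, …` (the variable with index `0`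
is never used). -/
abbrev Coeffs : Type := MvPolynomial ℕ ℚ

/-- Formal power series in `u` (the variable `none`) and `m` further variables (the variables
`some i`), with coefficients polynomial in the `q_j`. -/
abbrev Series (m : ℕ) : Type := MvPowerSeries (Option (Fin m)) Coeffs

instance (m : ℕ) : IsDomain (Series m) := NoZeroDivisors.to_isDomain _

/-- The symmetrized genus `g`, `m`-part series (`m ≥ 1`)
`H^g_m(x_1,…,x_m) = ∑_{d ≥ 1} ∑_{α, β ⊢ d, l(α) = m}
  m_α(x_1,…,x_m) q_β u^{l(β)} H^g_{α,β} / (r! |Aut β|)`,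
where `m_α` is the monomial symmetric function: the monomial `x^a` occurs in `m_α`, with
coefficient `1`, exactly when the `m` exponents `a_1, …, a_m` are the parts of `α`. -/
def symH (g m : ℕ) : Series m := fun e =>
  ∑ α : (∑ i, e (some i)).Partition, ∑ β : (∑ i, e (some i)).Partition,
    if α.parts = Finset.univ.val.map (fun i : Fin m => e (some i)) ∧
        Multiset.card β.parts = e none then
      MvPolynomial.C (hurwitzNumber g α β /
          (((numSimple g α β).factorial : ℚ) * (autCard β : ℚ))) *
        (β.parts.map MvPolynomial.X).prod
    else 0

/-- The intrinsic variable `u`. -/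
def u (m : ℕ) : Series m := MvPowerSeries.X none

/-- The variable `w_i`. -/
def w {m : ℕ} (i : Fin m) : Series m := MvPowerSeries.X (some i)

/-- `Q(t) = ∑_{j ≥ 1} q_j t^j`. -/
def Q : PowerSeries Coeffs :=
  PowerSeries.mk fun j => if j = 0 then 0 else MvPolynomial.X j

/-- `Q_i = Q(w_i)`. -/
def Qw {m : ℕ} (i : Fin m) : Series m := PowerSeries.subst (w i) Q

/-- `μ_i = μ(w_i) = 1 / (1 - u w_i Q'(w_i))`. -/
def mu {m : ℕ} (i : Fin m) : Series m :=
  MvPowerSeries.invOfUnit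
    (1 - u m * w i * PowerSeries.subst (w i) (PowerSeries.derivative Coeffs Q)) 1

/-- The series `x_i = w_i e^{-u Q_i}`. -/
def xOfW {m : ℕ} (i : Fin m) : Series m :=
  w i * PowerSeries.subst (-(u m * Qw i)) (PowerSeries.exp Coeffs)

/-- The values substituted by `Γ`: `u ↦ u`, `x_i ↦ w_i e^{-u Q_i}`. -/
def gammaVals (m : ℕ) : Option (Fin m) → Series m
  | none => u m
  | some i => xOfW i

/-- The change of variables `Γ` from `x_1, …, x_m` to `w_1, …, w_m`. -/
def Gamma {m : ℕ} (f : Series m) : Series m := MvPowerSeries.subst (gammaVals m) f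

/-- `h^g_m(u, w_1, …, w_m) = H^g_m(w_1 e^{-u Q_1}, …, w_m e^{-u Q_m})`. -/
def h (g m : ℕ) : Series m := Gamma (symH g m)

/-- For `α = {α_1 < ⋯ < α_j} ⊆ {1,…,m}`, the series `h^g_{|α|}(u, w_α)`
with `w_α = w_{α_1}, …, w_{α_j}`. -/
def hAt (g : ℕ) {m : ℕ} (α : Finset (Fin m)) : Series m :=
  MvPowerSeries.rename (α.orderEmbOfFin rfl).toEmbedding.optionMap (h g α.card)

/-- `h^g_{|α|,i}(u, w_α) = w_i ∂/∂w_i h^g_{|α|}(u, w_α)`. -/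
def hAtD (g : ℕ) {m : ℕ} (α : Finset (Fin m)) (i : Fin m) : Series m :=
  w i * MvPowerSeries.pderiv Coeffs (some i) (hAt g α)

/-- The unordered pairs `{α, ζ}` of subsets of `{1,…,m}` with `α ∪ ζ = {1,…,m}`,
`α ∩ ζ = {i}` and `l(α), l(ζ) ≥ 3`. -/
def Omega (m : ℕ) (i : Fin m) : Finset (Sym2 (Finset (Fin m))) :=
  ((Finset.univ : Finset (Finset (Fin m) × Finset (Fin m))).filter fun p =>
    p.1 ∪ p.2 = Finset.univ ∧ p.1 ∩ p.2 = {i} ∧ 3 ≤ p.1.card ∧ 3 ≤ p.2.card).image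
      fun p => s(p.1, p.2)

/-- The formal integral `∫_0^u f du`, with `w_1, …, w_m` regarded as constants. -/
def integralU {m : ℕ} (f : Series m) : Series m := fun e =>
  if e none = 0 then 0
  else (e none : ℚ)⁻¹ • MvPowerSeries.coeff (e - Finsupp.single none 1) f

/-- The inclusion of the power series ring in its field of fractions. -/
abbrev toFrac {m : ℕ} (f : Series m) : FractionRing (Series m) :=
  algebraMap (Series m) (FractionRing (Series m)) f

theorem constantCoeff_u (m : ℕ) : MvPowerSeries.constantCoeff (u m) = 0 := by
  simp [u]

theorem constantCoeff_w {m : ℕ} (i : Fin m) : MvPowerSeries.constantCoeff (w i) = 0 := by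
  simp [w]

theorem hasSubst_w {m : ℕ} (i : Fin m) : PowerSeries.HasSubst (w i) :=
  PowerSeries.HasSubst.of_constantCoeff_zero (constantCoeff_w i)

theorem hasSubst_exp {m : ℕ} (i : Fin m) : PowerSeries.HasSubst (-(u m * Qw i)) :=
  PowerSeries.HasSubst.of_constantCoeff_zero (by simp [constantCoeff_u])

/-- The substitution defining `Γ` is legitimate. -/
theorem hasSubst_gammaVals (m : ℕ) : MvPowerSeries.HasSubst (gammaVals m) := by
  apply MvPowerSeries.hasSubst_of_constantCoeff_zero
  rintro (_ | i)
  · exact constantCoeff_u m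
  · simp [gammaVals, xOfW, constantCoeff_w]

/-- `μ_i` is the inverse of `1 - u w_i Q'(w_i)`. -/
theorem mul_mu {m : ℕ} (i : Fin m) :
    (1 - u m * w i * PowerSeries.subst (w i) (PowerSeries.derivative Coeffs Q)) * mu i = 1 := by
  apply MvPowerSeries.mul_invOfUnit
  simp [constantCoeff_u]

end

end DoubleHurwitz

/-!
For a set `α` of labels, `HA α` is the genus zero series `H_{|α|}` in the variables `x_α`, regarded
as a series in all `m` variables (`HA_eq_rename`). The monomial symmetric functions disappear if the
cycles of the product `τ_r ⋯ τ_1 σ` are labelled by `α`: a labelled factorization contributes the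
monomial in which the exponent of `x_i` is the length of the cycle labelled `i`, and `|Aut α|` counts
the labellings (`card_labs`).

Removing `τ_r` gives the cut-and-join equation (`cut_join`). If the remaining permutations still act
transitively, `τ_r` cuts a cycle in two, because joining two cycles of one orbit would leave a
factorization that violates the Riemann-Hurwitz inequality (`Conn.ncyc_add_ncyc_le`). The sum over
the cuts of an `n`-cycle is the divided difference of `sub_mul_cutSum`. Otherwise `τ_r` joins two
orbits; the same inequality forces genus zero on both, the two sets of labels share exactly the label
of the joined cycle, and a product of two series arises (`joinCover_sum`).

Under the change of variables `x_i = w_i exp (-u Q_i)` the operator `x_i ∂/∂x_i` becomes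
`μ_i w_i ∂/∂w_i`, and `u ∂/∂u` acquires the additional terms `u Q_i x_i ∂/∂x_i`. The point is that
the series with one and two parts become explicit: `gD_singleton` says that `x_i ∂H_1/∂x_i` becomes
`u Q_i`, and `gD_pair` is a closed formula for two parts. Both follow from the cut-and-join equation,
whose solution is determined by its terms of lowest order in `u`. Hence the products with a one-part
series cancel the additional terms, and the products with a two-part series turn the kernel
`x_l / (x_k - x_l)` of the cut terms into `μ_k w_l / (w_k - w_l)` (`toFrac_gD_pair_add`). What is left
is `(u ∂/∂u + m - 2) h_m = F` with `F` the sum in the statement (`recursion`), and this is integrated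
in `u` (`u_pow_mul_eq_integralU`).
-/


namespace DoubleHurwitz

set_option linter.unusedSectionVars false

open Equiv Equiv.Perm Finset

/-! ### Labellings of the cycles of a permutation -/

section Cycles

variable {V ι : Type*}

/-- `ℓ` labels the cycles of `γ`: its nonempty fibres are exactly the cycles. -/
def IsLabelling (γ : Perm V) (ℓ : V → ι) : Prop :=
  ∀ x y, ℓ x = ℓ y ↔ γ.SameCycle x y

/-- The cycle relation is the smallest equivalence relation linking every point to its image. -/
theorem SameCycle.of_rel {γ : Perm V} (S : Setoid V) (h : ∀ x, S x (γ x)) {x y : V}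
    (hxy : γ.SameCycle x y) : S x y := by
  obtain ⟨n, rfl⟩ := hxy
  induction n using Int.induction_on with
  | zero => exact S.refl _
  | succ n ih =>
    rw [add_comm, zpow_add, zpow_one, Perm.mul_apply]
    exact S.trans ih (h _)
  | pred n ih =>
    refine S.trans ih (S.symm ?_)
    have := h ((γ ^ (-(n : ℤ) - 1)) x)
    rwa [← Perm.mul_apply, ← zpow_one_add, show (1 + (-(n : ℤ) - 1)) = -(n : ℤ) by ring] at this

theorem isLabelling_mk (γ : Perm V) :
    IsLabelling γ (Quotient.mk (Perm.SameCycle.setoid γ)) := fun _ _ => Quotient.eq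

theorem IsLabelling.apply {γ : Perm V} {ℓ : V → ι} (h : IsLabelling γ ℓ) (x : V) :
    ℓ (γ x) = ℓ x := (h _ _).2 ((Perm.sameCycle_apply_left).2 (Perm.SameCycle.refl _ _))

theorem IsLabelling.comp {W : Type*} {γ : Perm V} {ℓ : V → ι} (h : IsLabelling γ ℓ) (e : V ≃ W) :
    IsLabelling (e.permCongr γ) (ℓ ∘ e.symm) := by
  have key : ∀ (n : ℤ) x, ((e.permCongr γ) ^ n) x = e ((γ ^ n) (e.symm x)) := by
    intro n x
    have : (e.permCongr γ) ^ n = e.permCongr (γ ^ n) := by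
      exact (map_zpow (e.permCongrHom) γ n).symm
    rw [this]; rfl
  intro x y
  rw [Function.comp, Function.comp, h]
  constructor
  · rintro ⟨n, hn⟩
    exact ⟨n, by rw [key, hn]; simp⟩
  · rintro ⟨n, hn⟩
    exact ⟨n, by rw [key] at hn; rw [← hn]; simp⟩

variable [DecidableEq V]

section Finite
variable [Fintype V]

/-- The cycle lengths, read off any labelling; unlike `cycleType`, `partition.parts` counts the
fixed points. -/
theorem parts_eq_of_isLabelling [DecidableEq ι] {γ : Perm V} {ℓ : V → ι} (h : IsLabelling γ ℓ) :
    γ.partition.parts = (univ.image ℓ).val.map (fun i => #{v | ℓ v = i}) := by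
  classical
  rw [parts_partition]
  have hsplit : univ.image ℓ = (γ.support.image ℓ).disjUnion (γ.supportᶜ.image ℓ) (by
      rw [Finset.disjoint_left]
      rintro _ hi hj
      obtain ⟨x, hx, rfl⟩ := mem_image.1 hi
      obtain ⟨y, hy, hxy⟩ := mem_image.1 hj
      rw [h] at hxy
      rw [mem_compl, Perm.mem_support, not_not] at hy
      rw [Perm.mem_support] at hx
      exact hx ((hxy.apply_eq_self_iff).1 hy)) := by
    rw [disjUnion_eq_union, ← image_union, union_compl]
  rw [hsplit, Finset.disjUnion_val, Multiset.map_add]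
  congr 1
  · rw [cycleType_def]
    have hex : ∀ c ∈ γ.cycleFactorsFinset, ∃ x, x ∈ γ.support ∧ c = γ.cycleOf x := by
      intro c hc
      obtain ⟨x, hx⟩ := (mem_cycleFactorsFinset_iff.1 hc).1.nonempty_support
      exact ⟨x, mem_cycleFactorsFinset_support_le hc hx,
        (cycle_is_cycleOf hx hc)⟩
    choose x hx1 hx2 using hex
    refine Multiset.map_eq_map_of_bij_of_nodup _ _ γ.cycleFactorsFinset.nodup
      (γ.support.image ℓ).nodup (fun c hc => ℓ (x c hc)) ?_ ?_ ?_ ?_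
    · intro c hc
      exact mem_image_of_mem _ (hx1 c hc)
    · intro c hc c' hc' heq
      rw [h] at heq
      rw [hx2 c hc, hx2 c' hc', heq.cycleOf_eq]
    · intro i hi
      obtain ⟨y, hy, rfl⟩ := mem_image.1 hi
      have hc : γ.cycleOf y ∈ γ.cycleFactorsFinset := cycleOf_mem_cycleFactorsFinset_iff.2 hy
      refine ⟨γ.cycleOf y, hc, ?_⟩
      rw [h]
      have h1 := hx2 _ hc
      have h2 : y ∈ (γ.cycleOf (x (γ.cycleOf y) hc)).support := by
        rw [← h1, mem_support_cycleOf_iff]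
        exact ⟨SameCycle.refl _ _, hy⟩
      exact (mem_support_cycleOf_iff.1 h2).1
    · intro c hc
      refine (congrArg (fun g => #(Perm.support g)) (hx2 c hc)).trans (congrArg card ?_)
      ext v
      rw [mem_support_cycleOf_iff, mem_filter, h]
      constructor
      · rintro ⟨h1, -⟩
        exact ⟨mem_univ _, h1.symm⟩
      · rintro ⟨-, h1⟩
        exact ⟨h1.symm, hx1 c hc⟩
  · have hinj : ∀ x ∈ γ.supportᶜ, ∀ y, ℓ y = ℓ x → y = x := by
      intro x hx y hxy
      rw [mem_compl, Perm.mem_support, not_not] at hx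
      rw [h] at hxy
      obtain ⟨n, hn⟩ := hxy.symm
      rw [zpow_apply_eq_self_of_apply_eq_self hx] at hn
      exact hn.symm
    rw [← card_compl, eq_comm, Multiset.eq_replicate]
    constructor
    · rw [Multiset.card_map]
      exact card_image_of_injOn fun x _ y hy hxy => hinj y hy x hxy
    · intro n hn
      obtain ⟨i, hi, rfl⟩ := Multiset.mem_map.1 hn
      obtain ⟨x, hx, rfl⟩ := mem_image.1 hi
      rw [card_eq_one]
      exact ⟨x, by ext v; simpa using ⟨hinj x hx v, fun h => by rw [h]⟩⟩

/-- The number of cycles of a permutation, fixed points included. -/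
def ncyc (γ : Perm V) : ℕ := Multiset.card γ.partition.parts

theorem ncyc_eq_card_image [DecidableEq ι] {γ : Perm V} {ℓ : V → ι} (h : IsLabelling γ ℓ) :
    ncyc γ = #(univ.image ℓ) := by
  rw [ncyc, parts_eq_of_isLabelling h, Multiset.card_map]; rfl

end Finite

/-- A transposition of points in two different cycles joins these cycles. -/
theorem sameCycle_swap_mul_of_not [Finite V] {γ : Perm V} {a b : V} (h : ¬ γ.SameCycle a b) :
    (swap a b * γ).SameCycle a b := by
  by_contra hn
  have key : ∀ n : ℕ, ((swap a b * γ) ^ n) a = (γ ^ n) a ∧ (γ ^ (n + 1)) a ≠ a := by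
    have step : ∀ n : ℕ, ((swap a b * γ) ^ n) a = (γ ^ n) a → (γ ^ (n + 1)) a ≠ a := by
      intro n ih h1
      apply hn
      refine ⟨(n + 1 : ℕ), ?_⟩
      rw [zpow_natCast, pow_succ', Perm.mul_apply, ih, Perm.mul_apply, ← Perm.mul_apply γ, ← pow_succ',
        h1, swap_apply_left]
    intro n
    induction n with
    | zero => exact ⟨rfl, step 0 rfl⟩
    | succ n ih =>
      have : ((swap a b * γ) ^ (n + 1)) a = (γ ^ (n + 1)) a := by
        rw [pow_succ', Perm.mul_apply, ih.1, Perm.mul_apply, ← Perm.mul_apply γ, ← pow_succ']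
        refine swap_apply_of_ne_of_ne ih.2 ?_
        intro h1
        exact h ⟨(n + 1 : ℕ), by rw [zpow_natCast, h1]⟩
      exact ⟨this, step _ this⟩
  have h1 := (key (orderOf γ - 1)).2
  rw [Nat.sub_add_cancel (orderOf_pos γ), pow_orderOf_eq_one] at h1
  exact h1 rfl

open Classical in
/-- The labelling in which the class of `b` is given the label of `a`. -/
noncomputable def mergeLabel (ℓ : V → ι) (a b : V) : V → ι :=
  fun v => if ℓ v = ℓ b then ℓ a else ℓ v

theorem mergeLabel_eq_iff {ℓ : V → ι} {a b : V} (x y : V) :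
    mergeLabel ℓ a b x = mergeLabel ℓ a b y ↔
      ℓ x = ℓ y ∨ ((ℓ x = ℓ a ∨ ℓ x = ℓ b) ∧ (ℓ y = ℓ a ∨ ℓ y = ℓ b)) := by
  unfold mergeLabel
  split_ifs <;> grind

theorem IsLabelling.merge [Finite V] {γ : Perm V} {ℓ : V → ι}
    (h : IsLabelling γ ℓ) {a b : V} (hab : ℓ a ≠ ℓ b) :
    IsLabelling (swap a b * γ) (mergeLabel ℓ a b) := by
  have hs : (swap a b * γ).SameCycle a b := sameCycle_swap_mul_of_not fun h' => hab ((h _ _).2 h')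
  have hle : ∀ {x y}, γ.SameCycle x y → (swap a b * γ).SameCycle x y := by
    intro x y
    refine SameCycle.of_rel (Perm.SameCycle.setoid _) (fun x => ?_)
    change (swap a b * γ).SameCycle x (γ x)
    have h1 : (swap a b * γ).SameCycle x ((swap a b * γ) x) :=
      Perm.sameCycle_apply_right.2 (SameCycle.refl _ _)
    rw [Perm.mul_apply] at h1
    by_cases ha : γ x = a
    · rw [ha, swap_apply_left] at h1
      rw [ha]
      exact h1.trans hs.symm
    · by_cases hb : γ x = b
      · rw [hb, swap_apply_right] at h1
        rw [hb]
        exact h1.trans hs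
      · rwa [swap_apply_of_ne_of_ne ha hb] at h1
  intro x y
  constructor
  · rw [mergeLabel_eq_iff]
    simp only [h _ _]
    rintro (h1 | ⟨h1 | h1, h2 | h2⟩)
    · exact hle h1
    · exact (hle h1).trans (hle h2).symm
    · exact (hle h1).trans (hs.trans (hle h2).symm)
    · exact (hle h1).trans (hs.symm.trans (hle h2).symm)
    · exact (hle h1).trans (hle h2).symm
  · refine SameCycle.of_rel (Setoid.ker (mergeLabel ℓ a b)) (fun x => ?_)
    change mergeLabel ℓ a b x = mergeLabel ℓ a b _
    have hx := h.apply x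
    rw [Perm.mul_apply, mergeLabel_eq_iff]
    by_cases ha : γ x = a
    · rw [ha, swap_apply_left, ← hx, ha]; simp
    · by_cases hb : γ x = b
      · rw [hb, swap_apply_right, ← hx, hb]; simp
      · rw [swap_apply_of_ne_of_ne ha hb, hx]; simp

theorem image_mergeLabel [Fintype V] [DecidableEq ι] {ℓ : V → ι} {a b : V} (hab : ℓ a ≠ ℓ b) :
    univ.image (mergeLabel ℓ a b) = (univ.image ℓ).erase (ℓ b) := by
  ext i
  simp only [mem_image, mem_univ, true_and, mem_erase, mergeLabel]
  constructor
  · rintro ⟨x, rfl⟩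
    split_ifs with hx
    · exact ⟨hab, a, rfl⟩
    · exact ⟨hx, x, rfl⟩
  · rintro ⟨hi, x, rfl⟩
    exact ⟨x, if_neg hi⟩

theorem ncyc_swap_mul_of_not [Fintype V] {γ : Perm V} {a b : V} (h : ¬ γ.SameCycle a b) :
    ncyc (swap a b * γ) + 1 = ncyc γ := by
  classical
  have hl := isLabelling_mk γ
  have hab : Quotient.mk (Perm.SameCycle.setoid γ) a ≠ Quotient.mk (Perm.SameCycle.setoid γ) b :=
    fun h' => h ((hl _ _).1 h')
  rw [ncyc_eq_card_image hl, ncyc_eq_card_image (hl.merge hab), image_mergeLabel hab]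
  exact card_erase_add_one (mem_image_of_mem _ (mem_univ _))

end Cycles

/-! ### Cutting a cycle by a transposition -/

section Cut

variable {V ι : Type*} [DecidableEq V]

/-- Multiplication by the transposition `(a b)` with `b = γ^j a` cuts the cycle of `a`: the new
cycle of `a` consists of the first `j` iterates. -/
theorem sameCycle_swap_mul_iff [Finite V] {γ : Perm V} {a b : V} {j : ℕ} (hj0 : 0 < j)
    (hj : j < Function.minimalPeriod γ a) (hb : (γ ^ j) a = b) (y : V) :
    (swap a b * γ).SameCycle a y ↔ ∃ i < j, (γ ^ i) a = y := by
  have hne : ∀ i, 0 < i → i < Function.minimalPeriod γ a → (γ ^ i) a ≠ a := by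
    intro i hi0 hi h
    refine Function.not_isPeriodicPt_of_pos_of_lt_minimalPeriod hi0.ne' hi ?_
    rw [Function.IsPeriodicPt, Function.IsFixedPt, ← Perm.coe_pow]
    exact h
  have hneb : ∀ i, 0 < i → i < j → (γ ^ i) a ≠ b := by
    intro i hi0 hi h
    refine hne (j - i) (by omega) (by omega) ?_
    apply (γ ^ i).injective
    rw [← Perm.mul_apply, ← pow_add, h, ← hb]
    congr 2; omega
  have hstep : ∀ i, i + 1 < j → (swap a b * γ) ((γ ^ i) a) = (γ ^ (i + 1)) a := by
    intro i hi
    rw [Perm.mul_apply, ← Perm.mul_apply γ, ← pow_succ']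
    exact swap_apply_of_ne_of_ne (hne _ (by omega) (by omega)) (hneb _ (by omega) hi)
  have hlast : (swap a b * γ) ((γ ^ (j - 1)) a) = a := by
    rw [Perm.mul_apply, ← Perm.mul_apply γ, ← pow_succ', Nat.sub_add_cancel hj0, hb,
      swap_apply_right]
  have hpow : ∀ i < j, ((swap a b * γ) ^ i) a = (γ ^ i) a := by
    intro i
    induction i with
    | zero => intro _; rfl
    | succ i ih =>
      intro hi
      rw [pow_succ', Perm.mul_apply, ih (by omega), hstep i hi]
  constructor
  · intro h
    cases nonempty_fintype V
    obtain ⟨n, -, -, rfl⟩ := h.exists_pow_eq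
    clear h
    induction n with
    | zero => exact ⟨0, hj0, rfl⟩
    | succ n ih =>
      obtain ⟨i, hi, h⟩ := ih
      rw [pow_succ', Perm.mul_apply, ← h]
      by_cases h' : i + 1 < j
      · exact ⟨i + 1, h', (hstep i h').symm⟩
      · obtain rfl : i = j - 1 := by omega
        exact ⟨0, hj0, hlast.symm⟩
  · rintro ⟨i, hi, rfl⟩
    exact ⟨i, by rw [zpow_natCast, hpow i hi]⟩

theorem pow_injOn_minimalPeriod {γ : Perm V} {a : V} :
    Set.InjOn (fun i : ℕ => (γ ^ i) a) (Set.Iio (Function.minimalPeriod γ a)) := by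
  intro i hi j hj h
  have := Function.iterate_injOn_Iio_minimalPeriod (f := γ) (x := a) hi hj
  apply this
  simpa [← Perm.coe_pow] using h

theorem card_cut [Fintype V] [DecidableEq ι] {γ : Perm V} {a b : V} {j : ℕ} (hj0 : 0 < j)
    (hj : j < Function.minimalPeriod γ a) (hb : (γ ^ j) a = b) {ℓ : V → ι}
    (hℓ : IsLabelling (swap a b * γ) ℓ) : #{v | ℓ v = ℓ a} = j := by
  have : ({v | ℓ v = ℓ a} : Finset V) = (range j).image fun i => (γ ^ i) a := by
    ext v
    rw [mem_filter, eq_comm, hℓ, sameCycle_swap_mul_iff hj0 hj hb]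
    simp
  rw [this, card_image_of_injOn, card_range]
  intro x hx y hy hxy
  refine pow_injOn_minimalPeriod ?_ ?_ hxy
  · have := mem_range.1 (mem_coe.1 hx); exact this.trans hj
  · have := mem_range.1 (mem_coe.1 hy); exact this.trans hj

theorem sameCycle_iff_lt_minimalPeriod [Finite V] {γ : Perm V} {a y : V} :
    γ.SameCycle a y ↔ ∃ i < Function.minimalPeriod γ a, (γ ^ i) a = y := by
  constructor
  · intro h
    cases nonempty_fintype V
    obtain ⟨n, -, -, rfl⟩ := h.exists_pow_eq
    have hp : 0 < Function.minimalPeriod γ a :=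
      Function.minimalPeriod_pos_of_mem_periodicPts (Function.mem_periodicPts.2
        ⟨orderOf γ, orderOf_pos γ, by
          rw [Function.IsPeriodicPt, Function.IsFixedPt, ← Perm.coe_pow, pow_orderOf_eq_one]; rfl⟩)
    refine ⟨n % Function.minimalPeriod γ a, Nat.mod_lt _ hp, ?_⟩
    have := Function.iterate_mod_minimalPeriod_eq (f := γ) (x := a) (n := n)
    rwa [← Perm.coe_pow, ← Perm.coe_pow] at this
  · rintro ⟨i, -, rfl⟩
    exact ⟨i, by rw [zpow_natCast]⟩

theorem card_label_eq_minimalPeriod [Fintype V] [DecidableEq ι] {γ : Perm V} {a : V} {ℓ : V → ι}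
    (hℓ : IsLabelling γ ℓ) : #{v | ℓ v = ℓ a} = Function.minimalPeriod γ a := by
  have : ({v | ℓ v = ℓ a} : Finset V) =
      (range (Function.minimalPeriod γ a)).image fun i => (γ ^ i) a := by
    ext v
    rw [mem_filter, eq_comm, hℓ, sameCycle_iff_lt_minimalPeriod]
    simp
  rw [this, card_image_of_injOn, card_range]
  intro x hx y hy hxy
  exact pow_injOn_minimalPeriod (mem_range.1 (mem_coe.1 hx)) (mem_range.1 (mem_coe.1 hy)) hxy

theorem not_sameCycle_swap_mul [Finite V] {γ : Perm V} {a b : V} (hab : a ≠ b)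
    (h : γ.SameCycle a b) : ¬ (swap a b * γ).SameCycle a b := by
  obtain ⟨j, hj, hb⟩ := sameCycle_iff_lt_minimalPeriod.1 h
  have hj0 : 0 < j := by
    rcases Nat.eq_zero_or_pos j with rfl | h0
    · exact absurd hb hab
    · exact h0
  rw [sameCycle_swap_mul_iff hj0 hj hb]
  rintro ⟨i, hi, h'⟩
  exact hi.ne (pow_injOn_minimalPeriod (hi.trans hj) hj (h'.trans hb.symm))

theorem swap_mul_swap_mul' (γ : Perm V) (a b : V) : swap a b * (swap a b * γ) = γ := by
  rw [← mul_assoc, swap_mul_self, one_mul]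

theorem ncyc_swap_mul_of_sameCycle [Fintype V] {γ : Perm V} {a b : V} (hab : a ≠ b)
    (h : γ.SameCycle a b) : ncyc (swap a b * γ) = ncyc γ + 1 := by
  rw [← ncyc_swap_mul_of_not (not_sameCycle_swap_mul hab h), swap_mul_swap_mul']

end Cut

/-! ### Connectedness and the Riemann-Hurwitz inequality -/

section Connected

variable {V : Type*} [DecidableEq V]

/-- The product `τ_r ⋯ τ_1 σ`, for the list `[τ_r, …, τ_1]` of transpositions given as pairs. -/
def prodPerm (σ : Perm V) (L : List (V × V)) : Perm V :=
  (L.map fun p => swap p.1 p.2).prod * σ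

@[simp] theorem prodPerm_nil (σ : Perm V) : prodPerm σ [] = σ := by simp [prodPerm]

@[simp] theorem prodPerm_cons (σ : Perm V) (p : V × V) (L : List (V × V)) :
    prodPerm σ (p :: L) = swap p.1 p.2 * prodPerm σ L := by simp [prodPerm, mul_assoc]

/-- `A` is a union of orbits of the group generated by `σ` and the transpositions in `L`. -/
def Inv (σ : Perm V) (L : List (V × V)) (A : Finset V) : Prop :=
  (∀ x, σ x ∈ A ↔ x ∈ A) ∧ ∀ p ∈ L, p.1 ∈ A ↔ p.2 ∈ A

/-- `A` contains no union of orbits other than `∅` and `A`. -/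
def ConnOn (A : Finset V) (σ : Perm V) (L : List (V × V)) : Prop :=
  ∀ B ⊆ A, Inv σ L B → B = ∅ ∨ B = A

/-- The group generated by `σ` and the transpositions in `L` has at most one orbit. -/
def Conn [Fintype V] (σ : Perm V) (L : List (V × V)) : Prop := ConnOn univ σ L

theorem Inv.of_cons {σ : Perm V} {L : List (V × V)} {p : V × V} {A : Finset V}
    (h : Inv σ (p :: L) A) : Inv σ L A := ⟨h.1, fun q hq => h.2 q (List.mem_cons_of_mem _ hq)⟩

theorem inv_cons {σ : Perm V} {L : List (V × V)} {p : V × V} {A : Finset V} :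
    Inv σ (p :: L) A ↔ Inv σ L A ∧ (p.1 ∈ A ↔ p.2 ∈ A) := by
  simp only [Inv, List.forall_mem_cons]; tauto

theorem Inv.sdiff {σ : Perm V} {L : List (V × V)} {A B : Finset V}
    (hA : Inv σ L A) (hB : Inv σ L B) : Inv σ L (A \ B) := by
  refine ⟨fun x => ?_, fun p hp => ?_⟩
  · simp only [mem_sdiff, hA.1, hB.1]
  · simp only [mem_sdiff, hA.2 p hp, hB.2 p hp]

theorem inv_univ [Fintype V] (σ : Perm V) (L : List (V × V)) : Inv σ L univ := by
  simp [Inv]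

theorem Inv.compl [Fintype V] {σ : Perm V} {L : List (V × V)} {A : Finset V}
    (hA : Inv σ L A) : Inv σ L Aᶜ := by
  simpa [compl_eq_univ_sdiff] using (inv_univ σ L).sdiff hA

theorem Conn.cons [Fintype V] {σ : Perm V} {L : List (V × V)} {p : V × V}
    (h : Conn σ L) : Conn σ (p :: L) := fun B hB hi => h B hB hi.of_cons

/-- A transposition connects the data exactly when it links two orbits exhausting the points. -/
theorem conn_cons_and_not_iff [Fintype V] {σ : Perm V} {L : List (V × V)} {p : V × V} :
    (Conn σ (p :: L) ∧ ¬ Conn σ L) ↔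
      ∃ A, p.1 ∈ A ∧ p.2 ∉ A ∧ Inv σ L A ∧ ConnOn A σ L ∧ ConnOn Aᶜ σ L := by
  constructor
  · rintro ⟨h1, h2⟩
    have h1 : ∀ B, Inv σ L B → (p.1 ∈ B ↔ p.2 ∈ B) → B = ∅ ∨ B = univ := fun B hB hp =>
      h1 B (subset_univ _) (inv_cons.2 ⟨hB, hp⟩)
    have key : ∀ A, Inv σ L A → p.1 ∈ A → p.2 ∉ A →
        ∃ A, p.1 ∈ A ∧ p.2 ∉ A ∧ Inv σ L A ∧ ConnOn A σ L ∧ ConnOn Aᶜ σ L := by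
      intro A hA ha hb
      refine ⟨A, ha, hb, hA, ?_, ?_⟩
      · intro B hBA hB
        by_cases hBa : p.1 ∈ B
        · right
          rcases h1 (A \ B) (hA.sdiff hB) (by simp [hBa, hb]) with h | h
          · exact subset_antisymm hBA (sdiff_eq_empty_iff_subset.1 h)
          · have := h ▸ mem_univ p.2
            simp [hb] at this
        · rcases h1 B hB (by simpa [hBa] using fun h => hb (hBA h)) with h | h
          · exact Or.inl h
          · exact absurd (h ▸ mem_univ _) hBa
      · intro B hBA hB
        by_cases hBb : p.2 ∈ B
        · right
          rcases h1 (Aᶜ \ B) (hA.compl.sdiff hB) (by simp [hBb, ha]) with h | h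
          · exact subset_antisymm hBA (sdiff_eq_empty_iff_subset.1 h)
          · have := h ▸ mem_univ p.1
            simp [ha] at this
        · have hBa : p.1 ∉ B := fun h => by simpa [ha] using hBA h
          rcases h1 B hB (by simp [hBb, hBa]) with h | h
          · exact Or.inl h
          · exact absurd (h ▸ mem_univ _) hBb
    by_contra hcon
    apply h2
    intro B _ hB
    by_contra hne
    by_cases ha : p.1 ∈ B
    · by_cases hb : p.2 ∈ B
      · exact hne (h1 B hB (by simp [ha, hb]))
      · exact hcon (key B hB ha hb)
    · by_cases hb : p.2 ∈ B
      · have hB' := hB.compl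
        obtain ⟨A, hA⟩ := key _ hB' (by simpa using ha) (by simpa using hb)
        exact hcon ⟨A, hA⟩
      · exact hne (h1 B hB (by simp [ha, hb]))
  · rintro ⟨A, ha, hb, hA, hcA, hcB⟩
    constructor
    · intro B _ hB
      rw [inv_cons] at hB
      have hint : A \ (A \ B) = A ∩ B := by simp
      have hint' : Aᶜ \ (Aᶜ \ B) = Aᶜ ∩ B := by simp
      have h3 := hcA (A ∩ B) inter_subset_left (hint ▸ hA.sdiff (hA.sdiff hB.1))
      have h4 := hcB (Aᶜ ∩ B) inter_subset_left
        (hint' ▸ hA.compl.sdiff (hA.compl.sdiff hB.1))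
      have hp := hB.2
      rcases h3 with h3 | h3
      · have haB : p.1 ∉ B := fun h => by
          have : p.1 ∈ A ∩ B := mem_inter.2 ⟨ha, h⟩
          simp [h3] at this
        rcases h4 with h4 | h4
        · left
          ext x
          have e3 := Finset.ext_iff.1 h3 x
          have e4 := Finset.ext_iff.1 h4 x
          simp at e3 e4 ⊢
          tauto
        · have : p.2 ∈ Aᶜ ∩ B := by rw [h4]; simpa using hb
          exact absurd (hp.2 (mem_inter.1 this).2) haB
      · have haB : p.1 ∈ B := by
          have : p.1 ∈ A ∩ B := by rw [h3]; exact ha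
          exact (mem_inter.1 this).2
        rcases h4 with h4 | h4
        · have : p.2 ∈ Aᶜ ∩ B := mem_inter.2 ⟨by simpa using hb, hp.1 haB⟩
          simp [h4] at this
        · right
          ext x
          have e3 := Finset.ext_iff.1 h3 x
          have e4 := Finset.ext_iff.1 h4 x
          simp at e3 e4 ⊢
          tauto
    · intro h
      rcases h A (subset_univ _) hA with h | h
      · simp [h] at ha
      · simp [h] at hb

/-- The orbit in `conn_cons_and_not_iff` is unique, so that sums over it count every transposition
once. -/
theorem unique_of_conn_cons [Fintype V] {σ : Perm V} {L : List (V × V)} {p : V × V}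
    {A B : Finset V} (hA : p.1 ∈ A ∧ p.2 ∉ A ∧ Inv σ L A ∧ ConnOn A σ L ∧ ConnOn Aᶜ σ L)
    (hB : p.1 ∈ B ∧ p.2 ∉ B ∧ Inv σ L B ∧ ConnOn B σ L ∧ ConnOn Bᶜ σ L) : A = B := by
  have key : ∀ {A B : Finset V},
      (p.1 ∈ A ∧ p.2 ∉ A ∧ Inv σ L A ∧ ConnOn A σ L ∧ ConnOn Aᶜ σ L) →
      (p.1 ∈ B ∧ p.2 ∉ B ∧ Inv σ L B ∧ ConnOn B σ L ∧ ConnOn Bᶜ σ L) → A ⊆ B := by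
    intro A B hA hB
    have hint : A \ (A \ B) = A ∩ B := by simp
    rcases hA.2.2.2.1 (A ∩ B) inter_subset_left
      (hint ▸ hA.2.2.1.sdiff (hA.2.2.1.sdiff hB.2.2.1)) with h | h
    · have : p.1 ∈ A ∩ B := mem_inter.2 ⟨hA.1, hB.1⟩
      simp [h] at this
    · exact inter_eq_left.1 h
  exact subset_antisymm (key hA hB) (key hB hA)

/-- The orbit relation of the group generated by `σ` and the transpositions in `L`. -/
noncomputable def orbitRel (σ : Perm V) : List (V × V) → Setoid V
  | [] => Perm.SameCycle.setoid σ
  | p :: L => Setoid.ker (mergeLabel (Quotient.mk (orbitRel σ L)) p.1 p.2)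

theorem orbitRel_le_cons (σ : Perm V) (p : V × V) (L : List (V × V)) {x y : V}
    (h : orbitRel σ L x y) : orbitRel σ (p :: L) x y := by
  change mergeLabel _ _ _ _ = mergeLabel _ _ _ _
  rw [mergeLabel_eq_iff]
  exact Or.inl (Quotient.sound h)

theorem orbitRel_cons (σ : Perm V) (p : V × V) (L : List (V × V)) :
    orbitRel σ (p :: L) p.1 p.2 := by
  change mergeLabel _ _ _ _ = mergeLabel _ _ _ _
  rw [mergeLabel_eq_iff]
  simp

theorem orbitRel_apply (σ : Perm V) (L : List (V × V)) (x : V) : orbitRel σ L x (σ x) := by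
  induction L with
  | nil => exact Perm.sameCycle_apply_right.2 (SameCycle.refl _ _)
  | cons p L ih => exact orbitRel_le_cons σ p L ih

theorem orbitRel_of_mem (σ : Perm V) (L : List (V × V)) (p : V × V) (hp : p ∈ L) :
    orbitRel σ L p.1 p.2 := by
  induction L with
  | nil => simp at hp
  | cons q L ih =>
    rcases List.mem_cons.1 hp with rfl | h
    · exact orbitRel_cons σ p L
    · exact orbitRel_le_cons σ q L (ih h)

theorem orbitRel_prodPerm (σ : Perm V) (L : List (V × V)) (x : V) :
    orbitRel σ L x (prodPerm σ L x) := by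
  induction L with
  | nil => exact orbitRel_apply σ [] x
  | cons p L ih =>
    have h1 := orbitRel_le_cons σ p L ih
    rw [prodPerm_cons, Perm.mul_apply, swap_apply_def]
    split_ifs with h2 h3
    · rw [h2] at h1
      exact Setoid.trans' _ h1 (orbitRel_cons σ p L)
    · rw [h3] at h1
      exact Setoid.trans' _ h1 (Setoid.symm' _ (orbitRel_cons σ p L))
    · exact h1

/-- The Riemann-Hurwitz inequality. Each transposition changes the number of cycles of the product
by one; it can lower this number without merging orbits, but it raises it only inside an orbit. -/
theorem ncyc_add_ncyc_le [Fintype V] (σ : Perm V) (L : List (V × V)) (hL : ∀ p ∈ L, p.1 ≠ p.2) :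
    ncyc σ + ncyc (prodPerm σ L) ≤ L.length + 2 * Nat.card (Quotient (orbitRel σ L)) := by
  classical
  induction L with
  | nil =>
    have := ncyc_eq_card_image (isLabelling_mk σ)
    rw [image_univ_of_surjective Quotient.mk_surjective, card_univ,
      ← Nat.card_eq_fintype_card] at this
    rw [prodPerm_nil, this]
    change _ ≤ 0 + 2 * Nat.card (Quotient (Perm.SameCycle.setoid σ))
    omega
  | cons p L ih =>
    have ih := ih fun q hq => hL q (List.mem_cons_of_mem _ hq)
    have hp := hL p List.mem_cons_self
    have hcard : ∀ {β : Type _} [DecidableEq β] (f : V → β), Nat.card (Quotient (Setoid.ker f)) =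
        #(univ.image f) := by
      intro β _ f
      rw [Nat.card_congr (Setoid.quotientKerEquivRange f), ← Set.ncard_coe_finset,
        Nat.card_coe_set_eq, coe_image, coe_univ, Set.image_univ]
    rw [prodPerm_cons, List.length_cons]
    have h0 : Nat.card (Quotient (orbitRel σ L)) =
        #(univ.image (Quotient.mk (orbitRel σ L))) := by
      rw [image_univ_of_surjective Quotient.mk_surjective, card_univ,
        ← Nat.card_eq_fintype_card]
    have h1 : Nat.card (Quotient (orbitRel σ (p :: L))) = #(univ.image
        (mergeLabel (Quotient.mk (orbitRel σ L)) p.1 p.2)) := hcard _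
    by_cases hs : (prodPerm σ L).SameCycle p.1 p.2
    · have hle : Nat.card (Quotient (orbitRel σ (p :: L))) =
          Nat.card (Quotient (orbitRel σ L)) := by
        have hrel : orbitRel σ L p.1 p.2 :=
          SameCycle.of_rel _ (orbitRel_prodPerm σ L) hs
        have : mergeLabel (Quotient.mk (orbitRel σ L)) p.1 p.2 =
            Quotient.mk (orbitRel σ L) := by
          funext v
          unfold mergeLabel
          split_ifs with hv
          · rw [hv, Quotient.eq]; exact hrel
          · rfl
        rw [h1, this, h0]
      rw [ncyc_swap_mul_of_sameCycle hp hs, hle]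
      omega
    · have h2 := ncyc_swap_mul_of_not hs
      by_cases hrel : (Quotient.mk (orbitRel σ L)) p.1 = (Quotient.mk (orbitRel σ L)) p.2
      · have : mergeLabel (Quotient.mk (orbitRel σ L)) p.1 p.2 =
            Quotient.mk (orbitRel σ L) := by
          funext v
          unfold mergeLabel
          split_ifs with hv
          · rw [hv, hrel]
          · rfl
        rw [h1, this, ← h0]
        omega
      · rw [image_mergeLabel hrel] at h1
        have := card_erase_add_one
          (mem_image_of_mem (Quotient.mk (orbitRel σ L)) (mem_univ p.2))
        omega

/-- The genus of connected data is nonnegative. -/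
theorem Conn.ncyc_add_ncyc_le [Fintype V] {σ : Perm V} {L : List (V × V)} (h : Conn σ L)
    (hL : ∀ p ∈ L, p.1 ≠ p.2) : ncyc σ + ncyc (prodPerm σ L) ≤ L.length + 2 := by
  classical
  refine (DoubleHurwitz.ncyc_add_ncyc_le σ L hL).trans ?_
  have : Nat.card (Quotient (orbitRel σ L)) ≤ 1 := by
    rw [Nat.card_eq_fintype_card, Fintype.card_le_one_iff]
    intro x y
    induction x using Quotient.inductionOn with | _ x
    induction y using Quotient.inductionOn with | _ y
    rw [Quotient.eq]
    have hA : Inv σ L ({z | orbitRel σ L x z} : Finset V) := by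
      refine ⟨fun z => ?_, fun p hp => ?_⟩
      · have hz := orbitRel_apply σ L z
        simp only [mem_filter, mem_univ, true_and]
        exact ⟨fun h => Setoid.trans' _ h (Setoid.symm' _ hz), fun h => Setoid.trans' _ h hz⟩
      · have hz := orbitRel_of_mem σ L p hp
        simp only [mem_filter, mem_univ, true_and]
        exact ⟨fun h => Setoid.trans' _ h hz, fun h => Setoid.trans' _ h (Setoid.symm' _ hz)⟩
    rcases h _ (subset_univ _) hA with h | h
    · have : x ∈ ({z | orbitRel σ L x z} : Finset V) := by
        simp
      simp [h] at this
    · have := h ▸ mem_univ y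
      exact (mem_filter.1 this).2
  omega

end Connected

/-! ### Lists of transpositions and their shuffles -/

section Lists

variable {T T' : Type*}

/-- Prepending an entry to a list. -/
def consEmb : T × List T ↪ List T where
  toFun p := p.1 :: p.2
  inj' _ _ h := Prod.ext (List.cons.inj h).1 (List.cons.inj h).2

@[simp] theorem consEmb_apply (p : T × List T) : consEmb p = p.1 :: p.2 := rfl

/-- The lists of length `r` with entries in `s`. -/
def listsOf (s : Finset T) : ℕ → Finset (List T)
  | 0 => {[]}
  | r + 1 => (s ×ˢ listsOf s r).map consEmb

variable {M : Type*} [AddCommMonoid M]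

@[simp] theorem sum_listsOf_zero (s : Finset T) (f : List T → M) :
    ∑ L ∈ listsOf s 0, f L = f [] := by simp [listsOf]

theorem sum_listsOf_succ (s : Finset T) (r : ℕ) (f : List T → M) :
    ∑ L ∈ listsOf s (r + 1), f L = ∑ t ∈ s, ∑ L ∈ listsOf s r, f (t :: L) := by
  simp [listsOf, sum_product]

theorem mem_listsOf {s : Finset T} {r : ℕ} {L : List T} :
    L ∈ listsOf s r ↔ L.length = r ∧ ∀ t ∈ L, t ∈ s := by
  induction r generalizing L with
  | zero =>
    simp only [listsOf, mem_singleton, List.length_eq_zero_iff]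
    constructor
    · rintro rfl; simp
    · exact fun h => h.1
  | succ r ih =>
    cases L with
    | nil => simp [listsOf]
    | cons t L =>
      simp only [listsOf, mem_map, mem_product, consEmb_apply, Prod.exists,
        List.cons.injEq, List.length_cons, List.forall_mem_cons]
      constructor
      · rintro ⟨a, b, ⟨h1, h2⟩, rfl, rfl⟩
        rw [ih] at h2
        exact ⟨by omega, h1, h2.2⟩
      · rintro ⟨h1, h2, h3⟩
        exact ⟨t, L, ⟨h2, ih.2 ⟨by omega, h3⟩⟩, rfl, rfl⟩

theorem sum_listsOf_map (s : Finset T) (e : T ↪ T') (r : ℕ) (f : List T' → M) :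
    ∑ L ∈ listsOf (s.map e) r, f L = ∑ L ∈ listsOf s r, f (L.map e) := by
  induction r generalizing f with
  | zero => simp
  | succ r ih => simp [sum_listsOf_succ, ih]

theorem filter_listsOf (s : Finset T) (p : T → Prop) [DecidablePred p] (r : ℕ)
    [DecidablePred fun L : List T => ∀ t ∈ L, p t] :
    (listsOf s r).filter (fun L => ∀ t ∈ L, p t) = listsOf (s.filter p) r := by
  ext L
  simp only [mem_filter, mem_listsOf]
  grind

/-- The subsequence of entries of the first kind. -/
def lefts (L : List (T ⊕ T')) : List T := L.filterMap Sum.getLeft?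

/-- The subsequence of entries of the second kind. -/
def rights (L : List (T ⊕ T')) : List T' := L.filterMap Sum.getRight?

@[simp] theorem lefts_nil : lefts ([] : List (T ⊕ T')) = [] := rfl
@[simp] theorem rights_nil : rights ([] : List (T ⊕ T')) = [] := rfl
@[simp] theorem lefts_cons_inl (t : T) (L : List (T ⊕ T')) :
    lefts (.inl t :: L) = t :: lefts L := rfl
@[simp] theorem lefts_cons_inr (t : T') (L : List (T ⊕ T')) :
    lefts (.inr t :: L) = lefts L := rfl
@[simp] theorem rights_cons_inl (t : T) (L : List (T ⊕ T')) :
    rights (.inl t :: L) = rights L := rfl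
@[simp] theorem rights_cons_inr (t : T') (L : List (T ⊕ T')) :
    rights (.inr t :: L) = t :: rights L := rfl

/-- Lists in two alphabets are shuffles of a list in the first and a list in the second. -/
theorem sum_listsOf_disjSum {R : Type*} [CommSemiring R] (s : Finset T) (t : Finset T') (r : ℕ)
    (f : List T → List T' → R) :
    ∑ L ∈ listsOf (s.disjSum t) r, f (lefts L) (rights L) =
      ∑ ij ∈ antidiagonal r, (r.choose ij.1 : R) *
        ∑ L₁ ∈ listsOf s ij.1, ∑ L₂ ∈ listsOf t ij.2, f L₁ L₂ := by
  induction r generalizing f with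
  | zero => simp
  | succ r ih =>
    rw [sum_listsOf_succ, sum_disjSum, sum_antidiagonal_choose_succ_mul
      (fun i j => ∑ L₁ ∈ listsOf s i, ∑ L₂ ∈ listsOf t j, f L₁ L₂), add_comm]
    congr 1
    · simp only [lefts_cons_inr, rights_cons_inr]
      rw [sum_congr rfl fun b _ => ih (fun L₁ L₂ => f L₁ (b :: L₂)), sum_comm]
      refine sum_congr rfl fun ij _ => ?_
      rw [← mul_sum, sum_comm]
      simp only [sum_listsOf_succ]
    · simp only [lefts_cons_inl, rights_cons_inl]
      rw [sum_congr rfl fun b _ => ih (fun L₁ L₂ => f (b :: L₁) L₂), sum_comm]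
      refine sum_congr rfl fun ij hij => ?_
      rw [← mul_sum, sum_listsOf_succ, Nat.choose_symm_of_eq_add (mem_antidiagonal.1 hij).symm]

end Lists

/-! ### Permutations of a disjoint union -/

section SumType

variable {X Y : Type*} [DecidableEq X] [DecidableEq Y]

theorem sumCongr_zpow (σ : Perm X) (τ : Perm Y) (n : ℤ) :
    (Perm.sumCongr σ τ) ^ n = Perm.sumCongr (σ ^ n) (τ ^ n) :=
  (map_zpow (Perm.sumCongrHom X Y) (σ, τ) n).symm

theorem sameCycle_sumCongr_inl {σ : Perm X} {τ : Perm Y} {x y : X} :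
    SameCycle (Perm.sumCongr σ τ) (Sum.inl x : X ⊕ Y) (Sum.inl y) ↔ σ.SameCycle x y := by
  simp [SameCycle, sumCongr_zpow]

theorem sameCycle_sumCongr_inr {σ : Perm X} {τ : Perm Y} {x y : Y} :
    SameCycle (Perm.sumCongr σ τ) (Sum.inr x : X ⊕ Y) (Sum.inr y) ↔ τ.SameCycle x y := by
  simp [SameCycle, sumCongr_zpow]

theorem not_sameCycle_sumCongr_inl_inr {σ : Perm X} {τ : Perm Y} {x : X} {y : Y} :
    ¬ SameCycle (Perm.sumCongr σ τ) (Sum.inl x : X ⊕ Y) (Sum.inr y) := by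
  simp [SameCycle, sumCongr_zpow]

theorem not_sameCycle_sumCongr_inr_inl {σ : Perm X} {τ : Perm Y} {x : X} {y : Y} :
    ¬ SameCycle (Perm.sumCongr σ τ) (Sum.inr y : X ⊕ Y) (Sum.inl x) := by
  simp [SameCycle, sumCongr_zpow]

theorem parts_sumCongr [Fintype X] [Fintype Y] (σ : Perm X) (τ : Perm Y) :
    (Perm.partition (Perm.sumCongr σ τ : Perm (X ⊕ Y))).parts =
      σ.partition.parts + τ.partition.parts := by
  classical
  have h1 := isLabelling_mk σ
  have h2 := isLabelling_mk τ
  have h : IsLabelling (Perm.sumCongr σ τ : Perm (X ⊕ Y)) (Sum.map (Quotient.mk (SameCycle.setoid σ))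
      (Quotient.mk (SameCycle.setoid τ))) := by
    rintro (x | x) (y | y)
    · rw [sameCycle_sumCongr_inl, ← h1 x y]; simp
    · simp [not_sameCycle_sumCongr_inl_inr]
    · simp [not_sameCycle_sumCongr_inr_inl]
    · rw [sameCycle_sumCongr_inr, ← h2 x y]; simp
  have him : univ.image (Sum.map (Quotient.mk (SameCycle.setoid σ))
      (Quotient.mk (SameCycle.setoid τ))) = (univ.image (Quotient.mk (SameCycle.setoid σ))).disjSum
        (univ.image (Quotient.mk (SameCycle.setoid τ))) := by
    ext (i | i) <;> simp
  rw [parts_eq_of_isLabelling h, parts_eq_of_isLabelling h1, parts_eq_of_isLabelling h2, him,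
    Finset.val_disjSum, Multiset.disjSum, Multiset.map_add, Multiset.map_map, Multiset.map_map]
  congr 1
  · refine Multiset.map_congr rfl fun i _ => ?_
    rw [Function.comp, ← card_map (Function.Embedding.inl : X ↪ X ⊕ Y)]
    congr 1
    ext (v | v) <;> simp
  · refine Multiset.map_congr rfl fun i _ => ?_
    rw [Function.comp, ← card_map (Function.Embedding.inr : Y ↪ X ⊕ Y)]
    congr 1
    ext (v | v) <;> simp

/-- A pair of points of one of the two parts, seen in the disjoint union. -/
def pairIncl : (X × X) ⊕ (Y × Y) ↪ (X ⊕ Y) × (X ⊕ Y) where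
  toFun := Sum.elim (fun p => (.inl p.1, .inl p.2)) fun p => (.inr p.1, .inr p.2)
  inj' := by rintro (⟨a, b⟩ | ⟨a, b⟩) (⟨c, d⟩ | ⟨c, d⟩) <;> simp

@[simp] theorem pairIncl_inl (p : X × X) :
    pairIncl (Y := Y) (.inl p) = (.inl p.1, .inl p.2) := rfl
@[simp] theorem pairIncl_inr (p : Y × Y) :
    pairIncl (X := X) (.inr p) = (.inr p.1, .inr p.2) := rfl

theorem offDiag_filter_sum [Fintype X] [Fintype Y] :
    (univ : Finset (X ⊕ Y)).offDiag.filter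
        (fun p => p.1 ∈ univ.map Function.Embedding.inl ↔ p.2 ∈ univ.map Function.Embedding.inl) =
      (((univ : Finset X).offDiag).disjSum (univ : Finset Y).offDiag).map pairIncl := by
  ext ⟨a | a, b | b⟩ <;> simp

theorem prodPerm_sum (σ : Perm X) (τ : Perm Y) (L : List ((X × X) ⊕ (Y × Y))) :
    prodPerm (Perm.sumCongr σ τ) (L.map pairIncl) =
      Perm.sumCongr (prodPerm σ (lefts L)) (prodPerm τ (rights L)) := by
  induction L with
  | nil => simp
  | cons p L ih =>
    rcases p with p | p
    · simp only [List.map_cons, prodPerm_cons, ih, lefts_cons_inl, rights_cons_inl, pairIncl_inl]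
      rw [← Perm.sumCongr_swap_refl, Perm.sumCongr_mul]; rfl
    · simp only [List.map_cons, prodPerm_cons, ih, lefts_cons_inr, rights_cons_inr, pairIncl_inr]
      rw [← Perm.sumCongr_refl_swap, Perm.sumCongr_mul]; rfl

theorem inv_sum (σ : Perm X) (τ : Perm Y) (L : List ((X × X) ⊕ (Y × Y))) (A : Finset X)
    (B : Finset Y) : Inv (Perm.sumCongr σ τ) (L.map pairIncl) (A.disjSum B) ↔
      Inv σ (lefts L) A ∧ Inv τ (rights L) B := by
  induction L with
  | nil => simp [Inv]
  | cons p L ih =>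
    rcases p with p | p
    · simp only [List.map_cons, inv_cons, ih, lefts_cons_inl, rights_cons_inl, pairIncl_inl,
        inl_mem_disjSum]
      tauto
    · simp only [List.map_cons, inv_cons, ih, lefts_cons_inr, rights_cons_inr, pairIncl_inr,
        inr_mem_disjSum]
      tauto

theorem inv_empty {V : Type*} [DecidableEq V] (σ : Perm V) (L : List (V × V)) :
    Inv σ L ∅ := by simp [Inv]

theorem connOn_sum_left [Fintype X] [Fintype Y] (σ : Perm X) (τ : Perm Y)
    (L : List ((X × X) ⊕ (Y × Y))) :
    ConnOn (univ.map Function.Embedding.inl) (Perm.sumCongr σ τ) (L.map pairIncl) ↔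
      Conn σ (lefts L) := by
  have hd : ∀ A : Finset X, A.map (Function.Embedding.inl (β := Y)) = A.disjSum ∅ := by
    intro A; simp
  constructor
  · intro h B _ hB
    have := h (B.disjSum ∅) (by rw [← hd]; exact map_subset_map.2 (subset_univ _))
      ((inv_sum ..).2 ⟨hB, inv_empty _ _⟩)
    rw [← hd, map_eq_empty, map_inj] at this
    exact this
  · intro h B hB hi
    obtain ⟨B', -, rfl⟩ := subset_map_iff.1 hB
    rw [hd, inv_sum] at hi
    rw [map_eq_empty, map_inj]
    exact h B' (subset_univ _) hi.1

theorem connOn_sum_right [Fintype X] [Fintype Y] (σ : Perm X) (τ : Perm Y)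
    (L : List ((X × X) ⊕ (Y × Y))) :
    ConnOn (univ.map Function.Embedding.inl)ᶜ (Perm.sumCongr σ τ) (L.map pairIncl) ↔
      Conn τ (rights L) := by
  have hc : (univ.map (Function.Embedding.inl : X ↪ X ⊕ Y))ᶜ =
      univ.map (Function.Embedding.inr : Y ↪ X ⊕ Y) := by
    ext (x | x) <;> simp
  have hd : ∀ A : Finset Y, A.map (Function.Embedding.inr (α := X)) = (∅ : Finset X).disjSum A := by
    intro A; simp
  rw [hc]
  constructor
  · intro h B _ hB
    have := h ((∅ : Finset X).disjSum B) (by rw [← hd]; exact map_subset_map.2 (subset_univ _))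
      ((inv_sum ..).2 ⟨inv_empty _ _, hB⟩)
    rw [← hd, map_eq_empty, map_inj] at this
    exact this
  · intro h B hB hi
    obtain ⟨B', -, rfl⟩ := subset_map_iff.1 hB
    rw [hd, inv_sum] at hi
    rw [map_eq_empty, map_inj]
    exact h B' (subset_univ _) hi.2

theorem sameCycle_join_iff {V : Type*} [Finite V] [DecidableEq V] {γ : Perm V} {a b : V}
    (h : ¬ γ.SameCycle a b) (x y : V) : (swap a b * γ).SameCycle x y ↔
      γ.SameCycle x y ∨ ((γ.SameCycle x a ∨ γ.SameCycle x b) ∧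
        (γ.SameCycle y a ∨ γ.SameCycle y b)) := by
  have hl := isLabelling_mk γ
  have := hl.merge (a := a) (b := b) (fun h' => h ((hl _ _).1 h'))
  rw [← this x y, mergeLabel_eq_iff]
  simp only [hl _ _]

/-- Labellings of a join of two cycles from different parts. -/
theorem isLabelling_join_iff {ι : Type*} [DecidableEq ι] [Fintype X] [Fintype Y] {σ : Perm X}
    {τ : Perm Y} {a : X} {b : Y} {ℓ₁ : X → ι} {ℓ₂ : Y → ι} :
    IsLabelling (swap (Sum.inl a) (Sum.inr b) * Perm.sumCongr σ τ) (Sum.elim ℓ₁ ℓ₂) ↔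
      IsLabelling σ ℓ₁ ∧ IsLabelling τ ℓ₂ ∧ ℓ₁ a = ℓ₂ b ∧
        univ.image ℓ₁ ∩ univ.image ℓ₂ = {ℓ₁ a} := by
  have hs := sameCycle_join_iff (γ := (Perm.sumCongr σ τ : Perm (X ⊕ Y)))
    (not_sameCycle_sumCongr_inl_inr (x := a) (y := b))
  have e1 : ∀ x y : X, SameCycle (swap (Sum.inl a) (Sum.inr b) * Perm.sumCongr σ τ : Perm (X ⊕ Y))
      (Sum.inl x) (Sum.inl y) ↔ σ.SameCycle x y := by
    intro x y
    rw [hs]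
    simp only [sameCycle_sumCongr_inl, not_sameCycle_sumCongr_inl_inr, or_false]
    exact ⟨fun h => h.elim id fun h => h.1.trans h.2.symm, Or.inl⟩
  have e2 : ∀ x y : Y, SameCycle (swap (Sum.inl a) (Sum.inr b) * Perm.sumCongr σ τ : Perm (X ⊕ Y))
      (Sum.inr x) (Sum.inr y) ↔ τ.SameCycle x y := by
    intro x y
    rw [hs]
    simp only [sameCycle_sumCongr_inr, not_sameCycle_sumCongr_inr_inl, false_or]
    exact ⟨fun h => h.elim id fun h => h.1.trans h.2.symm, Or.inl⟩
  have e3 : ∀ (x : X) (y : Y),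
      SameCycle (swap (Sum.inl a) (Sum.inr b) * Perm.sumCongr σ τ : Perm (X ⊕ Y))
      (Sum.inl x) (Sum.inr y) ↔ σ.SameCycle x a ∧ τ.SameCycle y b := by
    intro x y
    rw [hs]
    simp only [sameCycle_sumCongr_inr, sameCycle_sumCongr_inl, not_sameCycle_sumCongr_inr_inl,
      not_sameCycle_sumCongr_inl_inr, false_or, or_false]
  have e4 : ∀ (x : X) (y : Y),
      SameCycle (swap (Sum.inl a) (Sum.inr b) * Perm.sumCongr σ τ : Perm (X ⊕ Y))
      (Sum.inr y) (Sum.inl x) ↔ σ.SameCycle x a ∧ τ.SameCycle y b := by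
    intro x y
    rw [sameCycle_comm, e3]
  constructor
  · intro h
    have h1 : IsLabelling σ ℓ₁ := fun x y => by rw [← e1, ← h]; rfl
    have h2 : IsLabelling τ ℓ₂ := fun x y => by rw [← e2, ← h]; rfl
    have h3 : ∀ x y, ℓ₁ x = ℓ₂ y ↔ σ.SameCycle x a ∧ τ.SameCycle y b := fun x y => by
      rw [← e3, ← h]; rfl
    have hab := (h3 a b).2 ⟨SameCycle.refl _ _, SameCycle.refl _ _⟩
    refine ⟨h1, h2, hab, ?_⟩
    ext i
    simp only [mem_inter, mem_image, mem_univ, true_and, mem_singleton]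
    constructor
    · rintro ⟨⟨x, rfl⟩, y, hy⟩
      exact (h1 _ _).2 ((h3 x y).1 hy.symm).1
    · rintro rfl
      exact ⟨⟨a, rfl⟩, b, hab.symm⟩
  · rintro ⟨h1, h2, hab, hi⟩
    have h3 : ∀ x y, ℓ₁ x = ℓ₂ y ↔ σ.SameCycle x a ∧ τ.SameCycle y b := by
      intro x y
      constructor
      · intro hxy
        have : ℓ₁ x ∈ univ.image ℓ₁ ∩ univ.image ℓ₂ := by
          rw [mem_inter]
          exact ⟨mem_image_of_mem _ (mem_univ _), hxy ▸ mem_image_of_mem _ (mem_univ _)⟩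
        rw [hi, mem_singleton] at this
        exact ⟨(h1 _ _).1 this, (h2 _ _).1 (by rw [← hxy, this, hab])⟩
      · rintro ⟨hx, hy⟩
        rw [(h1 _ _).2 hx, (h2 _ _).2 hy, hab]
    rintro (x | x) (y | y)
    · rw [e1, ← h1]; rfl
    · rw [e3, ← h3]; rfl
    · rw [e4, ← h3, eq_comm]; rfl
    · rw [e2, ← h2]; rfl

end SumType

/-! ### Cuts and joins of permutations with labelled cycles -/

section Labelled

variable {m : ℕ} {V : Type*} [Fintype V] [DecidableEq V]

/-- The monomial `∏_v w_{ℓ(v)}` recording the sizes of the classes of a labelling. -/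
noncomputable def mon (ℓ : V → Fin m) : Series m := ∏ v, w (ℓ v)

open Classical in
/-- The labellings of the cycles of `γ` with set of labels `α`. -/
noncomputable def labs (γ : Perm V) (α : Finset (Fin m)) : Finset (V → Fin m) :=
  {ℓ | IsLabelling γ ℓ ∧ univ.image ℓ = α}

theorem mem_labs {γ : Perm V} {α : Finset (Fin m)} {ℓ : V → Fin m} :
    ℓ ∈ labs γ α ↔ IsLabelling γ ℓ ∧ univ.image ℓ = α := by
  classical
  rw [labs, mem_filter]
  simp

/-- The generating polynomial of the labellings of the cycles of `γ` by `α`. -/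
noncomputable def labSum (γ : Perm V) (α : Finset (Fin m)) : Series m := ∑ ℓ ∈ labs γ α, mon ℓ

/-- The generating polynomial of the labellings with a chosen point in the cycle labelled `i`. -/
noncomputable def labSumD (γ : Perm V) (α : Finset (Fin m)) (i : Fin m) : Series m :=
  ∑ ℓ ∈ labs γ α, (#{v | ℓ v = i} : Series m) * mon ℓ

theorem ncyc_of_mem_labs {γ : Perm V} {α : Finset (Fin m)} {ℓ : V → Fin m} (h : ℓ ∈ labs γ α) :
    ncyc γ = #α := by
  rw [mem_labs] at h
  rw [ncyc_eq_card_image h.1, h.2]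

theorem labSum_eq_zero {γ : Perm V} {α : Finset (Fin m)} (h : ncyc γ ≠ #α) : labSum γ α = 0 :=
  sum_eq_zero fun _ hℓ => absurd (ncyc_of_mem_labs hℓ) h

theorem labSumD_eq (γ : Perm V) (α : Finset (Fin m)) (i : Fin m) :
    labSumD γ α i = ∑ a, ∑ ℓ ∈ labs γ α with ℓ a = i, mon ℓ := by
  simp only [sum_filter]
  rw [sum_comm]
  refine sum_congr rfl fun ℓ _ => ?_
  rw [← sum_filter, sum_const, nsmul_eq_mul]

/-- The ways to write a set of labels as a union of two sets with one common label. -/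
def splits (α : Finset (Fin m)) : Finset (Finset (Fin m) × Finset (Fin m) × Fin m) :=
  {t | t.1 ∪ t.2.1 = α ∧ t.1 ∩ t.2.1 = {t.2.2}}

theorem mem_splits {α : Finset (Fin m)} {t : Finset (Fin m) × Finset (Fin m) × Fin m} :
    t ∈ splits α ↔ t.1 ∪ t.2.1 = α ∧ t.1 ∩ t.2.1 = {t.2.2} := by
  simp [splits]

theorem mon_sum {X Y : Type*} [Fintype X] [Fintype Y] (ℓ₁ : X → Fin m) (ℓ₂ : Y → Fin m) :
    mon (Sum.elim ℓ₁ ℓ₂) = mon ℓ₁ * mon ℓ₂ := by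
  simp [mon]

/-- A transposition of a point `a` of `X` and a point `b` of `Y` joins their cycles. A labelling of
the join restricts to labellings of both parts that share just the label of this cycle. -/
theorem sum_labSum_join {X Y : Type*} [Fintype X] [Fintype Y] [DecidableEq X] [DecidableEq Y]
    (σ : Perm X) (τ : Perm Y) (α : Finset (Fin m)) :
    ∑ a, ∑ b, labSum (swap (Sum.inl a) (Sum.inr b) * Perm.sumCongr σ τ) α =
      ∑ t ∈ splits α, labSumD σ t.1 t.2.2 * labSumD τ t.2.1 t.2.2 := by
  simp only [labSumD_eq, sum_mul_sum]
  symm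
  rw [sum_comm]
  refine sum_congr rfl fun a _ => ?_
  rw [sum_comm]
  refine sum_congr rfl fun b _ => ?_
  rw [sum_congr rfl fun t _ => (sum_product' _ _ _).symm, sum_sigma']
  refine sum_bij' (fun x _ => Sum.elim x.2.1 x.2.2)
    (fun ℓ _ => ⟨(univ.image (ℓ ∘ Sum.inl), univ.image (ℓ ∘ Sum.inr), ℓ (.inl a)),
      (ℓ ∘ Sum.inl, ℓ ∘ Sum.inr)⟩) ?_ ?_ ?_ ?_ ?_
  · rintro ⟨⟨β, ζ, i⟩, ℓ₁, ℓ₂⟩ h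
    simp only [mem_sigma, mem_splits, mem_product, mem_filter, mem_labs] at h
    obtain ⟨⟨h1, h2⟩, ⟨⟨h3, h4⟩, h5⟩, ⟨h6, h7⟩, h8⟩ := h
    rw [mem_labs, isLabelling_join_iff]
    refine ⟨⟨h3, h6, h5.trans h8.symm, by rw [h4, h7, h2]; exact congrArg _ h5.symm⟩, ?_⟩
    rw [← h1, ← h4, ← h7]
    ext i; simp
  · intro ℓ h
    obtain ⟨ℓ₁, ℓ₂, rfl⟩ : ∃ ℓ₁ ℓ₂, ℓ = Sum.elim ℓ₁ ℓ₂ := ⟨_, _, (Sum.elim_comp_inl_inr ℓ).symm⟩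
    rw [mem_labs, isLabelling_join_iff] at h
    obtain ⟨⟨h1, h2, h3, h4⟩, h5⟩ := h
    simp only [mem_sigma, mem_splits, mem_product, mem_filter, mem_labs, Sum.elim_comp_inl,
      Sum.elim_comp_inr, Sum.elim_inl]
    refine ⟨⟨?_, h4⟩, ⟨⟨h1, trivial⟩, trivial⟩, ⟨h2, trivial⟩, h3.symm⟩
    rw [← h5]
    ext i; simp
  · rintro ⟨⟨β, ζ, i⟩, ℓ₁, ℓ₂⟩ h
    simp only [mem_sigma, mem_splits, mem_product, mem_filter, mem_labs] at h
    obtain ⟨⟨h1, h2⟩, ⟨⟨h3, h4⟩, h5⟩, ⟨h6, h7⟩, h8⟩ := h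
    simp [h4, h7, h5]
  · intro ℓ _
    simp
  · rintro ⟨⟨β, ζ, i⟩, ℓ₁, ℓ₂⟩ _
    rw [mon_sum]

/-- The generating polynomial of the ways to cut a cycle of `γ` by a transposition into cycles
labelled `k` and `l`. -/
noncomputable def cutSum (γ : Perm V) (α : Finset (Fin m)) (k l : Fin m) : Series m :=
  ∑ p ∈ univ.offDiag with γ.SameCycle p.1 p.2,
    ∑ ℓ ∈ labs (swap p.1 p.2 * γ) α with ℓ p.1 = k ∧ ℓ p.2 = l, mon ℓ

theorem sub_mul_sum_Ico {R : Type*} [CommRing R] (x y : R) {n : ℕ} (hn : 1 ≤ n) :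
    (x - y) * ∑ j ∈ Ico 1 n, x ^ j * y ^ (n - j) = y * x ^ n - x * y ^ n := by
  induction n, hn using Nat.le_induction with
  | base => simp [mul_comm]
  | succ n hn ih =>
    rw [sum_Ico_succ_top hn]
    have : ∑ j ∈ Ico 1 n, x ^ j * y ^ (n + 1 - j) = y * ∑ j ∈ Ico 1 n, x ^ j * y ^ (n - j) := by
      rw [mul_sum]
      refine sum_congr rfl fun j hj => ?_
      rw [Nat.succ_sub (mem_Ico.1 hj).2.le, pow_succ]; ring
    rw [this, Nat.add_sub_cancel_left]
    linear_combination y * ih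

/-- The part of the monomial of a labelling prime to `w_k`. -/
noncomputable def monRest (ℓ : V → Fin m) (k : Fin m) : Series m := ∏ v with ℓ v ≠ k, w (ℓ v)

theorem mon_eq_monRest (ℓ : V → Fin m) (k : Fin m) :
    mon ℓ = w k ^ #{v | ℓ v = k} * monRest ℓ k := by
  rw [mon, monRest, ← prod_filter_mul_prod_filter_not univ (fun v => ℓ v = k)]
  congr 1
  rw [← prod_const]
  exact prod_congr rfl fun v hv => by rw [(mem_filter.1 hv).2]

theorem IsLabelling.comp_inj {κ : Type*} {γ : Perm V} {ℓ : V → Fin m} (h : IsLabelling γ ℓ)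
    {f : Fin m → κ} (hf : f.Injective) : IsLabelling γ (f ∘ ℓ) := fun x y => by
  rw [Function.comp, Function.comp, hf.eq_iff, h]

theorem swap_apply_of_mem_erase {α : Finset (Fin m)} {k l i : Fin m} (hi : i ∈ α.erase l)
    (hk : i ≠ k) : swap k l i = i := swap_apply_of_ne_of_ne hk (ne_of_mem_erase hi)

/-- Giving the cycle labelled `k` the label `l`. -/
theorem labSumD_erase_swap (γ : Perm V) {α : Finset (Fin m)} {k l : Fin m} (hk : k ∈ α)
    (hl : l ∈ α) (hkl : k ≠ l) : labSumD γ (α.erase k) l = ∑ ℓ ∈ labs γ (α.erase l),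
      (#{v | ℓ v = k} : Series m) * (w l ^ #{v | ℓ v = k} * monRest ℓ k) := by
  have him : ∀ {k l : Fin m}, k ∈ α → l ∈ α → k ≠ l →
      (α.erase l).image (swap k l) = α.erase k := by
    intro k l hk hl hkl
    ext i
    rw [mem_image]
    constructor
    · rintro ⟨j, hj, rfl⟩
      by_cases hjk : j = k
      · rw [hjk, swap_apply_left]; exact mem_erase.2 ⟨hkl.symm, hl⟩
      · rw [swap_apply_of_mem_erase hj hjk]
        exact mem_erase.2 ⟨hjk, mem_of_mem_erase hj⟩
    · intro hi
      refine ⟨swap k l i, ?_, by rw [← Perm.mul_apply, swap_mul_self]; rfl⟩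
      by_cases hil : i = l
      · rw [hil, swap_apply_right]; exact mem_erase.2 ⟨hkl, hk⟩
      · rw [swap_apply_of_ne_of_ne (ne_of_mem_erase hi) hil]
        exact mem_erase.2 ⟨hil, mem_of_mem_erase hi⟩
  have hcard : ∀ ℓ : V → Fin m, #{v | (swap k l ∘ ℓ) v = l} = #{v | ℓ v = k} := by
    intro ℓ
    congr 1
    ext v
    simp only [mem_filter, mem_univ, true_and, Function.comp]
    rw [swap_apply_eq_iff, swap_apply_right]
  symm
  refine sum_bij' (fun ℓ _ => swap k l ∘ ℓ) (fun ℓ _ => swap k l ∘ ℓ) ?_ ?_ ?_ ?_ ?_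
  · intro ℓ h
    rw [mem_labs] at h ⊢
    refine ⟨h.1.comp_inj (swap k l).injective, ?_⟩
    rw [← image_image, h.2, him hk hl hkl]
  · intro ℓ h
    rw [mem_labs] at h ⊢
    refine ⟨h.1.comp_inj (swap k l).injective, ?_⟩
    rw [← image_image, h.2, swap_comm, him hl hk hkl.symm]
  · intro ℓ _; funext v; simp
  · intro ℓ _; funext v; simp
  · intro ℓ h
    rw [mon_eq_monRest (swap k l ∘ ℓ) l, hcard]
    congr 2
    unfold monRest
    refine prod_congr ?_ fun v hv => ?_
    · ext v
      simp only [mem_filter, mem_univ, true_and, Function.comp, ne_eq]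
      rw [swap_apply_eq_iff, swap_apply_right]
    · have hk : ℓ v ≠ k := fun h' => (mem_filter.1 hv).2 (by simp [h'])
      rw [mem_labs] at h
      have : ℓ v ∈ α.erase l := h.2 ▸ mem_image_of_mem _ (mem_univ v)
      rw [Function.comp, swap_apply_of_mem_erase this hk]

/-- The labellings of a cut permutation with labels `k` and `l` on the two new cycles, for a fixed
transposition, correspond to the labellings of `γ` without `l` in which the old cycle is labelled
`k`. -/
theorem sum_labs_cut {γ : Perm V} {α : Finset (Fin m)} {k l : Fin m} (hk : k ∈ α) (hl : l ∈ α)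
    (hkl : k ≠ l) {a b : V} (hab : a ≠ b) (h : γ.SameCycle a b) :
    ∑ ℓ ∈ labs (swap a b * γ) α with ℓ a = k ∧ ℓ b = l, mon ℓ =
      ∑ ℓ ∈ labs γ (α.erase l) with ℓ a = k,
        w k ^ Nat.card {v // (swap a b * γ).SameCycle a v} *
          w l ^ (#{v | ℓ v = k} - Nat.card {v // (swap a b * γ).SameCycle a v}) * monRest ℓ k := by
  classical
  have hn := not_sameCycle_swap_mul hab h
  have hs := sameCycle_join_iff hn
  rw [swap_mul_swap_mul'] at hs
  set γ' := swap a b * γ with hγ'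
  have hγ : γ = swap a b * γ' := (swap_mul_swap_mul' γ a b).symm
  have hmerge : ∀ {ℓ : V → Fin m}, ℓ a = k → ℓ b = l →
      mergeLabel ℓ a b = fun v => if ℓ v = l then k else ℓ v := by
    rintro ℓ rfl rfl; funext v; simp [mergeLabel]
  refine sum_bij' (fun ℓ _ v => if ℓ v = l then k else ℓ v)
    (fun ℓ _ v => if γ'.SameCycle v b then l else ℓ v) ?_ ?_ ?_ ?_ ?_
  · intro ℓ hℓ
    rw [mem_filter, mem_labs] at hℓ ⊢
    obtain ⟨⟨h1, h2⟩, ha, hb⟩ := hℓ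
    have hne : ℓ a ≠ ℓ b := by rw [ha, hb]; exact hkl
    rw [← hmerge ha hb]
    refine ⟨⟨hγ ▸ h1.merge hne, ?_⟩, ?_⟩
    · rw [image_mergeLabel hne, h2, hb]
    · rw [hmerge ha hb]
      simp [ha, hkl]
  · intro ℓ hℓ
    rw [mem_filter, mem_labs] at hℓ ⊢
    obtain ⟨⟨h1, h2⟩, ha⟩ := hℓ
    have hnl : ∀ v, ℓ v ≠ l := fun v hv => by
      have : ℓ v ∈ α.erase l := h2 ▸ mem_image_of_mem _ (mem_univ v)
      exact ne_of_mem_erase this hv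
    have hbb : γ'.SameCycle b b := SameCycle.refl _ _
    refine ⟨⟨?_, ?_⟩, by simp [hn, ha], by simp [hbb]⟩
    · intro x y
      by_cases hx : γ'.SameCycle x b <;> by_cases hy : γ'.SameCycle y b
      · simp only [hx, hy, if_true, true_iff]; exact hx.trans hy.symm
      · simp only [hx, hy, if_true, if_false]
        exact ⟨fun h' => absurd h'.symm (hnl y), fun h' => absurd (h'.symm.trans hx) hy⟩
      · simp only [hx, hy, if_true, if_false]
        exact ⟨fun h' => absurd h' (hnl x), fun h' => absurd (h'.trans hy) hx⟩
      · simp only [hx, hy, if_false]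
        rw [h1, hs]
        simp only [hx, hy, or_false]
        exact ⟨fun h' => h'.elim id fun h' => h'.1.trans h'.2.symm, Or.inl⟩
    · ext i
      simp only [mem_image, mem_univ, true_and]
      constructor
      · rintro ⟨v, rfl⟩
        split_ifs
        · exact hl
        · have : ℓ v ∈ α.erase l := h2 ▸ mem_image_of_mem _ (mem_univ v)
          exact mem_of_mem_erase this
      · intro hi
        by_cases hil : i = l
        · exact ⟨b, by simp [hbb, hil]⟩
        · by_cases hik : i = k
          · exact ⟨a, by simp [hn, ha, hik]⟩
          · have : i ∈ univ.image ℓ := h2 ▸ mem_erase.2 ⟨hil, hi⟩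
            obtain ⟨v, -, rfl⟩ := mem_image.1 this
            refine ⟨v, if_neg fun hv => hik ?_⟩
            rw [← ha, h1, hs]
            exact Or.inr ⟨Or.inr hv, Or.inl (SameCycle.refl _ _)⟩
  · intro ℓ hℓ
    rw [mem_filter, mem_labs] at hℓ
    obtain ⟨⟨h1, h2⟩, ha, hb⟩ := hℓ
    funext v
    have hv := h1 v b
    rw [hb] at hv
    by_cases h3 : ℓ v = l
    · simp [hv.1 h3, h3]
    · simp only [h3, if_false, mt hv.2 h3]
  · intro ℓ hℓ
    rw [mem_filter, mem_labs] at hℓ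
    obtain ⟨⟨h1, h2⟩, ha⟩ := hℓ
    have hnl : ∀ v, ℓ v ≠ l := fun v hv => by
      have : ℓ v ∈ α.erase l := h2 ▸ mem_image_of_mem _ (mem_univ v)
      exact ne_of_mem_erase this hv
    funext v
    by_cases hv : γ'.SameCycle v b
    · simp only [hv, if_true]
      rw [← ha, eq_comm, h1, hs]
      exact Or.inr ⟨Or.inr hv, Or.inl (SameCycle.refl _ _)⟩
    · simp only [hv, if_false, hnl v]
  · intro ℓ hℓ
    rw [mem_filter, mem_labs] at hℓ
    obtain ⟨⟨h1, h2⟩, ha, hb⟩ := hℓ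
    have hc1 : Nat.card {v // γ'.SameCycle a v} = #{v | ℓ v = k} := by
      rw [Nat.card_eq_fintype_card, Fintype.card_subtype]
      congr 1
      ext v
      simp only [mem_filter, mem_univ, true_and]
      rw [← h1, ha, eq_comm]
    have hc2 : #{v | (if ℓ v = l then k else ℓ v) = k} = #{v | ℓ v = k} + #{v | ℓ v = l} := by
      rw [← card_union_of_disjoint]
      · congr 1
        ext v
        simp only [mem_filter, mem_univ, true_and, mem_union]
        split_ifs with hv <;> simp [hv]
      · rw [disjoint_filter]
        intro v _ hv hv'
        exact hkl (hv.symm.trans hv')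
    rw [hc1, hc2, Nat.add_sub_cancel_left, mon_eq_monRest ℓ k, mul_assoc]
    congr 1
    rw [monRest, monRest, ← prod_filter_mul_prod_filter_not {v | ℓ v ≠ k} (fun v => ℓ v = l)]
    congr 1
    · rw [← prod_const, filter_filter]
      refine prod_congr ?_ fun v hv => by rw [(mem_filter.1 hv).2]
      ext v
      simp only [mem_filter, mem_univ, true_and]
      exact ⟨fun h => h.2, fun h => ⟨by rw [h]; exact hkl.symm, h⟩⟩
    · rw [filter_filter]
      refine prod_congr ?_ fun v hv => ?_
      · ext v
        simp only [mem_filter, mem_univ, true_and]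
        split_ifs with hv <;> simp [hv]
      · rw [mem_filter] at hv
        have : ℓ v ≠ l := fun h' => hv.2 (by simp [h'])
        simp [this]

/-- The `n - 1` cuts at a point of an `n`-cycle have lengths `j` and `n - j`, and the sum of the
monomials `w_k ^ j * w_l ^ (n - j)` is a divided difference. This is the origin of the denominators
`w_k - w_l`. -/
theorem sub_mul_cutSum (γ : Perm V) {α : Finset (Fin m)} {k l : Fin m} (hk : k ∈ α) (hl : l ∈ α)
    (hkl : k ≠ l) : (w k - w l) * cutSum γ α k l =
      w l * labSumD γ (α.erase l) k - w k * labSumD γ (α.erase k) l := by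
  classical
  have h1 : cutSum γ α k l = ∑ ℓ ∈ labs γ (α.erase l), ∑ a with ℓ a = k,
      ∑ j ∈ Ico 1 #{v | ℓ v = k}, w k ^ j * w l ^ (#{v | ℓ v = k} - j) * monRest ℓ k := by
    have h2 : cutSum γ α k l = ∑ p ∈ univ.offDiag with γ.SameCycle p.1 p.2,
      ∑ ℓ ∈ labs γ (α.erase l) with ℓ p.1 = k,
        w k ^ Nat.card {v // (swap p.1 p.2 * γ).SameCycle p.1 v} *
          w l ^ (#{v | ℓ v = k} - Nat.card {v // (swap p.1 p.2 * γ).SameCycle p.1 v}) *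
            monRest ℓ k := by
      unfold cutSum
      refine sum_congr rfl fun p hp => ?_
      rw [mem_filter, mem_offDiag] at hp
      exact sum_labs_cut hk hl hkl hp.1.2.2 hp.2
    rw [h2]
    simp only [sum_filter (fun ℓ : V → Fin m => ℓ _ = k)]
    rw [sum_comm]
    refine sum_congr rfl fun ℓ hℓ => ?_
    rw [mem_labs] at hℓ
    rw [← sum_filter, filter_filter, sum_sigma']
    symm
    have key : ∀ (a : V) (j : ℕ), ℓ a = k → 1 ≤ j → j < #{v | ℓ v = k} →
        Nat.card {v // (swap a ((γ ^ j) a) * γ).SameCycle a v} = j ∧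
          (a ≠ (γ ^ j) a ∧ γ.SameCycle a ((γ ^ j) a)) ∧ j < Function.minimalPeriod γ a := by
      intro a j ha h1 h2
      rw [← ha, card_label_eq_minimalPeriod hℓ.1] at h2
      refine ⟨?_, ⟨?_, ⟨j, rfl⟩⟩, h2⟩
      · have hc := card_cut h1 h2 rfl (isLabelling_mk (swap a ((γ ^ j) a) * γ))
        conv_rhs => rw [← hc]
        rw [Nat.card_eq_fintype_card, Fintype.card_subtype]
        congr 1
        ext v
        simp only [mem_filter, mem_univ, true_and]
        rw [isLabelling_mk _ _ _, sameCycle_comm]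
      · intro h3
        have := pow_injOn_minimalPeriod (γ := γ) (a := a) (Set.mem_Iio.2 h2)
          (Set.mem_Iio.2 (by omega : 0 < _)) h3.symm
        omega
    refine sum_bij (fun x _ => (x.1, (γ ^ x.2) x.1)) ?_ ?_ ?_ ?_
    · rintro ⟨a, j⟩ h
      simp only [mem_sigma, mem_filter, mem_univ, true_and, mem_Ico] at h
      obtain ⟨-, h3, -⟩ := key a j h.1 h.2.1 h.2.2
      simp only [mem_filter, mem_offDiag, mem_univ, true_and]
      exact ⟨h3.1, h3.2, h.1⟩
    · rintro ⟨a, j⟩ h ⟨a', j'⟩ h' he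
      simp only [mem_sigma, mem_filter, mem_univ, true_and, mem_Ico] at h h'
      obtain ⟨rfl, he⟩ := Prod.mk.inj he
      obtain rfl := pow_injOn_minimalPeriod (Set.mem_Iio.2 (key a j h.1 h.2.1 h.2.2).2.2)
        (Set.mem_Iio.2 (key a j' h'.1 h'.2.1 h'.2.2).2.2) he
      rfl
    · rintro ⟨a, b⟩ h
      simp only [mem_filter, mem_offDiag, mem_univ, true_and] at h
      obtain ⟨j, hj, hb⟩ := sameCycle_iff_lt_minimalPeriod.1 h.2.1
      refine ⟨⟨a, j⟩, ?_, by rw [← hb]⟩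
      simp only [mem_sigma, mem_filter, mem_univ, true_and, mem_Ico]
      refine ⟨h.2.2, ?_, ?_⟩
      · rcases Nat.eq_zero_or_pos j with rfl | h0
        · exact absurd hb h.1
        · exact h0
      · rwa [← h.2.2, card_label_eq_minimalPeriod hℓ.1]
    · rintro ⟨a, j⟩ h
      simp only [mem_sigma, mem_filter, mem_univ, true_and, mem_Ico] at h
      rw [(key a j h.1 h.2.1 h.2.2).1]
  rw [h1, labSumD_erase_swap γ hk hl hkl, labSumD, mul_sum, mul_sum, mul_sum, ← sum_sub_distrib]
  refine sum_congr rfl fun ℓ hℓ => ?_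
  rw [mem_labs] at hℓ
  have hpos : 1 ≤ #{v | ℓ v = k} := by
    have : k ∈ univ.image ℓ := hℓ.2 ▸ mem_erase.2 ⟨hkl, hk⟩
    obtain ⟨v, -, hv⟩ := mem_image.1 this
    exact card_pos.2 ⟨v, by simp [hv]⟩
  rw [sum_const, nsmul_eq_mul, ← sum_mul, mon_eq_monRest ℓ k]
  linear_combination (#{v | ℓ v = k} : Series m) * monRest ℓ k *
    sub_mul_sum_Ico (w k : Series m) (w l) hpos

/-- Cutting a cycle of `γ` by a transposition. -/
theorem sum_labSum_cut (γ : Perm V) (α : Finset (Fin m)) :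
    ∑ p ∈ univ.offDiag with γ.SameCycle p.1 p.2, labSum (swap p.1 p.2 * γ) α =
      ∑ p ∈ α.offDiag, cutSum γ α p.1 p.2 := by
  classical
  unfold cutSum
  rw [sum_comm]
  refine sum_congr rfl fun p hp => ?_
  rw [mem_filter, mem_offDiag] at hp
  have hn := not_sameCycle_swap_mul hp.1.2.2 hp.2
  rw [labSum]
  simp only [sum_filter]
  rw [sum_comm]
  refine sum_congr rfl fun ℓ hℓ => ?_
  rw [mem_labs] at hℓ
  rw [sum_eq_single (ℓ p.1, ℓ p.2)]
  · simp
  · rintro ⟨k, l⟩ _ hne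
    refine if_neg fun h => hne ?_
    rw [h.1, h.2]
  · intro h
    exfalso
    apply h
    rw [mem_offDiag, ← hℓ.2]
    exact ⟨mem_image_of_mem _ (mem_univ _), mem_image_of_mem _ (mem_univ _),
      fun h' => hn ((hℓ.1 _ _).1 h')⟩

end Labelled

/-! ### Generating polynomials of covers and removal of the last transposition -/

section Covers

variable {m : ℕ} {V : Type*} [Fintype V] [DecidableEq V]

/-- The weight `∏ u q_j` over the cycle lengths `j` of `σ`. -/
noncomputable def wt (m : ℕ) (σ : Perm V) : Series m :=
  (σ.partition.parts.map fun j => u m * MvPowerSeries.C (MvPolynomial.X j : Coeffs)).prod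

/-- The pairs of distinct points, standing for transpositions (each counted twice). -/
abbrev pairs (V : Type*) [Fintype V] [DecidableEq V] : Finset (V × V) := univ.offDiag

open Classical in
/-- The generating polynomial of the connected genus `0` factorizations with `r` transpositions and
cycles of the product labelled by `α`. -/
noncomputable def coverSum (V : Type*) [Fintype V] [DecidableEq V] (α : Finset (Fin m)) (r : ℕ) :
    Series m :=
  ∑ σ : Perm V, ∑ L ∈ listsOf (pairs V) r,
    if Conn σ L ∧ ncyc σ + #α = r + 2 then wt m σ * labSum (prodPerm σ L) α else 0

open Classical in
/-- As `coverSum`, with a chosen point in the cycle labelled `i`. -/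
noncomputable def coverSumD (V : Type*) [Fintype V] [DecidableEq V] (α : Finset (Fin m))
    (i : Fin m) (r : ℕ) : Series m :=
  ∑ σ : Perm V, ∑ L ∈ listsOf (pairs V) r,
    if Conn σ L ∧ ncyc σ + #α = r + 2 then wt m σ * labSumD (prodPerm σ L) α i else 0

open Classical in
/-- The contribution of the factorizations whose last transposition cuts a cycle of the product into
cycles labelled `k` and `l`. -/
noncomputable def cutCover (V : Type*) [Fintype V] [DecidableEq V] (α : Finset (Fin m))
    (k l : Fin m) (r : ℕ) : Series m :=
  ∑ σ : Perm V, ∑ L ∈ listsOf (pairs V) r,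
    if Conn σ L ∧ ncyc σ + #α = r + 3 then wt m σ * cutSum (prodPerm σ L) α k l else 0

open Classical in
/-- The contribution of the factorizations whose last transposition joins the orbit `A` to its
complement. -/
noncomputable def joinCover {V : Type*} [Fintype V] [DecidableEq V] (A : Finset V)
    (α : Finset (Fin m)) (r : ℕ) : Series m :=
  ∑ σ : Perm V, ∑ L ∈ listsOf (pairs V) r, ∑ p ∈ pairs V,
    if (p.1 ∈ A ∧ p.2 ∉ A ∧ Inv σ L A ∧ ConnOn A σ L ∧ ConnOn Aᶜ σ L) ∧ ncyc σ + #α = r + 3 then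
      wt m σ * labSum (swap p.1 p.2 * prodPerm σ L) α else 0

theorem sub_mul_cutCover {α : Finset (Fin m)} {k l : Fin m} (hk : k ∈ α) (hl : l ∈ α)
    (hkl : k ≠ l) (r : ℕ) : (w k - w l) * cutCover V α k l r =
      w l * coverSumD V (α.erase l) k r - w k * coverSumD V (α.erase k) l r := by
  have h1 := card_erase_add_one hk
  have h2 := card_erase_add_one hl
  unfold cutCover coverSumD
  rw [mul_sum, mul_sum, mul_sum, ← sum_sub_distrib]
  refine sum_congr rfl fun σ _ => ?_
  rw [mul_sum, mul_sum, mul_sum, ← sum_sub_distrib]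
  refine sum_congr rfl fun L _ => ?_
  by_cases h : Conn σ L ∧ ncyc σ + #α = r + 3
  · rw [if_pos h, if_pos ⟨h.1, by omega⟩, if_pos ⟨h.1, by omega⟩]
    linear_combination wt m σ * sub_mul_cutSum (prodPerm σ L) hk hl hkl
  · rw [if_neg h, if_neg fun h' => h ⟨h'.1, by omega⟩, if_neg fun h' => h ⟨h'.1, by omega⟩]
    ring

/-- Removing the last transposition. If the rest is connected, the transposition cuts a cycle: a join
would leave a rest violating the Riemann-Hurwitz inequality. Otherwise it joins two orbits. -/
theorem coverSum_succ (α : Finset (Fin m)) (r : ℕ) :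
    coverSum V α (r + 1) = ∑ A : Finset V, joinCover A α r +
      ∑ q ∈ α.offDiag, cutCover V α q.1 q.2 r := by
  classical
  unfold coverSum joinCover cutCover
  rw [sum_comm (s := (univ : Finset (Finset V))), sum_comm (s := α.offDiag), ← sum_add_distrib]
  refine sum_congr rfl fun σ _ => ?_
  rw [sum_listsOf_succ, sum_comm, sum_comm (s := (univ : Finset (Finset V))),
    sum_comm (s := α.offDiag), ← sum_add_distrib]
  refine sum_congr rfl fun L hL => ?_
  rw [mem_listsOf] at hL
  have hLne : ∀ p ∈ L, p.1 ≠ p.2 := fun p hp => (mem_offDiag.1 (hL.2 p hp)).2.2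
  have hcut : ∑ q ∈ α.offDiag, (if Conn σ L ∧ ncyc σ + #α = r + 3 then
      wt m σ * cutSum (prodPerm σ L) α q.1 q.2 else 0) = ∑ p ∈ pairs V,
      if (prodPerm σ L).SameCycle p.1 p.2 then (if Conn σ L ∧ ncyc σ + #α = r + 3 then
      wt m σ * labSum (swap p.1 p.2 * prodPerm σ L) α else 0) else 0 := by
    by_cases h : Conn σ L ∧ ncyc σ + #α = r + 3
    · simp only [if_pos h]
      rw [← sum_filter, ← mul_sum, ← mul_sum, sum_labSum_cut]
    · simp only [if_neg h, ite_self, sum_const_zero]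
  rw [hcut, sum_comm, ← sum_add_distrib]
  refine sum_congr rfl fun p hp => ?_
  have hpne := (mem_offDiag.1 hp).2.2
  rw [prodPerm_cons]
  by_cases hnum : ncyc σ + #α = r + 3
  swap
  · simp [hnum]
  simp only [hnum, and_true]
  by_cases hc : Conn σ L
  · have h0 : ∀ A : Finset V, ¬ (p.1 ∈ A ∧ p.2 ∉ A ∧ Inv σ L A ∧ ConnOn A σ L ∧ ConnOn Aᶜ σ L) :=
      fun A hA => (conn_cons_and_not_iff.2 ⟨A, hA⟩).2 hc
    rw [if_pos hc.cons, sum_eq_zero fun A _ => if_neg (h0 A), zero_add, if_pos hc]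
    split_ifs with hs
    · rfl
    · rw [labSum_eq_zero, mul_zero]
      have h1 := ncyc_swap_mul_of_not hs
      have h2 := hc.ncyc_add_ncyc_le hLne
      omega
  · rw [if_neg hc, ite_self, add_zero]
    by_cases hc' : Conn σ (p :: L)
    · obtain ⟨A, hA⟩ := conn_cons_and_not_iff.1 ⟨hc', hc⟩
      rw [if_pos hc', sum_eq_single A, if_pos hA]
      · intro B _ hBA
        exact if_neg fun hB => hBA (unique_of_conn_cons hB hA)
      · simp
    · rw [if_neg hc', sum_eq_zero]
      intro A _
      exact if_neg fun hA => hc' (conn_cons_and_not_iff.2 ⟨A, hA⟩).1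

section Transport

variable {W : Type*} [Fintype W] [DecidableEq W] (e : V ≃ W)

theorem parts_permCongr (γ : Perm V) :
    (Perm.partition (e.permCongr γ)).parts = γ.partition.parts := by
  classical
  have h := isLabelling_mk γ
  rw [parts_eq_of_isLabelling h, parts_eq_of_isLabelling (h.comp e), ← image_image,
    image_univ_equiv]
  refine Multiset.map_congr rfl fun i _ => ?_
  rw [← card_map e.toEmbedding]
  congr 1
  ext v
  simp [mem_map_equiv]

theorem ncyc_permCongr (γ : Perm V) : ncyc (e.permCongr γ) = ncyc γ := by
  rw [ncyc, parts_permCongr, ncyc]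

theorem wt_permCongr (γ : Perm V) : wt m (e.permCongr γ) = wt m γ := by
  rw [wt, parts_permCongr, wt]

theorem labSum_permCongr (γ : Perm V) (α : Finset (Fin m)) :
    labSum (e.permCongr γ) α = labSum γ α := by
  symm
  refine sum_bij' (fun ℓ _ => ℓ ∘ e.symm) (fun ℓ _ => ℓ ∘ e) ?_ ?_ ?_ ?_ ?_
  · intro ℓ h
    rw [mem_labs] at h ⊢
    exact ⟨h.1.comp e, by rw [← image_image, image_univ_equiv, h.2]⟩
  · intro ℓ h
    rw [mem_labs] at h ⊢
    refine ⟨?_, by rw [← image_image, image_univ_equiv, h.2]⟩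
    have := h.1.comp e.symm
    have hγ : e.symm.permCongr (e.permCongr γ) = γ := by ext; simp
    rwa [hγ] at this
  · intro ℓ _; funext; simp
  · intro ℓ _; funext; simp
  · intro ℓ _
    exact (Equiv.prod_comp e.symm fun v => w (ℓ v)).symm

theorem prodPerm_permCongr (σ : Perm V) (L : List (V × V)) :
    prodPerm (e.permCongr σ) (L.map (Equiv.prodCongr e e)) = e.permCongr (prodPerm σ L) := by
  induction L with
  | nil => simp
  | cons p L ih =>
    rw [List.map_cons, prodPerm_cons, ih, prodPerm_cons]
    ext x
    simp only [Perm.mul_apply, Equiv.permCongr_apply, Equiv.prodCongr_apply, Prod.map]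
    rw [swap_apply_def, swap_apply_def]
    simp only [e.injective.eq_iff]
    split_ifs <;> rfl

theorem inv_permCongr (σ : Perm V) (L : List (V × V)) (A : Finset V) :
    Inv (e.permCongr σ) (L.map (Equiv.prodCongr e e)) (A.map e.toEmbedding) ↔ Inv σ L A := by
  unfold Inv
  refine and_congr ?_ ?_
  · rw [← e.forall_congr_right]
    simp
  · rw [List.forall_mem_map]
    exact forall₂_congr fun p _ => iff_congr (mem_map' _) (mem_map' _)

theorem connOn_permCongr (σ : Perm V) (L : List (V × V)) (A : Finset V) :
    ConnOn (A.map e.toEmbedding) (e.permCongr σ) (L.map (Equiv.prodCongr e e)) ↔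
      ConnOn A σ L := by
  constructor
  · intro h B hB hi
    have := h (B.map e.toEmbedding) (map_subset_map.2 hB) ((inv_permCongr e σ L B).2 hi)
    rwa [map_eq_empty, map_inj] at this
  · intro h B hB hi
    obtain ⟨B', hB', rfl⟩ := subset_map_iff.1 hB
    rw [inv_permCongr] at hi
    rw [map_eq_empty, map_inj]
    exact h B' hB' hi

theorem pairs_map : (pairs V).map (Equiv.prodCongr e e).toEmbedding = pairs W := by
  ext ⟨a, b⟩
  simp [mem_map_equiv]

theorem joinCover_map (A : Finset V) (α : Finset (Fin m)) (r : ℕ) :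
    joinCover (A.map e.toEmbedding) α r = joinCover A α r := by
  classical
  unfold joinCover
  rw [← Equiv.sum_comp (e.permCongr)]
  refine sum_congr rfl fun σ _ => ?_
  rw [← pairs_map e, sum_listsOf_map]
  refine sum_congr rfl fun L _ => ?_
  rw [sum_map]
  refine sum_congr rfl fun p _ => ?_
  have hc : (A.map e.toEmbedding)ᶜ = Aᶜ.map e.toEmbedding := by
    ext x; simp [mem_map_equiv]
  have hp : swap (e p.1) (e p.2) * prodPerm (e.permCongr σ) (L.map (Equiv.prodCongr e e)) =
      e.permCongr (swap p.1 p.2 * prodPerm σ L) := by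
    have := prodPerm_permCongr e σ (p :: L)
    rwa [prodPerm_cons, List.map_cons, prodPerm_cons] at this
  have h1 : ((e.toEmbedding p.1 ∈ A.map e.toEmbedding) ↔ p.1 ∈ A) := mem_map' _
  have h2 : ((e.toEmbedding p.2 ∈ A.map e.toEmbedding) ↔ p.2 ∈ A) := mem_map' _
  have h3 := inv_permCongr e σ L A
  have h4 := connOn_permCongr e σ L A
  have h5 := connOn_permCongr e σ L Aᶜ
  rw [← hc] at h5
  refine if_congr ?_ ?_ rfl
  · rw [ncyc_permCongr]
    exact and_congr (and_congr h1 (and_congr (not_congr h2)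
      (and_congr h3 (and_congr h4 h5)))) Iff.rfl
  · rw [wt_permCongr, ← labSum_permCongr e, ← hp]
    rfl

end Transport

theorem wt_sumCongr {X Y : Type*} [Fintype X] [Fintype Y] [DecidableEq X] [DecidableEq Y]
    (σ : Perm X) (τ : Perm Y) :
    wt m (Perm.sumCongr σ τ : Perm (X ⊕ Y)) = wt m σ * wt m τ := by
  rw [wt, parts_sumCongr, Multiset.map_add, Multiset.prod_add, wt, wt]

theorem ncyc_sumCongr {X Y : Type*} [Fintype X] [Fintype Y] [DecidableEq X] [DecidableEq Y]
    (σ : Perm X) (τ : Perm Y) :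
    ncyc (Perm.sumCongr σ τ : Perm (X ⊕ Y)) = ncyc σ + ncyc τ := by
  rw [ncyc, parts_sumCongr, Multiset.card_add, ncyc, ncyc]

theorem labSumD_eq_zero {γ : Perm V} {α : Finset (Fin m)} {i : Fin m} (h : ncyc γ ≠ #α) :
    labSumD γ α i = 0 :=
  sum_eq_zero fun _ hℓ => absurd (ncyc_of_mem_labs hℓ) h

theorem card_of_mem_splits {α : Finset (Fin m)} {t : Finset (Fin m) × Finset (Fin m) × Fin m}
    (ht : t ∈ splits α) : #t.1 + #t.2.1 = #α + 1 := by
  rw [mem_splits] at ht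
  have := card_union_add_card_inter t.1 t.2.1
  rw [ht.1, ht.2, card_singleton] at this
  exact this.symm

open Classical in
/-- The genus of a join is the sum of the genera of the two parts, so both vanish if the total
does. -/
theorem ite_join {X Y : Type*} [Fintype X] [Fintype Y] [DecidableEq X] [DecidableEq Y]
    (σ : Perm X) (τ : Perm Y) {L₁ : List (X × X)} {L₂ : List (Y × Y)} {r i j : ℕ}
    (hij : i + j = r) (hL₁ : L₁ ∈ listsOf (pairs X) i) (hL₂ : L₂ ∈ listsOf (pairs Y) j)
    {α : Finset (Fin m)} {t : Finset (Fin m) × Finset (Fin m) × Fin m} (ht : t ∈ splits α) :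
    (if (Conn σ L₁ ∧ Conn τ L₂) ∧ ncyc σ + ncyc τ + #α = r + 3 then
      wt m σ * wt m τ * (labSumD (prodPerm σ L₁) t.1 t.2.2 * labSumD (prodPerm τ L₂) t.2.1 t.2.2)
      else 0) =
    (if Conn σ L₁ ∧ ncyc σ + #t.1 = i + 2 then
      wt m σ * labSumD (prodPerm σ L₁) t.1 t.2.2 else 0) *
    (if Conn τ L₂ ∧ ncyc τ + #t.2.1 = j + 2 then
      wt m τ * labSumD (prodPerm τ L₂) t.2.1 t.2.2 else 0) := by
  have hcard := card_of_mem_splits ht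
  rw [mem_listsOf] at hL₁ hL₂
  by_cases h1 : ncyc (prodPerm σ L₁) = #t.1
  swap
  · rw [labSumD_eq_zero h1]; simp
  by_cases h2 : ncyc (prodPerm τ L₂) = #t.2.1
  swap
  · rw [labSumD_eq_zero h2]; simp
  by_cases hc1 : Conn σ L₁
  swap
  · simp [hc1]
  by_cases hc2 : Conn τ L₂
  swap
  · simp [hc2]
  have g1 := hc1.ncyc_add_ncyc_le fun p hp => (mem_offDiag.1 (hL₁.2 p hp)).2.2
  have g2 := hc2.ncyc_add_ncyc_le fun p hp => (mem_offDiag.1 (hL₂.2 p hp)).2.2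
  rw [h1] at g1
  rw [h2] at g2
  by_cases hn : ncyc σ + ncyc τ + #α = r + 3
  · rw [if_pos ⟨⟨hc1, hc2⟩, hn⟩, if_pos ⟨hc1, by omega⟩, if_pos ⟨hc2, by omega⟩]
    ring
  · rw [if_neg fun h => hn h.2]
    by_cases hn1 : ncyc σ + #t.1 = i + 2
    · rw [if_neg (c := Conn τ L₂ ∧ _) fun h => by omega, mul_zero]
    · rw [if_neg fun h => hn1 h.2, zero_mul]

/-- The product formula for the join of two orbits; the binomial coefficient counts the shuffles of
the transpositions of the two parts. -/
theorem joinCover_sum (X Y : Type*) [Fintype X] [Fintype Y] [DecidableEq X] [DecidableEq Y]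
    (α : Finset (Fin m)) (r : ℕ) :
    joinCover (univ.map (Function.Embedding.inl : X ↪ X ⊕ Y)) α r =
      ∑ ij ∈ antidiagonal r, (r.choose ij.1 : Series m) *
        ∑ t ∈ splits α, coverSumD X t.1 t.2.2 ij.1 * coverSumD Y t.2.1 t.2.2 ij.2 := by
  classical
  set A := univ.map (Function.Embedding.inl : X ↪ X ⊕ Y) with hA
  -- the permutations preserving the two parts
  have h1 : joinCover A α r = ∑ στ : Perm X × Perm Y, ∑ L ∈ listsOf (pairs (X ⊕ Y)) r,
      ∑ p ∈ pairs (X ⊕ Y),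
      if (p.1 ∈ A ∧ p.2 ∉ A ∧ Inv (Perm.sumCongr στ.1 στ.2) L A ∧
          ConnOn A (Perm.sumCongr στ.1 στ.2) L ∧ ConnOn Aᶜ (Perm.sumCongr στ.1 στ.2) L) ∧
          ncyc (Perm.sumCongr στ.1 στ.2 : Perm (X ⊕ Y)) + #α = r + 3 then
        wt m (Perm.sumCongr στ.1 στ.2 : Perm (X ⊕ Y)) *
          labSum (swap p.1 p.2 * prodPerm (Perm.sumCongr στ.1 στ.2) L) α else 0 := by
    symm
    refine sum_of_injOn (fun στ => Perm.sumCongr στ.1 στ.2) ?_ ?_ ?_ ?_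
    · exact (Perm.sumCongrHom_injective).injOn
    · intro _ _; simp
    · intro σ _ hσ
      refine sum_eq_zero fun L _ => sum_eq_zero fun p _ => if_neg fun h => hσ ?_
      have hinv := h.1.2.2.1.1
      have hm : σ ∈ (Perm.sumCongrHom X Y).range := by
        apply mem_sumCongrHom_range_of_perm_mapsTo_inl
        rintro _ ⟨x, rfl⟩
        have := (hinv (Sum.inl x)).2 (by simp [hA])
        simpa [hA] using this
      obtain ⟨στ, rfl⟩ := hm
      exact ⟨στ, by simp, rfl⟩
    · intro _ _; rfl
  -- the transpositions joining the two parts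
  have h2 : ∀ (στ : Perm X × Perm Y) (L : List ((X ⊕ Y) × (X ⊕ Y))), ∑ p ∈ pairs (X ⊕ Y),
      (if (p.1 ∈ A ∧ p.2 ∉ A ∧ Inv (Perm.sumCongr στ.1 στ.2) L A ∧
          ConnOn A (Perm.sumCongr στ.1 στ.2) L ∧ ConnOn Aᶜ (Perm.sumCongr στ.1 στ.2) L) ∧
          ncyc (Perm.sumCongr στ.1 στ.2 : Perm (X ⊕ Y)) + #α = r + 3 then
        wt m (Perm.sumCongr στ.1 στ.2 : Perm (X ⊕ Y)) *
          labSum (swap p.1 p.2 * prodPerm (Perm.sumCongr στ.1 στ.2) L) α else 0) =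
      if (Inv (Perm.sumCongr στ.1 στ.2) L A ∧
          ConnOn A (Perm.sumCongr στ.1 στ.2) L ∧ ConnOn Aᶜ (Perm.sumCongr στ.1 στ.2) L) ∧
          ncyc στ.1 + ncyc στ.2 + #α = r + 3 then
        ∑ a : X, ∑ b : Y, wt m στ.1 * wt m στ.2 *
          labSum (swap (Sum.inl a) (Sum.inr b) * prodPerm (Perm.sumCongr στ.1 στ.2) L) α
        else 0 := by
    intro στ L
    rw [ncyc_sumCongr, wt_sumCongr]
    split_ifs with h
    · rw [← sum_product']
      symm
      refine sum_of_injOn (fun ab => (Sum.inl ab.1, Sum.inr ab.2)) ?_ ?_ ?_ ?_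
      · rintro ⟨a, b⟩ _ ⟨c, d⟩ _ h
        simpa using h
      · rintro ⟨a, b⟩ _; simp
      · rintro ⟨a | a, b | b⟩ _ hp
        · simp [hA]
        · exact absurd ⟨(a, b), by simp, rfl⟩ hp
        · simp [hA]
        · simp [hA]
      · rintro ⟨a, b⟩ _
        rw [if_pos ⟨⟨by simp [hA], by simp [hA], h.1⟩, h.2⟩]
    · exact sum_eq_zero fun p _ => if_neg fun h' => h ⟨h'.1.2.2, h'.2⟩
  -- the transpositions preserving the two parts
  have hAd : A = (univ : Finset X).disjSum (∅ : Finset Y) := by simp [hA]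
  have h3 : ∀ στ : Perm X × Perm Y, ∑ L ∈ listsOf (pairs (X ⊕ Y)) r,
      (if (Inv (Perm.sumCongr στ.1 στ.2) L A ∧
          ConnOn A (Perm.sumCongr στ.1 στ.2) L ∧ ConnOn Aᶜ (Perm.sumCongr στ.1 στ.2) L) ∧
          ncyc στ.1 + ncyc στ.2 + #α = r + 3 then
        ∑ a : X, ∑ b : Y, wt m στ.1 * wt m στ.2 *
          labSum (swap (Sum.inl a) (Sum.inr b) * prodPerm (Perm.sumCongr στ.1 στ.2) L) α
        else 0) = ∑ L ∈ listsOf ((pairs X).disjSum (pairs Y)) r,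
        ∑ t ∈ splits α, (if (Conn στ.1 (lefts L) ∧ Conn στ.2 (rights L)) ∧
          ncyc στ.1 + ncyc στ.2 + #α = r + 3 then
          wt m στ.1 * wt m στ.2 * (labSumD (prodPerm στ.1 (lefts L)) t.1 t.2.2 *
            labSumD (prodPerm στ.2 (rights L)) t.2.1 t.2.2) else 0) := by
    intro στ
    rw [← sum_filter_of_ne (p := fun L => ∀ p ∈ L, (p.1 ∈ A ↔ p.2 ∈ A)), filter_listsOf,
      offDiag_filter_sum, sum_listsOf_map]
    · refine sum_congr rfl fun L _ => ?_
      have e1 : Inv (Perm.sumCongr στ.1 στ.2) (L.map pairIncl) A := by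
        rw [hAd, inv_sum]
        exact ⟨inv_univ _ _, inv_empty _ _⟩
      have e2 := connOn_sum_left στ.1 στ.2 L
      have e3 := connOn_sum_right στ.1 στ.2 L
      rw [← hA] at e2 e3
      by_cases h : (Conn στ.1 (lefts L) ∧ Conn στ.2 (rights L)) ∧
          ncyc στ.1 + ncyc στ.2 + #α = r + 3
      · rw [if_pos ⟨⟨e1, e2.2 h.1.1, e3.2 h.1.2⟩, h.2⟩]
        simp only [if_pos h, ← mul_sum]
        rw [prodPerm_sum, sum_labSum_join]
      · rw [if_neg fun h' => h ⟨⟨e2.1 h'.1.2.1, e3.1 h'.1.2.2⟩, h'.2⟩]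
        simp only [if_neg h, sum_const_zero]
    · intro L _ hL
      by_contra hn
      exact hL (if_neg fun h => hn h.1.1.2)
  rw [h1]
  simp only [h2, h3]
  rw [sum_congr rfl fun στ _ => sum_listsOf_disjSum (pairs X) (pairs Y) r
    (fun L₁ L₂ => ∑ t ∈ splits α, (if (Conn στ.1 L₁ ∧ Conn στ.2 L₂) ∧
          ncyc στ.1 + ncyc στ.2 + #α = r + 3 then
          wt m στ.1 * wt m στ.2 * (labSumD (prodPerm στ.1 L₁) t.1 t.2.2 *
            labSumD (prodPerm στ.2 L₂) t.2.1 t.2.2) else 0)), sum_comm]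
  refine sum_congr rfl fun ij hij => ?_
  rw [HasAntidiagonal.mem_antidiagonal] at hij
  rw [← mul_sum]
  congr 1
  unfold coverSumD
  simp only [sum_mul_sum]
  rw [sum_comm (s := splits α), Fintype.sum_prod_type]
  refine sum_congr rfl fun σ _ => ?_
  rw [sum_comm (s := splits α)]
  refine sum_congr rfl fun τ _ => ?_
  rw [sum_comm (s := splits α)]
  refine sum_congr rfl fun L₁ hL₁ => ?_
  rw [sum_comm (s := splits α)]
  refine sum_congr rfl fun L₂ hL₂ => ?_
  exact sum_congr rfl fun t ht => ite_join σ τ hij hL₁ hL₂ ht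

/-- The sum over all ways in which the last transposition joins two orbits. -/
theorem sum_joinCover (d : ℕ) (α : Finset (Fin m)) (r : ℕ) :
    ∑ A : Finset (Fin d), joinCover A α r = ∑ ab ∈ antidiagonal d, (d.choose ab.1 : Series m) *
      ∑ ij ∈ antidiagonal r, (r.choose ij.1 : Series m) * ∑ t ∈ splits α,
        coverSumD (Fin ab.1) t.1 t.2.2 ij.1 * coverSumD (Fin ab.2) t.2.1 t.2.2 ij.2 := by
  classical
  have key : ∀ A : Finset (Fin d), joinCover A α r = ∑ ij ∈ antidiagonal r,
      (r.choose ij.1 : Series m) * ∑ t ∈ splits α,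
        coverSumD (Fin #A) t.1 t.2.2 ij.1 * coverSumD (Fin (d - #A)) t.2.1 t.2.2 ij.2 := by
    intro A
    have hc : Fintype.card {x // x ∉ A} = d - #A := by
      rw [Fintype.card_subtype_compl, Fintype.card_fin, Fintype.card_coe]
    let e : Fin d ≃ Fin #A ⊕ Fin (d - #A) :=
      (Equiv.sumCompl (· ∈ A)).symm.trans
        (Equiv.sumCongr A.equivFin (Fintype.equivFinOfCardEq hc))
    have he : A.map e.toEmbedding = univ.map Function.Embedding.inl := by
      ext (x | x)
      · have : e.symm (Sum.inl x) = (A.equivFin.symm x : Fin d) := rfl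
        simp [mem_map_equiv, this]
      · have : e.symm (Sum.inr x) = ((Fintype.equivFinOfCardEq hc).symm x : Fin d) := rfl
        simpa [mem_map_equiv, this] using ((Fintype.equivFinOfCardEq hc).symm x).2
    rw [← joinCover_map e, he, joinCover_sum]
  simp only [key]
  have := sum_powerset_apply_card (x := (univ : Finset (Fin d))) (fun a => ∑ ij ∈ antidiagonal r,
      (r.choose ij.1 : Series m) * ∑ t ∈ splits α,
        coverSumD (Fin a) t.1 t.2.2 ij.1 * coverSumD (Fin (d - a)) t.2.1 t.2.2 ij.2)
  rw [powerset_univ] at this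
  rw [this, card_univ, Fintype.card_fin, Nat.sum_antidiagonal_eq_sum_range_succ_mk]
  simp only [nsmul_eq_mul]

end Covers

/-! ### Euler operators -/

section Euler

variable {m : ℕ}

/-- The Euler operator `X_s ∂/∂X_s`. -/
noncomputable def euler (s : Option (Fin m)) (f : Series m) : Series m :=
  MvPowerSeries.X s * MvPowerSeries.pderiv Coeffs s f

theorem coeff_X_mul' (s : Option (Fin m)) (f : Series m) (e : Option (Fin m) →₀ ℕ) :
    MvPowerSeries.coeff e (MvPowerSeries.X s * f) =
      if e s = 0 then 0 else MvPowerSeries.coeff (e - Finsupp.single s 1) f := by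
  classical
  rw [MvPowerSeries.X, MvPowerSeries.coeff_monomial_mul, one_mul]
  have : Finsupp.single s 1 ≤ e ↔ e s ≠ 0 := by
    rw [Finsupp.single_le_iff]; omega
  simp only [this, ite_not]

theorem coeff_euler (s : Option (Fin m)) (f : Series m) (e : Option (Fin m) →₀ ℕ) :
    MvPowerSeries.coeff e (euler s f) = (e s : ℚ) • MvPowerSeries.coeff e f := by
  rw [euler, coeff_X_mul', MvPowerSeries.coeff_pderiv]
  split_ifs with h
  · simp [h]
  · have h1 : e - Finsupp.single s 1 + Finsupp.single s 1 = e :=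
      tsub_add_cancel_of_le (by rw [Finsupp.single_le_iff]; omega)
    have h2 : (((e - Finsupp.single s 1 : Option (Fin m) →₀ ℕ) s : ℕ) : Coeffs) + 1 =
        (e s : Coeffs) := by
      rw [Finsupp.tsub_apply, Finsupp.single_eq_same, ← Nat.cast_succ]
      congr 1; omega
    rw [h1, h2, mul_comm, Nat.cast_smul_eq_nsmul, nsmul_eq_mul]

theorem coeff_natCast_mul (n : ℕ) (f : Series m) (e : Option (Fin m) →₀ ℕ) :
    MvPowerSeries.coeff e ((n : Series m) * f) = (n : ℚ) • MvPowerSeries.coeff e f := by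
  rw [← nsmul_eq_mul, map_nsmul, Nat.cast_smul_eq_nsmul]

end Euler

/-! ### Coefficients of the generating polynomials -/

section Coefficients

variable {m : ℕ} {V : Type*} [Fintype V] [DecidableEq V]

/-- The exponent of the monomial recording `n` cycles of `σ` and the labelling `ℓ`. -/
noncomputable def labExp (n : ℕ) (ℓ : V → Fin m) : Option (Fin m) →₀ ℕ :=
  Finsupp.single none n + ∑ v, Finsupp.single (some (ℓ v)) 1

@[simp] theorem labExp_none (n : ℕ) (ℓ : V → Fin m) : labExp n ℓ none = n := by
  simp [labExp]

@[simp] theorem labExp_some (n : ℕ) (ℓ : V → Fin m) (i : Fin m) :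
    labExp n ℓ (some i) = #{v | ℓ v = i} := by
  simp [labExp, Finsupp.single_apply]

/-- The monomial in the `q_j` recording the cycle lengths of `σ`. -/
noncomputable def qwt (σ : Perm V) : Coeffs := (σ.partition.parts.map MvPolynomial.X).prod

theorem wt_mul_mon (σ : Perm V) (ℓ : V → Fin m) :
    wt m σ * mon ℓ = MvPowerSeries.monomial (labExp (ncyc σ) ℓ) (qwt σ) := by
  have h1 : wt m σ = MvPowerSeries.monomial (Finsupp.single none (ncyc σ)) (qwt σ) := by
    rw [wt, qwt, ncyc]
    induction σ.partition.parts using Multiset.induction_on with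
    | empty => simp
    | cons j s ih =>
      rw [Multiset.map_cons, Multiset.prod_cons, ih, Multiset.map_cons, Multiset.prod_cons,
        Multiset.card_cons, u, MvPowerSeries.X, MvPowerSeries.C]
      change MvPowerSeries.monomial _ _ * MvPowerSeries.monomial 0 _ * _ = _
      rw [MvPowerSeries.monomial_mul_monomial, MvPowerSeries.monomial_mul_monomial, add_zero,
        one_mul, ← Finsupp.single_add, add_comm 1]
  have h2 : mon ℓ = MvPowerSeries.monomial (∑ v, Finsupp.single (some (ℓ v)) 1) 1 := by
    rw [mon]
    induction (univ : Finset V) using Finset.induction_on with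
    | empty => simp
    | insert a s ha ih =>
      rw [prod_insert ha, ih, sum_insert ha, w, MvPowerSeries.X,
        MvPowerSeries.monomial_mul_monomial, one_mul]
  rw [h1, h2, MvPowerSeries.monomial_mul_monomial, mul_one, labExp]

theorem coeff_wt_mul_mon (σ : Perm V) (ℓ : V → Fin m) (e : Option (Fin m) →₀ ℕ) :
    MvPowerSeries.coeff e (wt m σ * mon ℓ) = if e = labExp (ncyc σ) ℓ then qwt σ else 0 := by
  classical
  rw [wt_mul_mon, MvPowerSeries.coeff_monomial]

theorem sum_labExp (n : ℕ) (ℓ : V → Fin m) : ∑ i, labExp n ℓ (some i) = Fintype.card V := by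
  simp only [labExp_some]
  rw [← card_univ, card_eq_sum_card_fiberwise (t := univ) (f := ℓ) (fun _ _ => mem_coe.2 (mem_univ _))]

/-- The number of points and the number of transpositions are determined by the exponent, so no
information is lost in adding up all these polynomials in one series. -/
theorem coeff_coverSum_ne_zero {α : Finset (Fin m)} {r : ℕ} {e : Option (Fin m) →₀ ℕ}
    (h : MvPowerSeries.coeff e (coverSum V α r) ≠ 0) :
    ∑ i, e (some i) = Fintype.card V ∧ e none + #α = r + 2 := by
  rw [coverSum, map_sum] at h
  obtain ⟨σ, -, h⟩ := exists_ne_zero_of_sum_ne_zero h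
  rw [map_sum] at h
  obtain ⟨L, -, h⟩ := exists_ne_zero_of_sum_ne_zero h
  split_ifs at h with hc
  · rw [labSum, mul_sum, map_sum] at h
    obtain ⟨ℓ, -, h⟩ := exists_ne_zero_of_sum_ne_zero h
    rw [coeff_wt_mul_mon] at h
    split_ifs at h with he
    · rw [he, sum_labExp, labExp_none]
      exact ⟨rfl, hc.2⟩
    · simp at h
  · simp at h

theorem coverSumD_eq_euler (α : Finset (Fin m)) (i : Fin m) (r : ℕ) :
    coverSumD V α i r = euler (some i) (coverSum V α r) := by
  ext1 e
  rw [coeff_euler, coverSum, coverSumD, map_sum, map_sum, smul_sum]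
  refine sum_congr rfl fun σ _ => ?_
  rw [map_sum, map_sum, smul_sum]
  refine sum_congr rfl fun L _ => ?_
  split_ifs
  · rw [labSum, labSumD, mul_sum, mul_sum, map_sum, map_sum, smul_sum]
    refine sum_congr rfl fun ℓ _ => ?_
    rw [mul_left_comm, coeff_natCast_mul, coeff_wt_mul_mon]
    split_ifs with he
    · rw [he, labExp_some]
    · simp
  · simp

theorem coeff_cutCover_ne_zero {α : Finset (Fin m)} {k l : Fin m} {r : ℕ}
    {e : Option (Fin m) →₀ ℕ} (h : MvPowerSeries.coeff e (cutCover V α k l r) ≠ 0) :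
    e none + #α = r + 3 := by
  rw [cutCover, map_sum] at h
  obtain ⟨σ, -, h⟩ := exists_ne_zero_of_sum_ne_zero h
  rw [map_sum] at h
  obtain ⟨L, -, h⟩ := exists_ne_zero_of_sum_ne_zero h
  split_ifs at h with hc
  · rw [cutSum, mul_sum, map_sum] at h
    obtain ⟨p, -, h⟩ := exists_ne_zero_of_sum_ne_zero h
    rw [mul_sum, map_sum] at h
    obtain ⟨ℓ, -, h⟩ := exists_ne_zero_of_sum_ne_zero h
    rw [coeff_wt_mul_mon] at h
    split_ifs at h with he
    · rw [he, labExp_none]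
      exact hc.2
    · simp at h
  · simp at h

end Coefficients

/-! ### The genus zero cut-and-join equation -/

section CutJoin

variable {m : ℕ}

/-- The normalization `d! r! 2^r`: relabellings of the points, orderings of the transpositions, and
orderings of the two points of each transposition. -/
noncomputable def fac (d r : ℕ) : ℚ := d.factorial * r.factorial * 2 ^ r

theorem fac_ne_zero (d r : ℕ) : fac d r ≠ 0 := by
  unfold fac; positivity

/-- The total degree in the variables `some i`. -/
def deg (e : Option (Fin m) →₀ ℕ) : ℕ := ∑ i, e (some i)

/-- The genus `0` series `H_{|α|}(x_α)`, as a series in all `m` variables. -/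
noncomputable def HA (α : Finset (Fin m)) : Series m := fun e =>
  (fac (deg e) (e none + #α - 2))⁻¹ •
    MvPowerSeries.coeff e (coverSum (Fin (deg e)) α (e none + #α - 2))

/-- The series of cuts of a cycle into cycles labelled `k` and `l`. -/
noncomputable def cutSeries (α : Finset (Fin m)) (k l : Fin m) : Series m := fun e =>
  (fac (deg e) (e none + #α - 3))⁻¹ •
    MvPowerSeries.coeff e (cutCover (Fin (deg e)) α k l (e none + #α - 3))

theorem coeff_HA (α : Finset (Fin m)) (e : Option (Fin m) →₀ ℕ) :
    MvPowerSeries.coeff e (HA α) = (fac (deg e) (e none + #α - 2))⁻¹ •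
    MvPowerSeries.coeff e (coverSum (Fin (deg e)) α (e none + #α - 2)) := rfl

theorem coeff_cutSeries (α : Finset (Fin m)) (k l : Fin m) (e : Option (Fin m) →₀ ℕ) :
    MvPowerSeries.coeff e (cutSeries α k l) = (fac (deg e) (e none + #α - 3))⁻¹ •
    MvPowerSeries.coeff e (cutCover (Fin (deg e)) α k l (e none + #α - 3)) := rfl

theorem two_le_of_coeff_HA_ne_zero {α : Finset (Fin m)} {e : Option (Fin m) →₀ ℕ}
    (h : MvPowerSeries.coeff e (HA α) ≠ 0) : 2 ≤ e none + #α := by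
  rw [coeff_HA] at h
  have := (coeff_coverSum_ne_zero (right_ne_zero_of_smul h)).2
  omega

theorem coeff_coverSum (d r : ℕ) (α : Finset (Fin m)) (e : Option (Fin m) →₀ ℕ) :
    MvPowerSeries.coeff e (coverSum (Fin d) α r) =
      if deg e = d ∧ e none + #α = r + 2 then fac d r • MvPowerSeries.coeff e (HA α) else 0 := by
  split_ifs with h
  · obtain ⟨rfl, h⟩ := h
    rw [coeff_HA, h, Nat.add_sub_cancel, smul_smul, mul_inv_cancel₀ (fac_ne_zero _ _), one_smul]
  · by_contra hne
    obtain ⟨h1, h2⟩ := coeff_coverSum_ne_zero hne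
    rw [Fintype.card_fin] at h1
    exact h ⟨h1, h2⟩

theorem coeff_coverSumD (d r : ℕ) (α : Finset (Fin m)) (i : Fin m) (e : Option (Fin m) →₀ ℕ) :
    MvPowerSeries.coeff e (coverSumD (Fin d) α i r) =
      if deg e = d ∧ e none + #α = r + 2 then
        fac d r • MvPowerSeries.coeff e (euler (some i) (HA α)) else 0 := by
  rw [coverSumD_eq_euler, coeff_euler, coeff_coverSum, coeff_euler]
  split_ifs
  · rw [smul_comm]
  · simp

theorem two_le_of_coeff_euler_ne_zero {α : Finset (Fin m)} {i : Fin m} {e : Option (Fin m) →₀ ℕ}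
    (h : MvPowerSeries.coeff e (euler (some i) (HA α)) ≠ 0) : 2 ≤ e none + #α := by
  rw [coeff_euler] at h
  exact two_le_of_coeff_HA_ne_zero (right_ne_zero_of_smul h)

theorem deg_add (e f : Option (Fin m) →₀ ℕ) : deg (e + f) = deg e + deg f := by
  simp [deg, sum_add_distrib]

theorem deg_sub_single {e : Option (Fin m) →₀ ℕ} {i : Fin m} (h : e (some i) ≠ 0) :
    deg (e - Finsupp.single (some i) 1) + 1 = deg e := by
  have h1 : e - Finsupp.single (some i) 1 + Finsupp.single (some i) 1 = e :=
      tsub_add_cancel_of_le (by rw [Finsupp.single_le_iff]; omega)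
  conv_rhs => rw [← h1, deg_add]
  congr 1
  simp [deg, Finsupp.single_apply]

/-- The series of cuts, in terms of series with one label less. -/
theorem sub_mul_cutSeries {α : Finset (Fin m)} {k l : Fin m} (hk : k ∈ α) (hl : l ∈ α)
    (hkl : k ≠ l) : (w k - w l) * cutSeries α k l =
      w l * euler (some k) (HA (α.erase l)) - w k * euler (some l) (HA (α.erase k)) := by
  have hk' := card_erase_add_one hk
  have hl' := card_erase_add_one hl
  ext1 e
  by_cases hd : deg e = 0
  · have h0 : ∀ i, e (some i) = 0 := fun i => by
      have := (sum_eq_zero_iff (s := univ)).1 hd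
      exact this i (mem_univ i)
    have : ∀ (i : Fin m) (f : Series m), MvPowerSeries.coeff e (w i * f) = 0 := fun i f => by
      rw [w, coeff_X_mul', if_pos (h0 i)]
    rw [sub_mul, map_sub, map_sub, this, this, this, this]
  · obtain ⟨d, hd⟩ := Nat.exists_eq_succ_of_ne_zero hd
    have key : ∀ (s : Fin m) (f g : Series m) (c : ℚ),
        (∀ e', deg e' = d → e' none = e none → MvPowerSeries.coeff e' f =
          c • MvPowerSeries.coeff e' g) →
        MvPowerSeries.coeff e (w s * f) = c • MvPowerSeries.coeff e (w s * g) := by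
      intro s f g c hfg
      rw [w, coeff_X_mul', coeff_X_mul']
      split_ifs with hs
      · simp
      · refine hfg _ ?_ ?_
        · have := deg_sub_single hs
          omega
        · simp [Finsupp.tsub_apply]
    set r := e none + #α - 3
    have hcut : ∀ e', deg e' = d → e' none = e none → MvPowerSeries.coeff e' (cutSeries α k l) =
        (fac d r)⁻¹ • MvPowerSeries.coeff e' (cutCover (Fin d) α k l r) := by
      intro e' h1 h2
      rw [coeff_cutSeries, h2]
      subst h1
      rfl
    have heul : ∀ (β : Finset (Fin m)) (i : Fin m), #β + 1 = #α → ∀ e', deg e' = d →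
        e' none = e none → MvPowerSeries.coeff e' (euler (some i) (HA β)) =
        (fac d r)⁻¹ • MvPowerSeries.coeff e' (coverSumD (Fin d) β i r) := by
      intro β i hβ e' h1 h2
      rw [coeff_coverSumD]
      split_ifs with h
      · rw [smul_smul, inv_mul_cancel₀ (fac_ne_zero _ _), one_smul]
      · rw [smul_zero]
        by_contra hne
        have := two_le_of_coeff_euler_ne_zero hne
        exact h ⟨h1, by omega⟩
    rw [sub_mul, map_sub, map_sub, key k _ _ _ hcut, key l _ _ _ hcut,
      key l _ _ _ (heul _ k hl'), key k _ _ _ (heul _ l hk'), ← smul_sub, ← smul_sub, ← map_sub,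
      ← map_sub, ← sub_mul, sub_mul_cutCover hk hl hkl]

theorem fac_mul_fac (a b i j : ℕ) : ((a + b).choose a : ℚ) * (i + j).choose i *
    (fac a i * fac b j) = fac (a + b) (i + j) := by
  unfold fac
  rw [Nat.choose_symm_add, Nat.choose_symm_add, ← Nat.add_choose_mul_factorial_mul_factorial a b,
    ← Nat.add_choose_mul_factorial_mul_factorial i j]
  push_cast
  ring

/-- The product of two series, in terms of the finite generating polynomials. -/
theorem coeff_euler_mul_euler {α β ζ : Finset (Fin m)} (i : Fin m) (hc : #β + #ζ = #α + 1)
    (e : Option (Fin m) →₀ ℕ) (r : ℕ) (hr : e none + #α = r + 3) :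
    fac (deg e) r • MvPowerSeries.coeff e (euler (some i) (HA β) * euler (some i) (HA ζ)) =
      ∑ ab ∈ antidiagonal (deg e), ∑ ij ∈ antidiagonal r,
        ((deg e).choose ab.1 * r.choose ij.1 : ℚ) •
          MvPowerSeries.coeff e (coverSumD (Fin ab.1) β i ij.1 * coverSumD (Fin ab.2) ζ i ij.2) := by
  classical
  simp only [MvPowerSeries.coeff_mul, smul_sum]
  rw [sum_congr rfl fun ab _ => sum_comm, sum_comm]
  refine sum_congr rfl fun p hp => ?_
  rw [HasAntidiagonal.mem_antidiagonal] at hp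
  have hdeg : deg p.1 + deg p.2 = deg e := by rw [← deg_add, hp]
  have hnone : p.1 none + p.2 none = e none := by rw [← hp]; rfl
  simp only [coeff_coverSumD]
  by_cases h1 : MvPowerSeries.coeff p.1 (euler (some i) (HA β)) = 0
  · simp [h1]
  by_cases h2 : MvPowerSeries.coeff p.2 (euler (some i) (HA ζ)) = 0
  · simp [h2]
  have h1 := two_le_of_coeff_euler_ne_zero h1
  have h2 := two_le_of_coeff_euler_ne_zero h2
  obtain ⟨r₁, hr₁⟩ := Nat.exists_eq_add_of_le' h1
  obtain ⟨r₂, hr₂⟩ := Nat.exists_eq_add_of_le' h2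
  have hrr : r₁ + r₂ = r := by omega
  rw [sum_eq_single (deg p.1, deg p.2), sum_eq_single (r₁, r₂)]
  · rw [if_pos ⟨rfl, hr₁⟩, if_pos ⟨rfl, hr₂⟩, smul_mul_smul_comm, smul_smul, ← hdeg, ← hrr,
      fac_mul_fac]
  · rintro ⟨a, b⟩ _ hne
    by_cases ha : p.1 none + #β = a + 2
    · by_cases hb : p.2 none + #ζ = b + 2
      · exfalso
        apply hne
        rw [Prod.mk.injEq]
        constructor <;> omega
      · simp [hb]
    · simp [ha]
  · intro h
    exact absurd (HasAntidiagonal.mem_antidiagonal.2 hrr) h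
  · rintro ⟨a, b⟩ _ hne
    refine sum_eq_zero fun ij _ => ?_
    by_cases ha : deg p.1 = a
    · by_cases hb : deg p.2 = b
      · exact absurd (by rw [ha, hb]) hne
      · simp [hb]
    · simp [ha]
  · intro h
    exact absurd (HasAntidiagonal.mem_antidiagonal.2 hdeg) h

theorem coeff_euler_mul_euler_eq_zero {α β ζ : Finset (Fin m)} (i : Fin m)
    (hc : #β + #ζ = #α + 1) (e : Option (Fin m) →₀ ℕ) (hr : e none + #α < 3) :
    MvPowerSeries.coeff e (euler (some i) (HA β) * euler (some i) (HA ζ)) = 0 := by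
  classical
  rw [MvPowerSeries.coeff_mul]
  refine sum_eq_zero fun p hp => ?_
  rw [HasAntidiagonal.mem_antidiagonal] at hp
  have hnone : p.1 none + p.2 none = e none := by rw [← hp]; rfl
  by_contra hne
  have h1 := two_le_of_coeff_euler_ne_zero (left_ne_zero_of_mul hne)
  have h2 := two_le_of_coeff_euler_ne_zero (right_ne_zero_of_mul hne)
  omega

/-- The genus `0` cut-and-join equation. The factor `2` comes from transpositions being ordered
pairs of points, and `u ∂/∂u + |α| - 2` multiplies a coefficient by its number of transpositions. -/
theorem cut_join (α : Finset (Fin m)) :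
    2 * (euler none (HA α) + ((#α : Series m) - 2) * HA α) =
      ∑ t ∈ splits α, euler (some t.2.2) (HA t.1) * euler (some t.2.2) (HA t.2.1) +
        ∑ q ∈ α.offDiag, cutSeries α q.1 q.2 := by
  ext1 e
  have hL : MvPowerSeries.coeff e (2 * (euler none (HA α) + ((#α : Series m) - 2) * HA α)) =
      (2 * ((e none : ℚ) + #α - 2)) • MvPowerSeries.coeff e (HA α) := by
    have h2 : (2 : Series m) = ((2 : ℕ) : Series m) := by norm_num
    rw [h2, coeff_natCast_mul, map_add, coeff_euler, sub_mul, map_sub, coeff_natCast_mul,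
      coeff_natCast_mul, ← sub_smul, ← add_smul, smul_smul]
    congr 1
    push_cast; ring
  rw [hL, map_add, map_sum, map_sum]
  by_cases hn : e none + #α < 3
  · have hzero : (2 * ((e none : ℚ) + #α - 2)) • MvPowerSeries.coeff e (HA α) = 0 := by
      by_contra hne
      have h1 := two_le_of_coeff_HA_ne_zero (right_ne_zero_of_smul hne)
      have h2 : e none + #α = 2 := by omega
      apply left_ne_zero_of_smul hne
      have : (e none : ℚ) + #α = 2 := by exact_mod_cast h2
      rw [this]; norm_num
    rw [hzero, sum_eq_zero, sum_eq_zero, add_zero]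
    · intro q _
      by_contra hne
      rw [coeff_cutSeries] at hne
      have := coeff_cutCover_ne_zero (right_ne_zero_of_smul hne)
      omega
    · intro t ht
      exact coeff_euler_mul_euler_eq_zero _ (card_of_mem_splits ht) e hn
  · obtain ⟨r, hr⟩ := Nat.exists_eq_add_of_le' (not_lt.1 hn)
    have hfac : fac (deg e) (r + 1) = 2 * ((r : ℚ) + 1) * fac (deg e) r := by
      unfold fac
      rw [Nat.factorial_succ, pow_succ]
      push_cast
      ring
    have hnum : (e none : ℚ) + #α - 2 = r + 1 := by
      have : (e none : ℚ) + #α = r + 3 := by exact_mod_cast hr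
      rw [this]; ring
    have h1 := coeff_coverSum (deg e) (r + 1) α e
    rw [if_pos ⟨rfl, by omega⟩, coverSum_succ, map_add, sum_joinCover, map_sum, map_sum, hfac,
      mul_smul, smul_comm] at h1
    rw [hnum]
    refine smul_right_injective _ (fac_ne_zero (deg e) r) ?_
    change fac (deg e) r • _ = fac (deg e) r • _
    rw [← h1, smul_add]
    congr 1
    · rw [smul_sum, sum_congr rfl fun t ht => coeff_euler_mul_euler t.2.2
        (card_of_mem_splits ht) e r hr, sum_comm]
      refine sum_congr rfl fun ab _ => ?_
      rw [coeff_natCast_mul, map_sum, sum_comm, smul_sum]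
      refine sum_congr rfl fun ij _ => ?_
      rw [coeff_natCast_mul, map_sum, smul_smul, smul_sum]
    · rw [smul_sum]
      refine sum_congr rfl fun q _ => ?_
      rw [coeff_cutSeries, hr, Nat.add_sub_cancel, smul_smul, mul_inv_cancel₀ (fac_ne_zero _ _),
        one_smul]

end CutJoin

/-! ### Counting the labellings with given cycle lengths -/

section Counting

/-- Families with the same multiset of values differ by a bijection of their index sets. -/
theorem exists_equiv_of_map_eq {Q A B : Type*} [Fintype Q] [Fintype A] [DecidableEq B]
    (f : Q → B) (g : A → B)
    (h : (univ : Finset Q).val.map f = (univ : Finset A).val.map g) :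
    ∃ φ : Q ≃ A, ∀ q, g (φ q) = f q := by
  have hc (b : B) : Nonempty ({q // f q = b} ≃ {a // g a = b}) := by
    have hb := congrArg (Multiset.count b) h
    rw [Multiset.count_map, Multiset.count_map] at hb
    refine Fintype.card_eq.1 ?_
    rw [Fintype.card_subtype, Fintype.card_subtype]
    simp only [Finset.card_def, filter_val]
    simpa only [eq_comm] using hb
  let ψ := fun b => (hc b).some
  refine ⟨(Equiv.sigmaFiberEquiv f).symm.trans ((Equiv.sigmaCongrRight ψ).trans
    (Equiv.sigmaFiberEquiv g)), fun q => ?_⟩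
  exact (ψ (f q) ⟨q, rfl⟩).2

variable {m : ℕ} {V : Type*} [Fintype V] [DecidableEq V]

/-- The number of labellings of the cycles with prescribed lengths is `|Aut|` of the cycle type:
such labellings form a torsor under the permutations of the labels that preserve the lengths. -/
theorem card_labs (γ : Perm V) (α : Finset (Fin m)) (e : Fin m → ℕ) :
    #{ℓ ∈ labs γ α | ∀ i ∈ α, #{v | ℓ v = i} = e i} =
      if γ.partition.parts = α.val.map e then
        ∏ j ∈ γ.partition.parts.toFinset, (γ.partition.parts.count j).factorial else 0 := by
  classical
  have hαe : α.val.map e = (univ : Finset {x // x ∈ α}).val.map fun i : {x // x ∈ α} => e i.1 := by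
    rw [univ_eq_attach, attach_val]
    exact (Multiset.attach_map_val' α.val e).symm
  have hparts : ∀ ℓ ∈ labs γ α, (∀ i ∈ α, #{v | ℓ v = i} = e i) →
      γ.partition.parts = α.val.map e := by
    intro ℓ hℓ he
    rw [mem_labs] at hℓ
    rw [parts_eq_of_isLabelling hℓ.1, hℓ.2]
    exact Multiset.map_congr rfl fun i hi => he i hi
  split_ifs with hγ
  swap
  · rw [card_eq_zero, filter_eq_empty_iff]
    exact fun ℓ hℓ he => hγ (hparts ℓ hℓ he)
  obtain ⟨ℓ₀, hℓ₀, he₀⟩ : ∃ ℓ ∈ labs γ α, ∀ i ∈ α, #{v | ℓ v = i} = e i := by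
    have hmk := isLabelling_mk γ
    have h1 := parts_eq_of_isLabelling hmk
    rw [image_univ_of_surjective Quotient.mk_surjective, hγ, hαe] at h1
    obtain ⟨φ, hφ⟩ := exists_equiv_of_map_eq _ _ h1.symm
    have hφmk : ∀ v (i : α), (φ (Quotient.mk _ v) : Fin m) = i ↔ Quotient.mk _ v = φ.symm i := by
      intro v i
      rw [Subtype.coe_inj, ← Equiv.eq_symm_apply]
    refine ⟨fun v => φ (Quotient.mk _ v), ?_, ?_⟩
    · rw [mem_labs]
      constructor
      · intro x y
        rw [Subtype.coe_inj, φ.injective.eq_iff, hmk]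
      · ext i
        simp only [mem_image, mem_univ, true_and]
        constructor
        · rintro ⟨v, rfl⟩; exact (φ _).2
        · intro hi
          obtain ⟨v, hv⟩ := Quotient.mk_surjective (φ.symm ⟨i, hi⟩)
          exact ⟨v, (hφmk v ⟨i, hi⟩).2 hv⟩
    · intro i hi
      have h2 := hφ (φ.symm ⟨i, hi⟩)
      rw [Equiv.apply_symm_apply] at h2
      rw [h2]
      congr 1
      ext v
      simp only [mem_filter, mem_univ, true_and]
      exact hφmk v ⟨i, hi⟩
  have hℓ₀' := mem_labs.1 hℓ₀
  have hmem : ∀ {ℓ}, ℓ ∈ labs γ α → ∀ v, ℓ v ∈ α := fun hℓ v =>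
    (mem_labs.1 hℓ).2 ▸ mem_image_of_mem _ (mem_univ v)
  have hsurj : ∀ i : α, ∃ v, ℓ₀ v = i := fun i => by
    have : (i : Fin m) ∈ univ.image ℓ₀ := hℓ₀'.2 ▸ i.2
    obtain ⟨v, -, hv⟩ := mem_image.1 this
    exact ⟨v, hv⟩
  choose s hs using hsurj
  set f : α → ℕ := fun i => e i with hf
  have hcard := DomMulAct.stabilizer_card' f
  have h2 : ∏ j ∈ γ.partition.parts.toFinset, (γ.partition.parts.count j).factorial =
      ∏ j ∈ univ.image f, (Fintype.card {a // f a = j}).factorial := by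
    rw [hγ, hαe]
    refine prod_congr rfl fun j _ => ?_
    rw [Multiset.count_map, Fintype.card_subtype, Finset.card_def, filter_val]
    simp only [eq_comm, hf]
  rw [h2, ← hcard, ← card_univ]
  symm
  refine card_bij (fun g _ v => (g.1 ⟨ℓ₀ v, hmem hℓ₀ v⟩ : Fin m)) ?_ ?_ ?_
  · rintro ⟨g, hg⟩ _
    rw [mem_filter, mem_labs]
    refine ⟨⟨?_, ?_⟩, ?_⟩
    · intro x y
      rw [Subtype.coe_inj, g.injective.eq_iff, Subtype.mk.injEq, hℓ₀'.1]
    · ext i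
      simp only [mem_image, mem_univ, true_and]
      constructor
      · rintro ⟨v, rfl⟩; exact (g _).2
      · intro hi
        refine ⟨s (g.symm ⟨i, hi⟩), ?_⟩
        simp only [hs, Subtype.coe_eta, Equiv.apply_symm_apply]
    · intro i hi
      have h3 : e i = e (g.symm ⟨i, hi⟩) := by
        have := congrFun hg (g.symm ⟨i, hi⟩)
        simpa [hf] using this
      rw [h3, ← he₀ _ (g.symm ⟨i, hi⟩).2]
      congr 1
      ext v
      simp only [mem_filter, mem_univ, true_and]
      have : ((g ⟨ℓ₀ v, hmem hℓ₀ v⟩ : Fin m) = i) ↔ g ⟨ℓ₀ v, hmem hℓ₀ v⟩ = ⟨i, hi⟩ :=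
        ⟨fun h => Subtype.ext h, fun h => by rw [h]⟩
      rw [this, ← Equiv.eq_symm_apply]
      exact ⟨fun h => congrArg Subtype.val h, fun h => Subtype.ext h⟩
  · rintro ⟨g, hg⟩ _ ⟨g', hg'⟩ _ h
    rw [Subtype.mk.injEq]
    ext i
    have := congrFun h (s i)
    simp only [hs, Subtype.coe_eta] at this
    exact congrArg Fin.val this
  · intro ℓ hℓ
    rw [mem_filter] at hℓ
    have hℓ' := mem_labs.1 hℓ.1
    have hls : ∀ v, ℓ (s ⟨ℓ₀ v, hmem hℓ₀ v⟩) = ℓ v := by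
      intro v
      rw [hℓ'.1, ← hℓ₀'.1, hs]
    have hinj : Function.Injective fun i : α => (⟨ℓ (s i), hmem hℓ.1 _⟩ : α) := by
      intro i j hij
      rw [Subtype.mk.injEq, hℓ'.1, ← hℓ₀'.1, hs, hs] at hij
      exact Subtype.ext hij
    refine ⟨⟨Equiv.ofBijective _ (Finite.injective_iff_bijective.1 hinj), ?_⟩, mem_univ _, ?_⟩
    · funext i
      change e (ℓ (s i)) = e i
      rw [← hℓ.2 _ (hmem hℓ.1 _), ← he₀ _ i.2]
      congr 1
      ext v
      simp only [mem_filter, mem_univ, true_and]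
      rw [hℓ'.1, ← hs i, hℓ₀'.1]
    · funext v
      exact hls v

theorem ncyc_pos [Nonempty V] (σ : Perm V) : 0 < ncyc σ := by
  classical
  rw [ncyc_eq_card_image (isLabelling_mk σ)]
  exact card_pos.2 (univ_nonempty.image _)

end Counting

/-! ### Transpositions as pairs of points, and transitivity -/

section Transpositions

variable {V : Type*} [Fintype V] [DecidableEq V] {M : Type*} [AddCommMonoid M]

open Classical in
/-- The transpositions. -/
noncomputable def swaps (V : Type*) [Fintype V] [DecidableEq V] : Finset (Perm V) :=
  {t | t.IsSwap}

theorem mem_swaps {t : Perm V} : t ∈ swaps V ↔ t.IsSwap := by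
  classical
  rw [swaps, mem_filter]; simp

/-- Every transposition comes from two pairs. -/
theorem sum_pairs_swap (g : Perm V → M) :
    ∑ p ∈ pairs V, g (swap p.1 p.2) = 2 • ∑ t ∈ swaps V, g t := by
  classical
  rw [← sum_fiberwise_of_maps_to (s := pairs V) (t := swaps V) (g := fun p => swap p.1 p.2)
    (fun p hp => mem_swaps.2 ⟨p.1, p.2, (mem_offDiag.1 hp).2.2, rfl⟩), smul_sum]
  refine sum_congr rfl fun t ht => ?_
  obtain ⟨a, b, hab, rfl⟩ := mem_swaps.1 ht
  have : ({p ∈ pairs V | swap p.1 p.2 = swap a b} : Finset (V × V)) = {(a, b), (b, a)} := by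
    ext ⟨x, y⟩
    simp only [mem_filter, mem_offDiag, mem_univ, true_and, mem_insert, mem_singleton,
      Prod.mk.injEq]
    constructor
    · rintro ⟨hxy, h⟩
      have h1 : swap a b x = y := by rw [← h, swap_apply_left]
      rw [swap_apply_def] at h1
      split_ifs at h1 with h2 h3
      · exact Or.inl ⟨h2, h1.symm⟩
      · exact Or.inr ⟨h3, h1.symm⟩
      · exact absurd h1 hxy
    · rintro (⟨rfl, rfl⟩ | ⟨rfl, rfl⟩)
      · exact ⟨hab, rfl⟩
      · exact ⟨hab.symm, swap_comm _ _⟩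
  rw [this, sum_pair (by simp [hab]), swap_comm b a, two_nsmul]

theorem sum_listsOf_pairs (r : ℕ) (f : List (Perm V) → M) :
    ∑ L ∈ listsOf (pairs V) r, f (L.map fun p => swap p.1 p.2) =
      2 ^ r • ∑ L ∈ listsOf (swaps V) r, f L := by
  induction r generalizing f with
  | zero => simp
  | succ r ih =>
    rw [sum_listsOf_succ, sum_listsOf_succ]
    simp only [List.map_cons]
    rw [sum_congr rfl fun p _ => ih fun L => f (swap p.1 p.2 :: L),
      sum_pairs_swap (fun t => 2 ^ r • ∑ L ∈ listsOf (swaps V) r, f (t :: L)), ← smul_sum,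
      smul_smul, pow_succ, mul_comm]

/-- Lists are read as tuples, in the reverse order. -/
theorem sum_listsOf_eq_sum_tuple {T : Type*} [Fintype T] (s : Finset T) (r : ℕ)
    (f : List T → M) [DecidablePred fun τ : Fin r → T => ∀ j, τ j ∈ s] :
    ∑ L ∈ listsOf s r, f L =
      ∑ τ : Fin r → T with ∀ j, τ j ∈ s, f (List.ofFn τ).reverse := by
  classical
  symm
  refine sum_bij (fun τ _ => (List.ofFn τ).reverse) ?_ ?_ ?_ ?_
  · intro τ h
    rw [mem_listsOf]
    simpa [List.mem_ofFn] using h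
  · intro τ _ τ' _ h
    exact List.ofFn_injective (List.reverse_injective h)
  · intro L hL
    rw [mem_listsOf] at hL
    obtain ⟨n, τ, hτ⟩ := List.exists_iff_exists_tuple.1 (⟨L.reverse, rfl⟩ : ∃ l, L.reverse = l)
    have hn : n = r := by
      have := congrArg List.length hτ
      simpa [hL.1] using this.symm
    subst hn
    refine ⟨τ, ?_, by rw [← hτ, List.reverse_reverse]⟩
    rw [mem_filter]
    refine ⟨mem_univ _, fun j => hL.2 _ ?_⟩
    rw [← List.mem_reverse, hτ, List.mem_ofFn]
    exact ⟨j, rfl⟩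
  · intro _ _; rfl

/-- The group generated by `σ` and the permutations in the list `T` is transitive. -/
def Trans (σ : Perm V) (T : List (Perm V)) : Prop :=
  MulAction.IsPretransitive (Subgroup.closure (insert σ {t | t ∈ T})) V

/-- Absence of proper invariant subsets agrees with transitivity of the generated group, also for
`V` empty. -/
theorem conn_iff_trans (σ : Perm V) (L : List (V × V)) :
    Conn σ L ↔ Trans σ (L.map fun p => swap p.1 p.2) := by
  have hmem : ∀ t, t ∈ {t | t ∈ L.map fun p => swap p.1 p.2} ↔ ∃ p ∈ L, swap p.1 p.2 = t := by
    intro t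
    rw [Set.mem_ofPred_eq, List.mem_map]
  have hswap : ∀ (p : V × V) (B : Finset V),
      (∀ x, swap p.1 p.2 x ∈ B ↔ x ∈ B) ↔ (p.1 ∈ B ↔ p.2 ∈ B) := by
    intro p B
    constructor
    · intro h
      have := h p.1
      rw [swap_apply_left] at this
      exact this.symm
    · intro h x
      rw [swap_apply_def]
      split_ifs with h1 h2
      · rw [h1, h]
      · rw [h2, h]
      · rfl
  rw [Trans]
  set gens := {t | t ∈ L.map fun p => swap p.1 p.2}
  have hinv : ∀ B, Inv σ L B ↔ ∀ g ∈ insert σ gens, ∀ x, g x ∈ B ↔ x ∈ B := by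
    intro B
    rw [Set.forall_mem_insert]
    refine and_congr Iff.rfl ?_
    constructor
    · rintro h t ht
      obtain ⟨p, hp, rfl⟩ := (hmem t).1 ht
      exact (hswap p B).2 (h p hp)
    · intro h p hp
      exact (hswap p B).1 (h _ ((hmem _).2 ⟨p, hp, rfl⟩))
  constructor
  · intro hc
    refine ⟨fun x y => ?_⟩
    classical
    set G := Subgroup.closure (insert σ gens) with hG
    have hB : Inv σ L ({z | ∃ g : G, g • x = z} : Finset V) := by
      rw [hinv]
      intro t ht z
      have htG : t ∈ G := Subgroup.subset_closure ht
      simp only [mem_filter, mem_univ, true_and]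
      constructor
      · rintro ⟨g, hg⟩
        refine ⟨⟨t, htG⟩⁻¹ * g, ?_⟩
        rw [mul_smul, hg, inv_smul_eq_iff]
        rfl
      · rintro ⟨g, rfl⟩
        exact ⟨⟨t, htG⟩ * g, by rw [mul_smul]; rfl⟩
    rcases hc _ (subset_univ _) hB with h | h
    · have : x ∈ ({z | ∃ g : G, g • x = z} : Finset V) := by
        simp only [mem_filter, mem_univ, true_and]
        exact ⟨1, one_smul _ _⟩
      rw [h] at this
      simp at this
    · have : y ∈ ({z | ∃ g : G, g • x = z} : Finset V) := by
        rw [h]; exact mem_univ y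
      simpa using this
  · intro ht B _ hB
    rw [hinv] at hB
    have hG : ∀ g ∈ Subgroup.closure (insert σ gens), ∀ x, g x ∈ B ↔ x ∈ B := by
      intro g hg
      induction hg using Subgroup.closure_induction with
      | mem g hg => exact hB g hg
      | one => intro x; rfl
      | mul a b _ _ ha hb => intro x; rw [Perm.mul_apply, ha, hb]
      | inv a _ ha => intro x; rw [← ha, ← Perm.mul_apply, mul_inv_cancel, Perm.one_apply]
    rcases B.eq_empty_or_nonempty with h | ⟨x, hx⟩
    · exact Or.inl h
    · right
      rw [eq_univ_iff_forall]
      intro y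
      obtain ⟨g, rfl⟩ := ht.exists_smul_eq x y
      exact (hG g.1 g.2 x).2 hx

end Transpositions

/-! ### Identification with the series of double Hurwitz numbers -/

section Identification

variable {m : ℕ}

open Classical in
/-- The sum of the monomials `q_β` over the transitive factorizations of permutations of `d` points
whose product has cycle type `M` and whose first factor, of cycle type `β`, has `n` cycles. -/
noncomputable def factSum (d r n : ℕ) (M : Multiset ℕ) : Coeffs :=
  ∑ σ : Perm (Fin d), ∑ T ∈ listsOf (swaps (Fin d)) r,
    if Trans σ T ∧ (T.prod * σ).partition.parts = M ∧ ncyc σ = n then qwt σ else 0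

/-- `|Aut|` of a partition. -/
def autM (M : Multiset ℕ) : ℕ := ∏ j ∈ M.toFinset, (M.count j).factorial

theorem autM_ne_zero (M : Multiset ℕ) : autM M ≠ 0 :=
  prod_ne_zero_iff.2 fun _ _ => Nat.factorial_ne_zero _

theorem coeff_wt_mul_labSum {V : Type*} [Fintype V] [DecidableEq V] (σ γ : Perm V)
    (α : Finset (Fin m)) (e : Option (Fin m) →₀ ℕ) (he : ∀ i ∉ α, e (some i) = 0) :
    MvPowerSeries.coeff e (wt m σ * labSum γ α) =
      if γ.partition.parts = α.val.map (fun i => e (some i)) ∧ ncyc σ = e none then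
        (autM (α.val.map fun i => e (some i)) : ℚ) • qwt σ else 0 := by
  classical
  rw [labSum, mul_sum, map_sum]
  simp only [coeff_wt_mul_mon]
  rw [← sum_filter, sum_const]
  have h1 : ({ℓ ∈ labs γ α | e = labExp (ncyc σ) ℓ} : Finset (V → Fin m)) =
      if ncyc σ = e none then {ℓ ∈ labs γ α | ∀ i ∈ α, #{v | ℓ v = i} = e (some i)} else ∅ := by
    split_ifs with hn
    · refine filter_congr fun ℓ hℓ => ?_
      constructor
      · intro h i _
        rw [h, labExp_some]
      · intro h
        ext s
        rcases s with _ | i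
        · rw [labExp_none, hn]
        · rw [labExp_some]
          by_cases hi : i ∈ α
          · exact (h i hi).symm
          · rw [he i hi, eq_comm, card_eq_zero, filter_eq_empty_iff]
            rintro v - rfl
            exact hi ((mem_labs.1 hℓ).2 ▸ mem_image_of_mem _ (mem_univ v))
    · rw [filter_eq_empty_iff]
      intro ℓ _ h
      exact hn (by rw [h, labExp_none])
  rw [h1]
  by_cases hn : ncyc σ = e none
  · rw [if_pos hn, card_labs]
    by_cases hγ : γ.partition.parts = α.val.map (fun i => e (some i))
    · rw [if_pos hγ, if_pos ⟨hγ, hn⟩, hγ, Nat.cast_smul_eq_nsmul]; rfl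
    · rw [if_neg hγ, if_neg (fun h => hγ h.1), zero_smul]
  · rw [if_neg hn, if_neg (fun h => hn h.2), card_empty, zero_smul]

/-- The coefficients of `HA`, through factorizations. -/
theorem coeff_HA_eq_factSum {α : Finset (Fin m)} (hα : α.Nonempty) (e : Option (Fin m) →₀ ℕ)
    (he : ∀ i ∉ α, e (some i) = 0) :
    MvPowerSeries.coeff e (HA α) =
      ((autM (α.val.map fun i => e (some i)) : ℚ) /
        ((deg e).factorial * (e none + #α - 2).factorial)) •
      factSum (deg e) (e none + #α - 2) (e none) (α.val.map fun i => e (some i)) := by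
  classical
  set r := e none + #α - 2 with hr
  set d := deg e with hd
  set M := α.val.map fun i => e (some i) with hM
  rw [coeff_HA, ← hr, ← hd, coverSum, map_sum, factSum, smul_sum, smul_sum]
  refine sum_congr rfl fun σ _ => ?_
  have h1 : ∀ L ∈ listsOf (pairs (Fin d)) r, MvPowerSeries.coeff e
      (if Conn σ L ∧ ncyc σ + #α = r + 2 then wt m σ * labSum (prodPerm σ L) α else 0) =
      (fun T : List (Perm (Fin d)) => if Trans σ T ∧ (T.prod * σ).partition.parts = M ∧
        ncyc σ = e none then (autM M : ℚ) • qwt σ else 0) (L.map fun p => swap p.1 p.2) := by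
    intro L _
    have hpp : (L.map fun p => swap p.1 p.2).prod * σ = prodPerm σ L := rfl
    beta_reduce
    rw [← conn_iff_trans, hpp]
    by_cases hc : Conn σ L
    · by_cases hn : ncyc σ + #α = r + 2
      · rw [if_pos ⟨hc, hn⟩, coeff_wt_mul_labSum _ _ _ _ he]
        simp only [hc, true_and]
        rfl
      · rw [if_neg (fun h => hn h.2), map_zero, if_neg]
        rintro ⟨-, hp, hn'⟩
        obtain ⟨i, hi⟩ := hα
        have hei : 0 < e (some i) := by
          refine (prodPerm σ L).partition.parts_pos ?_
          rw [hp, hM]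
          exact Multiset.mem_map_of_mem _ hi
        have hd0 : 0 < d := by
          rw [hd, deg]
          exact lt_of_lt_of_le hei (single_le_sum (f := fun i => e (some i))
            (fun _ _ => Nat.zero_le _) (mem_univ i))
        have : Nonempty (Fin d) := ⟨⟨0, hd0⟩⟩
        have h2 := ncyc_pos σ
        have h3 : 0 < #α := card_pos.2 ⟨i, hi⟩
        omega
    · rw [if_neg (fun h => hc h.1), if_neg (fun h => hc h.1), map_zero]
  rw [map_sum, sum_congr rfl h1, sum_listsOf_pairs r (fun T : List (Perm (Fin d)) =>
    if Trans σ T ∧ (T.prod * σ).partition.parts = M ∧ ncyc σ = e none then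
      (autM M : ℚ) • qwt σ else 0), smul_sum, smul_sum, smul_sum]
  refine sum_congr rfl fun T _ => ?_
  split_ifs with h
  · rw [← Nat.cast_smul_eq_nsmul ℚ, smul_smul, smul_smul, fac]
    congr 1
    push_cast
    field_simp
  · simp

/-- The number of transitive factorizations, as a sum over lists of transpositions. -/
theorem card_isTransitiveFactorization {d : ℕ} (r : ℕ) (A B : d.Partition)
    [∀ (σ : Perm (Fin d)) (T : List (Perm (Fin d))), Decidable (σ.partition.parts = B.parts ∧
      Trans σ T ∧ (T.prod * σ).partition.parts = A.parts)] :
    Nat.card {x : Perm (Fin d) × (Fin r → Perm (Fin d)) × Perm (Fin d) //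
      IsTransitiveFactorization A B x.1 x.2.1 x.2.2} =
    ∑ σ : Perm (Fin d), ∑ T ∈ listsOf (swaps (Fin d)) r,
      if σ.partition.parts = B.parts ∧ Trans σ T ∧ (T.prod * σ).partition.parts = A.parts
        then 1 else 0 := by
  classical
  have hset : ∀ τ : Fin r → Perm (Fin d), Set.range τ = {t | t ∈ (List.ofFn τ).reverse} := by
    intro τ
    ext t
    rw [Set.mem_ofPred_eq, List.mem_reverse, List.mem_ofFn, Set.mem_range]
  let E : {x : Perm (Fin d) × (Fin r → Perm (Fin d)) × Perm (Fin d) //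
      IsTransitiveFactorization A B x.1 x.2.1 x.2.2} ≃
      {p : Perm (Fin d) × (Fin r → Perm (Fin d)) // IsTransitiveFactorization A B p.1 p.2
        ((List.ofFn p.2).reverse.prod * p.1)} :=
    { toFun := fun x => ⟨(x.1.1, x.1.2.1), by
        have hx : (List.ofFn x.1.2.1).reverse.prod * x.1.1 = x.1.2.2 := x.2.2.2.2.1
        rw [hx]
        exact x.2⟩
      invFun := fun p => ⟨(p.1.1, p.1.2, (List.ofFn p.1.2).reverse.prod * p.1.1), p.2⟩
      left_inv := fun x => Subtype.ext (Prod.ext rfl (Prod.ext rfl x.2.2.2.2.1))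
      right_inv := fun p => rfl }
  rw [Nat.card_congr E, Nat.card_eq_fintype_card, Fintype.card_subtype, card_filter,
    ← univ_product_univ, sum_product]
  refine sum_congr rfl fun σ _ => ?_
  rw [sum_listsOf_eq_sum_tuple, sum_filter]
  refine sum_congr rfl fun τ _ => ?_
  rw [← ite_and]
  refine if_congr ?_ rfl rfl
  have htr : MulAction.IsPretransitive (Subgroup.closure (insert σ (Set.range τ))) (Fin d) ↔
      Trans σ (List.ofFn τ).reverse := by rw [Trans, hset]
  simp only [IsTransitiveFactorization, mem_swaps, htr]
  tauto

/-- The cycle type of a permutation of `d` points, as a partition of `d`. -/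
def cycPart {d : ℕ} (σ : Perm (Fin d)) : d.Partition where
  parts := σ.partition.parts
  parts_pos := σ.partition.parts_pos
  parts_sum := by rw [σ.partition.parts_sum, Fintype.card_fin]

theorem sum_sum_sum_sum_comm {A B S T M : Type*} [AddCommMonoid M] (a : Finset A) (b : Finset B)
    (s : Finset S) (t : Finset T) (f : A → B → S → T → M) :
    ∑ i ∈ a, ∑ j ∈ b, ∑ k ∈ s, ∑ l ∈ t, f i j k l =
      ∑ k ∈ s, ∑ l ∈ t, ∑ i ∈ a, ∑ j ∈ b, f i j k l :=
  calc _ = ∑ i ∈ a, ∑ k ∈ s, ∑ j ∈ b, ∑ l ∈ t, f i j k l := sum_congr rfl fun _ _ => sum_comm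
    _ = ∑ k ∈ s, ∑ i ∈ a, ∑ j ∈ b, ∑ l ∈ t, f i j k l := sum_comm
    _ = ∑ k ∈ s, ∑ i ∈ a, ∑ l ∈ t, ∑ j ∈ b, f i j k l :=
      sum_congr rfl fun _ _ => sum_congr rfl fun _ _ => sum_comm
    _ = _ := sum_congr rfl fun _ _ => sum_comm

/-- The coefficients of `symH`, through factorizations: for given `σ` and transpositions, exactly one
pair of partitions occurs. The factor `|Aut β|` cancels, and `|Aut α|` is the number of labellings. -/
theorem coeff_symH_eq_factSum {k : ℕ} (e : Option (Fin k) →₀ ℕ) :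
    MvPowerSeries.coeff e (symH 0 k) =
      ((autM ((univ : Finset (Fin k)).val.map fun i => e (some i)) : ℚ) /
        ((deg e).factorial * (e none + k - 2).factorial)) •
      factSum (deg e) (e none + k - 2) (e none) (univ.val.map fun i => e (some i)) := by
  classical
  set r := e none + k - 2 with hr
  set M := (univ : Finset (Fin k)).val.map fun i => e (some i) with hM
  set c := (autM M : ℚ) / ((deg e).factorial * r.factorial) with hc
  have h1 : ∀ A B : (deg e).Partition, A.parts = M → Multiset.card B.parts = e none →
      MvPolynomial.C (hurwitzNumber 0 A B / (((numSimple 0 A B).factorial : ℚ) * (autCard B : ℚ))) *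
        (B.parts.map MvPolynomial.X).prod =
      ∑ σ : Perm (Fin (deg e)), ∑ T ∈ listsOf (swaps (Fin (deg e))) r,
        if σ.partition.parts = B.parts ∧ Trans σ T ∧ (T.prod * σ).partition.parts = A.parts
        then c • qwt σ else 0 := by
    intro A B hA hB
    have hnum : numSimple 0 A B = r := by
      rw [numSimple, hA, hB, hr, hM, Multiset.card_map, card_val, card_univ, Fintype.card_fin]
      omega
    rw [hurwitzNumber, hnum, card_isTransitiveFactorization]
    have hA' : (autCard A : ℚ) = autM M := by rw [← hA]; rfl
    have hB' : (autCard B : ℚ) ≠ 0 := Nat.cast_ne_zero.2 (autM_ne_zero B.parts)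
    have h2 : ∀ n : ℚ, (autCard A : ℚ) * autCard B / (deg e).factorial * n /
        (r.factorial * autCard B) = n * c := by
      intro n
      rw [hA', hc]
      field_simp
    rw [h2, ← MvPolynomial.smul_eq_C_mul]
    push_cast
    rw [sum_mul, sum_smul]
    refine sum_congr rfl fun σ _ => ?_
    rw [sum_mul, sum_smul]
    refine sum_congr rfl fun T _ => ?_
    split_ifs with h
    · rw [one_mul, qwt, h.1]
    · rw [zero_mul, zero_smul]
  have h2 : MvPowerSeries.coeff e (symH 0 k) = ∑ A : (deg e).Partition, ∑ B : (deg e).Partition,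
      ∑ σ : Perm (Fin (deg e)), ∑ T ∈ listsOf (swaps (Fin (deg e))) r,
        if B = cycPart σ ∧ A = cycPart (T.prod * σ) ∧
          (Trans σ T ∧ (T.prod * σ).partition.parts = M ∧ ncyc σ = e none)
        then c • qwt σ else 0 := by
    change symH 0 k e = _
    unfold symH
    refine sum_congr rfl fun A _ => sum_congr rfl fun B _ => ?_
    split_ifs with h
    · refine (h1 A B h.1 h.2).trans ?_
      refine sum_congr rfl fun σ _ => sum_congr rfl fun T _ => ?_
      have hiff : (σ.partition.parts = B.parts ∧ Trans σ T ∧ (T.prod * σ).partition.parts = A.parts)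
          ↔ B.parts = σ.partition.parts ∧ A.parts = (T.prod * σ).partition.parts ∧
            (Trans σ T ∧ (T.prod * σ).partition.parts = M ∧ ncyc σ = e none) := by
        constructor
        · rintro ⟨ha, hb, hd⟩
          refine ⟨ha.symm, hd.symm, hb, hd.trans h.1, ?_⟩
          rw [ncyc, ha, h.2]
        · rintro ⟨ha, hb, hd, -⟩
          exact ⟨ha.symm, hd, hb.symm⟩
      by_cases hP : σ.partition.parts = B.parts ∧ Trans σ T ∧
          (T.prod * σ).partition.parts = A.parts
      · have hQ := hiff.1 hP
        rw [if_pos hP]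
        exact (if_pos ⟨Nat.Partition.ext hQ.1, Nat.Partition.ext hQ.2.1, hQ.2.2⟩).symm
      · rw [if_neg hP]
        refine (if_neg ?_).symm
        rintro ⟨hB, hA, hR⟩
        exact hP (hiff.2 ⟨congrArg Nat.Partition.parts hB, congrArg Nat.Partition.parts hA, hR⟩)
    · symm
      refine sum_eq_zero fun σ _ => sum_eq_zero fun T _ => if_neg ?_
      rintro ⟨rfl, rfl, -, h3, h4⟩
      exact h ⟨h3, h4⟩
  rw [h2, factSum, smul_sum, sum_sum_sum_sum_comm]
  refine sum_congr rfl fun σ _ => ?_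
  rw [smul_sum]
  refine sum_congr rfl fun T _ => ?_
  rw [sum_eq_single (cycPart (T.prod * σ)), sum_eq_single (cycPart σ)]
  · simp only [true_and]
    rw [smul_ite, smul_zero]
  · intro B _ hB
    exact if_neg fun h => hB h.1
  · exact fun h => absurd (mem_univ _) h
  · intro A _ hA
    exact sum_eq_zero fun B _ => if_neg fun h => hA h.2.1
  · exact fun h => absurd (mem_univ _) h

/-- `HA α` contains only the variables with index in `α`. -/
theorem coeff_HA_eq_zero {α : Finset (Fin m)} {e : Option (Fin m) →₀ ℕ} {i : Fin m} (hi : i ∉ α)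
    (hei : e (some i) ≠ 0) : MvPowerSeries.coeff e (HA α) = 0 := by
  rw [coeff_HA, coverSum, map_sum, sum_eq_zero, smul_zero]
  intro σ _
  rw [map_sum]
  refine sum_eq_zero fun L _ => ?_
  split_ifs
  · rw [labSum, mul_sum, map_sum]
    refine sum_eq_zero fun ℓ hℓ => ?_
    rw [coeff_wt_mul_mon, if_neg]
    intro h
    apply hei
    rw [h, labExp_some, card_eq_zero, filter_eq_empty_iff]
    rintro v - rfl
    exact hi ((mem_labs.1 hℓ).2 ▸ mem_image_of_mem _ (mem_univ v))
  · exact map_zero _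

/-- The series `HA α` is the symmetrized series of the statement, in the variables `x_α`. -/
theorem HA_eq_rename {α : Finset (Fin m)} (hα : α.Nonempty) :
    HA α = MvPowerSeries.rename (α.orderEmbOfFin rfl).toEmbedding.optionMap (symH 0 #α) := by
  classical
  set ι := (α.orderEmbOfFin rfl).toEmbedding with hι
  have hmap : univ.map ι = α := by
    rw [hι, map_orderEmbOfFin_univ]
  have hmapM : ∀ f : Fin m → ℕ, α.val.map f = (univ : Finset (Fin #α)).val.map fun j => f (ι j) := by
    intro f
    have := congrArg (fun s : Finset (Fin m) => s.val.map f) hmap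
    beta_reduce at this
    rw [← this, map_val, Multiset.map_map]
    rfl
  have hmem : ∀ j, ι j ∈ α := fun j => by
    have := mem_map_of_mem ι (mem_univ j)
    rwa [hmap] at this
  have hsum : ∀ f : Fin m → ℕ, ∑ i ∈ α, f i = ∑ j, f (ι j) := fun f => congrArg Multiset.sum (hmapM f)
  ext1 e
  by_cases he : ∀ i ∉ α, e (some i) = 0
  · obtain ⟨e', rfl⟩ : ∃ e', e = Finsupp.embDomain ι.optionMap e' := by
      refine ⟨Finsupp.comapDomain ι.optionMap e ι.optionMap.injective.injOn, ?_⟩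
      rw [Finsupp.embDomain_comapDomain]
      intro s hs
      rcases s with _ | i
      · exact ⟨none, rfl⟩
      · have hi : i ∈ α := by
          by_contra hi
          exact Finsupp.mem_support_iff.1 hs (he i hi)
        rw [← hmap, mem_map] at hi
        obtain ⟨j, -, rfl⟩ := hi
        exact ⟨some j, rfl⟩
    have hsome : ∀ j, Finsupp.embDomain ι.optionMap e' (some (ι j)) = e' (some j) := fun j =>
      Finsupp.embDomain_apply_self ι.optionMap e' (some j)
    have hnone : Finsupp.embDomain ι.optionMap e' none = e' none :=
      Finsupp.embDomain_apply_self ι.optionMap e' none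
    have hM : α.val.map (fun i => Finsupp.embDomain ι.optionMap e' (some i)) =
        (univ : Finset (Fin #α)).val.map fun j => e' (some j) := by
      rw [hmapM]
      exact Multiset.map_congr rfl fun j _ => hsome j
    have hdeg : deg (Finsupp.embDomain ι.optionMap e') = deg e' := by
      rw [deg, deg, ← sum_subset (subset_univ α) (fun i _ hi => he i hi), hsum]
      exact sum_congr rfl fun j _ => hsome j
    rw [MvPowerSeries.coeff_embDomain_rename, coeff_symH_eq_factSum, coeff_HA_eq_factSum hα _ he,
      hM, hdeg, hnone]
  · push Not at he
    obtain ⟨i, hi, hei⟩ := he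
    rw [MvPowerSeries.coeff_rename_eq_zero, coeff_HA_eq_zero hi hei]
    rintro ⟨e', rfl⟩
    apply hei
    refine Finsupp.mapDomain_of_notMem_range _ _ ?_
    rintro ⟨s, hs⟩
    rcases s with _ | j
    · simp at hs
    · have : ι j = i := by simpa using hs
      exact hi (this ▸ hmem j)

end Identification

/-! ### The chain rule for substitutions -/

section ChainRule

open scoped MvPowerSeries.WithPiTopology in
theorem continuous_pderiv {R ρ : Type*} [CommRing R] [TopologicalSpace R] [IsTopologicalRing R]
    (s : ρ) : Continuous fun g : MvPowerSeries ρ R => MvPowerSeries.pderiv R s g := by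
  refine continuous_pi fun d => ?_
  change Continuous fun g => MvPowerSeries.coeff d (MvPowerSeries.pderiv R s g)
  simp only [MvPowerSeries.coeff_pderiv]
  exact (MvPowerSeries.WithPiTopology.continuous_coeff R _).mul continuous_const

open scoped MvPowerSeries.WithPiTopology in
/-- The chain rule for substitution into a power series. -/
theorem pderiv_subst {R σ τ : Type*} [CommRing R] [Fintype σ] {a : σ → MvPowerSeries τ R}
    (ha : MvPowerSeries.HasSubst a) (f : MvPowerSeries σ R) (t : τ) :
    MvPowerSeries.pderiv R t (MvPowerSeries.subst a f) =
      ∑ s, MvPowerSeries.subst a (MvPowerSeries.pderiv R s f) * MvPowerSeries.pderiv R t (a s) := by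
  classical
  let : UniformSpace R := ⊥
  have : DiscreteUniformity R := ⟨rfl⟩
  have hcs : Continuous fun g : MvPowerSeries σ R => (MvPowerSeries.subst a g : MvPowerSeries τ R) :=
    MvPowerSeries.continuous_subst ha
  suffices h : (fun f => MvPowerSeries.pderiv R t (MvPowerSeries.subst a f)) = fun f =>
      ∑ s, MvPowerSeries.subst a (MvPowerSeries.pderiv R s f) * MvPowerSeries.pderiv R t (a s) from
    congrFun h f
  refine (MvPowerSeries.WithPiTopology.denseRange_toMvPowerSeries (σ := σ) (R := R)).equalizer
    ((continuous_pderiv t).comp hcs)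
    (continuous_finsetSum _ fun s _ => (hcs.comp (continuous_pderiv s)).mul continuous_const) ?_
  funext p
  simp only [Function.comp]
  induction p using MvPolynomial.induction_on with
  | C r =>
    rw [MvPolynomial.coe_C, MvPowerSeries.subst_C, MvPowerSeries.pderiv_C, eq_comm]
    refine sum_eq_zero fun s _ => ?_
    rw [MvPowerSeries.pderiv_C, ← MvPowerSeries.substAlgHom_apply ha, map_zero, zero_mul]
  | add p q hp hq =>
    simp only [MvPolynomial.coe_add, map_add, MvPowerSeries.subst_add ha, hp, hq, add_mul,
      sum_add_distrib]
  | mul_X p s hp =>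
    simp only [MvPolynomial.coe_mul, MvPolynomial.coe_X, Derivation.leibniz, smul_eq_mul,
      MvPowerSeries.subst_add ha, MvPowerSeries.subst_mul ha, MvPowerSeries.subst_X ha, hp,
      MvPowerSeries.pderiv_X, add_mul, sum_add_distrib, mul_sum]
    congr 1
    · rw [sum_eq_single s]
      · rw [Pi.single_eq_same, ← MvPowerSeries.substAlgHom_apply ha 1, map_one, mul_one]
      · intro r _ hr
        rw [Pi.single_eq_of_ne hr.symm, ← MvPowerSeries.substAlgHom_apply ha 0, map_zero, mul_zero,
          zero_mul]
      · exact fun h => absurd (mem_univ s) h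
    · exact sum_congr rfl fun _ _ => (mul_assoc _ _ _).symm

theorem pderiv_powerSeries_subst {R τ : Type*} [CommRing R] {a : MvPowerSeries τ R}
    (ha : PowerSeries.HasSubst a) (f : PowerSeries R) (t : τ) :
    MvPowerSeries.pderiv R t (PowerSeries.subst a f) =
      PowerSeries.subst a (PowerSeries.derivative R f) * MvPowerSeries.pderiv R t a := by
  have h := pderiv_subst ha.const f t
  rw [Fintype.sum_unique] at h
  exact h

end ChainRule

/-! ### The change of variables -/

section Gamma

variable {m : ℕ}

/-- `w_i Q'(w_i)`. -/
noncomputable def dQ (i : Fin m) : Series m :=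
  w i * PowerSeries.subst (w i) (PowerSeries.derivative Coeffs Q)

theorem pderiv_w (i : Fin m) (s : Option (Fin m)) :
    MvPowerSeries.pderiv Coeffs s (w i) = if s = some i then 1 else 0 := by
  split_ifs with h
  · subst h; exact MvPowerSeries.pderiv_X_self
  · exact MvPowerSeries.pderiv_X_of_ne (Ne.symm h)

theorem euler_Qw (i : Fin m) (s : Option (Fin m)) :
    euler s (Qw i) = if s = some i then dQ i else 0 := by
  rw [euler, Qw, pderiv_powerSeries_subst (hasSubst_w i), pderiv_w]
  split_ifs with h
  · subst h
    rw [mul_one]; rfl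
  · rw [mul_zero, mul_zero]

theorem euler_mul (s : Option (Fin m)) (f g : Series m) :
    euler s (f * g) = f * euler s g + g * euler s f := by
  simp only [euler, Derivation.leibniz, smul_eq_mul]; ring

theorem euler_add (s : Option (Fin m)) (f g : Series m) :
    euler s (f + g) = euler s f + euler s g := by
  simp only [euler, map_add, mul_add]

theorem euler_sub (s : Option (Fin m)) (f g : Series m) :
    euler s (f - g) = euler s f - euler s g := by
  simp only [euler, map_sub, mul_sub]

theorem euler_u (s : Option (Fin m)) : euler s (u m) = if s = none then u m else 0 := by
  classical
  rw [euler, u]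
  split_ifs with h
  · subst h
    rw [MvPowerSeries.pderiv_X_self, mul_one]
  · rw [MvPowerSeries.pderiv_X_of_ne (Ne.symm h), mul_zero]

theorem euler_w (i : Fin m) (s : Option (Fin m)) : euler s (w i) = if s = some i then w i else 0 := by
  rw [euler, pderiv_w]
  split_ifs with h
  · subst h; rw [mul_one]; rfl
  · rw [mul_zero]

theorem euler_none_dQ (i : Fin m) : euler none (dQ i) = 0 := by
  have h : euler none (PowerSeries.subst (w i) (PowerSeries.derivative Coeffs Q)) = 0 := by
    rw [euler, pderiv_powerSeries_subst (hasSubst_w i), pderiv_w, if_neg (by simp), mul_zero,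
      mul_zero]
  rw [dQ, euler_mul, h, euler_w, if_neg (by simp), mul_zero, mul_zero, zero_add]

theorem euler_none_one_sub (i : Fin m) : euler none (1 - u m * dQ i) = -(u m * dQ i) := by
  have h1 : euler none (1 : Series m) = 0 := by
    rw [euler, Derivation.map_one_eq_zero, mul_zero]
  rw [euler_sub, h1, euler_mul, euler_none_dQ, euler_u, if_pos rfl]
  ring

theorem euler_xOfW (i : Fin m) (s : Option (Fin m)) :
    euler s (xOfW i) = xOfW i * ((if s = some i then 1 - u m * dQ i else 0) -
      (if s = none then u m * Qw i else 0)) := by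
  have hexp : euler s (PowerSeries.subst (-(u m * Qw i)) (PowerSeries.exp Coeffs)) =
      PowerSeries.subst (-(u m * Qw i)) (PowerSeries.exp Coeffs) * -(euler s (u m * Qw i)) := by
    rw [euler, pderiv_powerSeries_subst (hasSubst_exp i), PowerSeries.derivative_exp, euler, map_neg]
    ring
  rw [xOfW, euler_mul, hexp, euler_mul, euler_u, euler_w, euler_Qw]
  rcases s with _ | j
  · simp; ring
  · by_cases h : j = i
    · simp [h]; ring
    · simp [h]

theorem mul_mu' (i : Fin m) : (1 - u m * dQ i) * mu i = 1 := by
  rw [dQ, ← mul_assoc, mul_mu]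

/-- The change of variables as a homomorphism. -/
noncomputable def gammaHom (m : ℕ) : Series m →ₐ[Coeffs] Series m :=
  MvPowerSeries.substAlgHom (hasSubst_gammaVals m)

theorem gammaHom_apply (f : Series m) : gammaHom m f = Gamma f :=
  MvPowerSeries.substAlgHom_apply _ f

theorem gammaHom_X (s : Option (Fin m)) : gammaHom m (MvPowerSeries.X s) = gammaVals m s :=
  MvPowerSeries.substAlgHom_X _ s

theorem gammaHom_u : gammaHom m (u m) = u m := gammaHom_X none

theorem gammaHom_w (i : Fin m) : gammaHom m (w i) = xOfW i := gammaHom_X (some i)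

theorem euler_gammaHom (s : Option (Fin m)) (f : Series m) :
    euler s (gammaHom m f) = gammaHom m (MvPowerSeries.pderiv Coeffs none f) * euler s (u m) +
      ∑ i, gammaHom m (MvPowerSeries.pderiv Coeffs (some i) f) * euler s (xOfW i) := by
  rw [euler, gammaHom_apply, Gamma, pderiv_subst (hasSubst_gammaVals m), mul_sum,
    Fintype.sum_option]
  simp only [gammaHom_apply, euler, Gamma]
  exact congrArg₂ (· + ·) (mul_left_comm _ _ _) (sum_congr rfl fun i _ => mul_left_comm _ _ _)

theorem euler_some_gammaHom (i : Fin m) (f : Series m) :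
    euler (some i) (gammaHom m f) = (1 - u m * dQ i) * gammaHom m (euler (some i) f) := by
  rw [euler_gammaHom, euler_u, if_neg (by simp), mul_zero, zero_add, sum_eq_single i]
  · rw [euler_xOfW, if_pos rfl, if_neg (by simp), euler, map_mul, gammaHom_X]
    simp only [gammaVals]
    ring
  · intro j _ hj
    rw [euler_xOfW, if_neg (by simpa using hj.symm), if_neg (by simp), sub_zero, mul_zero, mul_zero]
  · exact fun h => absurd (mem_univ i) h

/-- The change of variables turns `x_i ∂/∂x_i` into `μ_i w_i ∂/∂w_i`. -/
theorem gammaHom_euler_some (i : Fin m) (f : Series m) :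
    gammaHom m (euler (some i) f) = mu i * euler (some i) (gammaHom m f) := by
  rw [euler_some_gammaHom, ← mul_assoc, mul_comm (mu i), mul_mu', one_mul]

/-- The operator `u ∂/∂u` at fixed `x` differs from the one at fixed `w`, since `x_i` depends on `u`
when `w_i` is fixed. -/
theorem gammaHom_euler_none (f : Series m) :
    gammaHom m (euler none f) = euler none (gammaHom m f) +
      ∑ i, u m * Qw i * gammaHom m (euler (some i) f) := by
  rw [euler_gammaHom, euler_u, if_pos rfl, add_assoc, ← sum_add_distrib, sum_eq_zero, add_zero,
    euler, map_mul, gammaHom_X, mul_comm]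
  · rfl
  · intro i _
    rw [euler_xOfW, if_neg (by simp), if_pos rfl, euler, map_mul, gammaHom_X]
    simp only [gammaVals]
    ring

theorem rename_powerSeries_subst {k : ℕ} (ι : Fin k ↪ Fin m) {a : Series k}
    (ha : PowerSeries.HasSubst a) (f : PowerSeries Coeffs) :
    MvPowerSeries.rename ι.optionMap (PowerSeries.subst a f) =
      PowerSeries.subst (MvPowerSeries.rename ι.optionMap a) f := by
  rw [MvPowerSeries.rename_eq_subst, PowerSeries.subst, PowerSeries.subst,
    MvPowerSeries.subst_comp_subst_apply ha.const (MvPowerSeries.HasSubst.X_comp _),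
    MvPowerSeries.rename_eq_subst]

theorem rename_w {k : ℕ} (ι : Fin k ↪ Fin m) (i : Fin k) :
    MvPowerSeries.rename ι.optionMap (w i) = w (ι i) :=
  MvPowerSeries.rename_X _ _

theorem rename_u {k : ℕ} (ι : Fin k ↪ Fin m) :
    MvPowerSeries.rename ι.optionMap (u k) = u m :=
  MvPowerSeries.rename_X _ _

theorem rename_gammaVals {k : ℕ} (ι : Fin k ↪ Fin m) (s : Option (Fin k)) :
    MvPowerSeries.rename ι.optionMap (gammaVals k s) = gammaVals m (ι.optionMap s) := by
  rcases s with _ | i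
  · exact rename_u ι
  · change MvPowerSeries.rename ι.optionMap (xOfW i) = xOfW (ι i)
    rw [xOfW, xOfW, map_mul, rename_w, rename_powerSeries_subst ι (hasSubst_exp i), map_neg,
      map_mul, rename_u, Qw, rename_powerSeries_subst ι (hasSubst_w i), rename_w, Qw]

/-- The change of variables is compatible with renaming. -/
theorem rename_Gamma {k : ℕ} (ι : Fin k ↪ Fin m) (f : Series k) :
    MvPowerSeries.rename ι.optionMap (Gamma f) = gammaHom m (MvPowerSeries.rename ι.optionMap f) := by
  rw [MvPowerSeries.rename_eq_subst, gammaHom_apply, Gamma, Gamma, MvPowerSeries.rename_eq_subst,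
    MvPowerSeries.subst_comp_subst_apply (hasSubst_gammaVals k) (MvPowerSeries.HasSubst.X_comp _),
    MvPowerSeries.subst_comp_subst_apply (MvPowerSeries.HasSubst.X_comp _) (hasSubst_gammaVals m)]
  congr 1
  funext s
  rw [← MvPowerSeries.rename_eq_subst, rename_gammaVals, Function.comp_apply,
    MvPowerSeries.subst_X (hasSubst_gammaVals m)]

theorem hAt_eq {α : Finset (Fin m)} (hα : α.Nonempty) : hAt 0 α = gammaHom m (HA α) := by
  rw [hAt, h, rename_Gamma, HA_eq_rename hα]

theorem hAtD_eq {α : Finset (Fin m)} (hα : α.Nonempty) (i : Fin m) :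
    mu i * hAtD 0 α i = gammaHom m (euler (some i) (HA α)) := by
  rw [gammaHom_euler_some, ← hAt_eq hα]; rfl

end Gamma

/-! ### Divisibility by powers of `u` -/

section Divisibility

variable {m : ℕ}

theorem u_pow_dvd_iff {n : ℕ} {f : Series m} :
    u m ^ n ∣ f ↔ ∀ e : Option (Fin m) →₀ ℕ, e none < n → MvPowerSeries.coeff e f = 0 :=
  MvPowerSeries.X_pow_dvd_iff

theorem u_dvd_iff {f : Series m} :
    u m ∣ f ↔ ∀ e : Option (Fin m) →₀ ℕ, e none = 0 → MvPowerSeries.coeff e f = 0 :=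
  MvPowerSeries.X_dvd_iff

theorem eq_zero_of_u_pow_dvd {f : Series m} (h : ∀ n, u m ^ n ∣ f) : f = 0 := by
  ext1 e
  rw [u_pow_dvd_iff.1 (h (e none + 1)) e (Nat.lt_succ_self _), map_zero]

theorem u_pow_dvd_euler {n : ℕ} {f : Series m} (s : Option (Fin m)) (h : u m ^ n ∣ f) :
    u m ^ n ∣ euler s f := by
  rw [u_pow_dvd_iff] at h ⊢
  intro e he
  rw [coeff_euler, h e he, smul_zero]

/-- Away from the exponent `k`, the operator `u ∂/∂u - k` detects powers of `u`. -/
theorem u_pow_succ_dvd_of_euler {n k : ℕ} {f : Series m} (hk : n ≠ k) (h : u m ^ n ∣ f)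
    (h' : u m ^ (n + 1) ∣ euler none f - (k : Series m) * f) : u m ^ (n + 1) ∣ f := by
  rw [u_pow_dvd_iff] at h h' ⊢
  intro e he
  by_cases hn : e none < n
  · exact h e hn
  · have h1 := h' e he
    have h2 : e none = n := by omega
    rw [map_sub, coeff_euler, coeff_natCast_mul, ← sub_smul, h2, smul_eq_zero] at h1
    refine h1.resolve_left ?_
    rw [sub_eq_zero]
    exact_mod_cast hk

/-- Divisibility by powers of `u` is a bound on the order in `u`, which is additive on products. -/
theorem le_weightedOrder_iff {n : ℕ} {f : Series m} :
    (n : ℕ∞) ≤ f.weightedOrder (Pi.single none 1) ↔ u m ^ n ∣ f := by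
  rw [u_pow_dvd_iff]
  constructor
  · intro h e he
    refine MvPowerSeries.coeff_eq_zero_of_lt_weightedOrder (Pi.single none 1) ?_
    rw [Finsupp.weight_single_one_apply]
    exact lt_of_lt_of_le (by exact_mod_cast he) h
  · intro h
    refine MvPowerSeries.nat_le_weightedOrder _ fun e he => ?_
    rw [Finsupp.weight_single_one_apply] at he
    exact h e he

theorem u_pow_dvd_of_mul {n : ℕ} {b f : Series m} (hb : ¬ u m ∣ b) (h : u m ^ n ∣ b * f) :
    u m ^ n ∣ f := by
  have hb0 : b.weightedOrder (Pi.single none 1) = 0 := by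
    by_contra h0
    apply hb
    rw [← pow_one (u m), ← le_weightedOrder_iff, Nat.cast_one]
    exact Order.one_le_iff_ne_zero.2 h0
  rw [← le_weightedOrder_iff, MvPowerSeries.weightedOrder_mul, hb0, zero_add] at h
  exact le_weightedOrder_iff.1 h

/-- Substitution respects congruence modulo `u`. -/
theorem u_dvd_subst_sub {σ : Type*} {a b : σ → Series m} (ha : MvPowerSeries.HasSubst a)
    (hb : MvPowerSeries.HasSubst b) (h : ∀ s, u m ∣ a s - b s) (f : MvPowerSeries σ Coeffs) :
    u m ∣ MvPowerSeries.subst a f - MvPowerSeries.subst b f := by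
  rw [u_dvd_iff]
  intro e he
  rw [map_sub, MvPowerSeries.coeff_subst ha, MvPowerSeries.coeff_subst hb, sub_eq_zero]
  refine finsum_congr fun d => ?_
  congr 1
  have h1 : u m ∣ (d.prod fun s n => a s ^ n) - d.prod fun s n => b s ^ n := by
    rw [← Ideal.mem_span_singleton, ← Ideal.Quotient.eq, Finsupp.prod, Finsupp.prod, map_prod,
      map_prod]
    refine prod_congr rfl fun s _ => ?_
    rw [map_pow, map_pow]
    congr 1
    rw [Ideal.Quotient.eq, Ideal.mem_span_singleton]
    exact h s
  have h2 := u_dvd_iff.1 h1 e he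
  rwa [map_sub, sub_eq_zero] at h2

theorem u_dvd_xOfW_sub (i : Fin m) : u m ∣ xOfW i - w i := by
  have h0 : PowerSeries.HasSubst (0 : Series m) := PowerSeries.HasSubst.of_constantCoeff_zero (by simp)
  have h1 : u m ∣ PowerSeries.subst (-(u m * Qw i)) (PowerSeries.exp Coeffs) -
      PowerSeries.subst (0 : Series m) (PowerSeries.exp Coeffs) :=
    u_dvd_subst_sub (hasSubst_exp i).const h0.const
      (fun _ => ⟨-Qw i, by ring⟩) _
  have h2 : PowerSeries.subst (0 : Series m) (PowerSeries.exp Coeffs) = 1 := by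
    have : PowerSeries.subst (0 : Series m) (PowerSeries.exp Coeffs) =
      MvPowerSeries.map (algebraMap Coeffs Coeffs)
        (MvPowerSeries.C (MvPowerSeries.constantCoeff (σ := Unit) (PowerSeries.exp Coeffs))) :=
      MvPowerSeries.subst_zero_eq_C_constantCoeff
    rw [this]
    have hc : MvPowerSeries.constantCoeff (σ := Unit) (PowerSeries.exp Coeffs) = 1 :=
      PowerSeries.constantCoeff_exp
    rw [hc, map_one, map_one]
  rw [h2] at h1
  have : xOfW i - w i = w i *
      (PowerSeries.subst (-(u m * Qw i)) (PowerSeries.exp Coeffs) - 1) := by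
    rw [xOfW]; ring
  rw [this]
  exact h1.mul_left _

/-- The change of variables is the identity at `u = 0`. -/
theorem u_dvd_gammaHom_sub (f : Series m) : u m ∣ gammaHom m f - f := by
  have h := u_dvd_subst_sub (hasSubst_gammaVals m) MvPowerSeries.HasSubst.X (fun s => ?_) f
  · rw [MvPowerSeries.subst_self] at h
    rw [gammaHom_apply]
    exact h
  · rcases s with _ | i
    · exact ⟨0, by rw [mul_zero]; exact sub_self _⟩
    · exact u_dvd_xOfW_sub i

theorem u_pow_dvd_gammaHom {n : ℕ} {f : Series m} (h : u m ^ n ∣ f) : u m ^ n ∣ gammaHom m f := by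
  obtain ⟨g, rfl⟩ := h
  rw [map_mul, map_pow, gammaHom_u]
  exact dvd_mul_right _ _

end Divisibility

/-! ### Terms of lowest order in `u` -/

section Initial

variable {m : ℕ}

theorem euler_HA_eq_zero {α : Finset (Fin m)} {i : Fin m} (hi : i ∉ α) :
    euler (some i) (HA α) = 0 := by
  ext1 e
  rw [coeff_euler, map_zero]
  by_cases hei : e (some i) = 0
  · rw [hei, Nat.cast_zero, zero_smul]
  · rw [coeff_HA_eq_zero hi hei, smul_zero]

/-- There is no term without `u`: every permutation of a nonempty set has a cycle. -/
theorem u_dvd_HA {α : Finset (Fin m)} (hα : α.Nonempty) : u m ∣ HA α := by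
  classical
  rw [u_dvd_iff]
  intro e he
  by_cases h : ∀ i ∉ α, e (some i) = 0
  swap
  · push Not at h
    obtain ⟨i, hi, hei⟩ := h
    exact coeff_HA_eq_zero hi hei
  rw [coeff_HA_eq_factSum hα e h, factSum, sum_eq_zero, smul_zero]
  intro σ _
  refine sum_eq_zero fun T _ => if_neg ?_
  rintro ⟨-, hp, hn⟩
  obtain ⟨i, hi⟩ := hα
  have hei : 0 < e (some i) := by
    refine (T.prod * σ).partition.parts_pos ?_
    rw [hp]
    exact Multiset.mem_map_of_mem _ hi
  have hd0 : 0 < deg e := lt_of_lt_of_le hei (single_le_sum (f := fun i => e (some i))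
    (fun _ _ => Nat.zero_le _) (mem_univ i))
  have : Nonempty (Fin (deg e)) := ⟨⟨0, hd0⟩⟩
  have h2 := ncyc_pos σ
  omega

/-- There are `(d - 1)!` cycles of length `d`, also for `d = 1`. -/
theorem mul_card_cycles {d : ℕ} (hd : d ≠ 0) :
    d * #{σ : Perm (Fin d) | σ.partition.parts = {d}} = d.factorial := by
  classical
  rcases Nat.lt_or_ge d 2 with h | h
  · obtain rfl : d = 1 := by omega
    have : ∀ σ : Perm (Fin 1), σ.partition.parts = {1} := by
      intro σ
      rw [Subsingleton.elim σ 1, parts_partition]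
      simp
    simp [this]
  · have h1 : ∀ σ : Perm (Fin d), σ.partition.parts = {d} ↔ σ.cycleType = {d} := by
      intro σ
      constructor
      · intro hp
        rw [← filter_parts_partition_eq_cycleType, hp, Multiset.filter_singleton, if_pos h]
      · intro hp
        rw [parts_partition, hp, ← sum_cycleType, hp]
        simp
    have h2 := card_of_cycleType_mul_eq (α := Fin d) {d}
    simp only [Multiset.sum_singleton, Fintype.card_fin, Multiset.mem_singleton, forall_eq, h,
      le_refl, and_self, if_true, Nat.sub_self, Nat.factorial_zero, Multiset.prod_singleton,
      Multiset.toFinset_singleton, prod_singleton, Multiset.count_singleton_self, Nat.factorial_one,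
      one_mul, mul_one] at h2
    simp only [h1]
    rw [mul_comm, h2]

theorem conn_nil_of_ncyc_eq_one {V : Type*} [Fintype V] [DecidableEq V] {σ : Perm V}
    (h : ncyc σ = 1) : Conn σ [] := by
  classical
  intro B _ hB
  rcases B.eq_empty_or_nonempty with h0 | ⟨x, hx⟩
  · exact Or.inl h0
  · right
    rw [eq_univ_iff_forall]
    intro y
    rw [ncyc_eq_card_image (isLabelling_mk σ), card_eq_one] at h
    obtain ⟨c, hc⟩ := h
    have hq : ∀ z, Quotient.mk (Perm.SameCycle.setoid σ) z = c := fun z => by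
      rw [← mem_singleton, ← hc]
      exact mem_image_of_mem _ (mem_univ z)
    have hxy : σ.SameCycle x y := (isLabelling_mk σ x y).1 ((hq x).trans (hq y).symm)
    have := SameCycle.of_rel (Setoid.ker fun z => z ∈ B)
      (fun z => propext (hB.1 z).symm) hxy
    exact (Iff.of_eq this).1 hx

/-- Without transpositions, a transitive factorization is a `d`-cycle. -/
theorem factSum_zero {d : ℕ} (hd : d ≠ 0) :
    (d : ℚ) • factSum d 0 1 {d} = (d.factorial : ℚ) • (MvPolynomial.X d : Coeffs) := by
  classical
  have h1 : factSum d 0 1 {d} = #{σ : Perm (Fin d) | σ.partition.parts = {d}} •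
      (MvPolynomial.X d : Coeffs) := by
    rw [factSum, ← sum_const, sum_filter]
    refine sum_congr rfl fun σ _ => ?_
    rw [sum_listsOf_zero, List.prod_nil, one_mul]
    by_cases h : σ.partition.parts = {d}
    · have hn : ncyc σ = 1 := by rw [ncyc, h, Multiset.card_singleton]
      rw [if_pos ⟨(conn_iff_trans σ []).1 (conn_nil_of_ncyc_eq_one hn), h, hn⟩, if_pos h, qwt, h,
        Multiset.map_singleton, Multiset.prod_singleton]
    · rw [if_neg fun h' => h h'.2.1, if_neg h]
  rw [h1, ← mul_card_cycles hd, ← Nat.cast_smul_eq_nsmul ℚ, smul_smul]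
  push_cast
  rfl

theorem coeff_Qw (i : Fin m) (e : Option (Fin m) →₀ ℕ) :
    MvPowerSeries.coeff e (Qw i) =
      if e = Finsupp.single (some i) (e (some i)) ∧ e (some i) ≠ 0 then
        (MvPolynomial.X (e (some i)) : Coeffs) else 0 := by
  classical
  rw [Qw, PowerSeries.coeff_subst (hasSubst_w i), finsum_eq_single _ (e (some i))]
  · rw [w, MvPowerSeries.coeff_X_pow, Q, PowerSeries.coeff_mk]
    by_cases h1 : e = Finsupp.single (some i) (e (some i))
    · by_cases h2 : e (some i) = 0
      · simp [h2]
      · simp [← h1, h2]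
    · simp [h1]
  · intro n hn
    rw [w, MvPowerSeries.coeff_X_pow, if_neg, smul_zero]
    rintro rfl
    simp at hn

/-- The terms of lowest order in `u` of the one-part series. -/
theorem u_sq_dvd_euler_HA_singleton (i : Fin m) :
    u m ^ 2 ∣ euler (some i) (HA {i}) - u m * Qw i := by
  classical
  rw [u_pow_dvd_iff]
  intro e he
  rw [map_sub, u, coeff_X_mul', coeff_euler, sub_eq_zero]
  split_ifs with h0
  · rw [u_dvd_iff.1 (u_dvd_HA (singleton_nonempty i)) e h0, smul_zero]
  have h1 : e none = 1 := by omega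
  rw [coeff_Qw]
  have h2 : (e - Finsupp.single none 1 : Option (Fin m) →₀ ℕ) (some i) = e (some i) := by
    simp [Finsupp.tsub_apply]
  rw [h2]
  by_cases hz : e (some i) = 0
  · rw [if_neg fun h => h.2 hz, hz, Nat.cast_zero, zero_smul]
  by_cases hs : ∀ j ∉ ({i} : Finset (Fin m)), e (some j) = 0
  · have hd : deg e = e (some i) := by
      rw [deg, sum_eq_single i]
      · exact fun j _ hj => hs j (by simpa using hj)
      · exact fun h => absurd (mem_univ i) h
    rw [if_pos, coeff_HA_eq_factSum (singleton_nonempty i) e hs, hd, h1, card_singleton,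
      singleton_val, Multiset.map_singleton, smul_comm, factSum_zero hz, smul_smul]
    · have : (autM {e (some i)} : ℚ) = 1 := by simp [autM]
      rw [this]
      have hf : ((e (some i)).factorial : ℚ) ≠ 0 := by positivity
      simp [hf]
    · refine ⟨?_, hz⟩
      ext s
      rcases s with _ | j
      · simp [Finsupp.tsub_apply, h1]
      · by_cases hj : j = i
        · subst hj; simp [Finsupp.tsub_apply]
        · simp [Finsupp.tsub_apply, hs j (by simpa using hj), Ne.symm hj]
  · push Not at hs
    obtain ⟨j, hj, hej⟩ := hs
    rw [coeff_HA_eq_zero hj hej, smul_zero, if_neg]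
    rintro ⟨h, -⟩
    have := DFunLike.congr_fun h (some j)
    rw [Finsupp.single_apply, if_neg (by simpa using Ne.symm (by simpa using hj))] at this
    apply hej
    simpa [Finsupp.tsub_apply] using this

end Initial

/-! ### The series with one part -/

section OnePart

variable {m : ℕ}

theorem euler_comm (s t : Option (Fin m)) (f : Series m) :
    euler s (euler t f) = euler t (euler s f) := by
  ext1 e
  simp only [coeff_euler]
  rw [smul_comm]

theorem euler_natCast_mul (s : Option (Fin m)) (n : ℕ) (f : Series m) :
    euler s ((n : Series m) * f) = (n : Series m) * euler s f := by
  ext1 e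
  simp only [coeff_euler, coeff_natCast_mul]
  rw [smul_comm]

/-- The series `Γ(x_i ∂H_α/∂x_i) = μ_i w_i ∂h_α/∂w_i`. -/
noncomputable def gD (α : Finset (Fin m)) (i : Fin m) : Series m :=
  gammaHom m (euler (some i) (HA α))

theorem euler_gammaHom_HA (α : Finset (Fin m)) (i : Fin m) :
    euler (some i) (gammaHom m (HA α)) = (1 - u m * dQ i) * gD α i :=
  euler_some_gammaHom i _

/-- The change of variables applied to the derivative in `u`. -/
theorem gammaHom_euler_none_HA (α : Finset (Fin m)) :
    gammaHom m (euler none (HA α)) = euler none (gammaHom m (HA α)) +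
      ∑ i ∈ α, u m * Qw i * gD α i := by
  rw [gammaHom_euler_none]
  congr 1
  symm
  refine sum_subset (subset_univ α) fun i _ hi => ?_
  rw [gD, euler_HA_eq_zero hi, map_zero, mul_zero]

theorem mem_of_mem_splits {α : Finset (Fin m)} {t : Finset (Fin m) × Finset (Fin m) × Fin m}
    (h : t ∈ splits α) : t.2.2 ∈ t.1 ∧ t.2.2 ∈ t.2.1 ∧ t.1 ⊆ α ∧ t.2.1 ⊆ α := by
  rw [mem_splits] at h
  have hj : t.2.2 ∈ t.1 ∩ t.2.1 := h.2 ▸ mem_singleton_self _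
  rw [mem_inter] at hj
  exact ⟨hj.1, hj.2, h.1 ▸ subset_union_left, h.1 ▸ subset_union_right⟩

/-- The two parts of a split play symmetric roles. -/
theorem sum_splits_swap {M : Type*} [AddCommMonoid M] (α : Finset (Fin m))
    (P : ℕ → ℕ → Prop) [∀ a b, Decidable (P a b)]
    (f : Finset (Fin m) × Finset (Fin m) × Fin m → M) :
    ∑ t ∈ splits α with P #t.2.1 #t.1, f t =
      ∑ t ∈ splits α with P #t.1 #t.2.1, f (t.2.1, t.1, t.2.2) := by
  refine sum_nbij' (fun t => (t.2.1, t.1, t.2.2)) (fun t => (t.2.1, t.1, t.2.2)) ?_ ?_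
    (fun _ _ => rfl) (fun _ _ => rfl) (fun _ _ => rfl)
  all_goals
    intro t ht
    rw [mem_filter, mem_splits] at ht ⊢
    refine ⟨⟨by rw [union_comm]; exact ht.1.1, by rw [inter_comm]; exact ht.1.2⟩, ht.2⟩

/-- A split with a part of size one is determined by the common label. -/
theorem sum_splits_card_one {M : Type*} [AddCommMonoid M] (α : Finset (Fin m))
    (f : Finset (Fin m) × Finset (Fin m) × Fin m → M) :
    ∑ t ∈ splits α with #t.1 = 1, f t = ∑ i ∈ α, f ({i}, α, i) := by
  have key : ∀ t ∈ splits α, #t.1 = 1 → t = ({t.2.2}, α, t.2.2) := by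
    rintro ⟨β, ζ, i⟩ ht h1
    obtain ⟨h2, h3, h4, h5⟩ := mem_of_mem_splits ht
    obtain ⟨j, hj⟩ := card_eq_one.1 h1
    change β = {j} at hj
    subst hj
    obtain rfl : i = j := mem_singleton.1 h2
    rw [mem_splits] at ht
    have : ζ = α := by
      rw [← ht.1]
      exact (union_eq_right.2 (singleton_subset_iff.2 h3)).symm
    rw [this]
  refine sum_nbij' (fun t => t.2.2) (fun i => ({i}, α, i)) ?_ ?_ ?_ (fun _ _ => rfl) ?_
  · intro t ht
    rw [mem_filter] at ht
    have := mem_of_mem_splits ht.1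
    exact this.2.2.1 this.1
  · intro i hi
    rw [mem_filter, mem_splits]
    refine ⟨⟨union_eq_right.2 (singleton_subset_iff.2 hi), ?_⟩, card_singleton i⟩
    exact inter_eq_left.2 (singleton_subset_iff.2 hi)
  · intro t ht
    rw [mem_filter] at ht
    exact (key t ht.1 ht.2).symm
  · intro t ht
    rw [mem_filter] at ht
    exact congrArg f (key t ht.1 ht.2)

/-- A split with a part of size two is determined by the common label and the other label of this
part. -/
theorem sum_splits_card_two {M : Type*} [AddCommMonoid M] (α : Finset (Fin m))
    (f : Finset (Fin m) × Finset (Fin m) × Fin m → M) :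
    ∑ t ∈ splits α with #t.1 = 2, f t =
      ∑ q ∈ α.offDiag, f ({q.1, q.2}, α.erase q.2, q.1) := by
  symm
  refine sum_bij (fun q _ => ({q.1, q.2}, α.erase q.2, q.1)) ?_ ?_ ?_ (fun _ _ => rfl)
  · rintro ⟨k, l⟩ hq
    rw [mem_offDiag] at hq
    obtain ⟨hk, hl, hkl⟩ := hq
    change k ≠ l at hkl
    rw [mem_filter, mem_splits]
    refine ⟨⟨?_, ?_⟩, card_pair hkl⟩
    · ext x
      simp only [mem_union, mem_insert, mem_singleton, mem_erase]
      constructor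
      · rintro ((rfl | rfl) | h)
        exacts [hk, hl, h.2]
      · intro hx
        by_cases hxl : x = l
        · exact Or.inl (Or.inr hxl)
        · exact Or.inr ⟨hxl, hx⟩
    · ext x
      simp only [mem_inter, mem_insert, mem_singleton, mem_erase]
      constructor
      · rintro ⟨rfl | rfl, h⟩
        exacts [rfl, absurd rfl h.1]
      · rintro rfl
        exact ⟨Or.inl rfl, hkl, hk⟩
  · rintro ⟨k, l⟩ hq ⟨k', l'⟩ hq' h
    rw [mem_offDiag] at hq hq'
    simp only [Prod.mk.injEq] at h ⊢
    obtain ⟨h1, -, rfl⟩ := h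
    refine ⟨rfl, ?_⟩
    have : l ∈ ({k, l'} : Finset (Fin m)) := h1 ▸ mem_insert_of_mem (mem_singleton_self l)
    rw [mem_insert, mem_singleton] at this
    exact this.resolve_left (Ne.symm hq.2.2)
  · rintro ⟨β, ζ, i⟩ ht
    rw [mem_filter] at ht
    obtain ⟨ht, h2⟩ := ht
    obtain ⟨hiβ, hiζ, hβ, hζ⟩ := mem_of_mem_splits ht
    rw [mem_splits] at ht
    change #β = 2 at h2
    change i ∈ β at hiβ
    have h3 : #(β.erase i) = 1 := by rw [card_erase_of_mem hiβ, h2]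
    obtain ⟨l, hl⟩ := card_eq_one.1 h3
    have hβ' : β = {i, l} := by rw [← insert_erase hiβ, hl]
    have hil : i ≠ l := by
      rintro rfl
      exact notMem_erase i β (hl ▸ mem_singleton_self i)
    have hlβ : l ∈ β := by rw [hβ']; exact mem_insert_of_mem (mem_singleton_self l)
    have hlζ : l ∉ ζ := fun h => hil (mem_singleton.1 (ht.2 ▸ mem_inter.2 ⟨hlβ, h⟩ :
      l ∈ ({i} : Finset (Fin m)))).symm
    refine ⟨(i, l), mem_offDiag.2 ⟨hβ hiβ, hβ hlβ, hil⟩, ?_⟩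
    have hζ' : α.erase l = ζ := by
      ext x
      rw [mem_erase]
      constructor
      · rintro ⟨hx, hxα⟩
        rw [← ht.1] at hxα
        rcases mem_union.1 hxα with h | h
        · change x ∈ β at h
          rw [hβ', mem_insert, mem_singleton] at h
          rcases h with rfl | rfl
          · exact hiζ
          · exact absurd rfl hx
        · exact h
      · intro hx
        exact ⟨fun h => hlζ (h ▸ hx), hζ hx⟩
    rw [← hβ', hζ']

theorem two_ne_zero_series : (2 : Series m) ≠ 0 := by
  intro h
  have h' := congrArg MvPowerSeries.constantCoeff h
  rw [map_ofNat, map_zero] at h'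
  exact two_ne_zero h'

theorem splits_singleton (i : Fin m) : splits {i} = {({i}, {i}, i)} := by
  ext ⟨β, ζ, j⟩
  rw [mem_singleton]
  constructor
  · intro h
    obtain ⟨h1, h2, h3, h4⟩ := mem_of_mem_splits h
    obtain rfl : j = i := mem_singleton.1 (h3 h1)
    exact Prod.ext (h3.antisymm (singleton_subset_iff.2 h1))
      (Prod.ext (h4.antisymm (singleton_subset_iff.2 h2)) rfl)
  · rintro h
    rw [h, mem_splits]
    simp

/-- The one-part series: `Γ(x_i ∂H/∂x_i) = u Q_i`. The cut-and-join equation, differentiated in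
`w_i`, shows that the difference of the two sides is divisible by all powers of `u`. -/
theorem gD_singleton (i : Fin m) : gD {i} i = u m * Qw i := by
  set g := gD {i} i with hg
  -- the deviation from the claim; it satisfies the homogeneous equation `key`
  set δ := g - u m * Qw i with hδ
  set f := gammaHom m (HA {i}) with hf
  have hD : euler (some i) f = (1 - u m * dQ i) * g := euler_gammaHom_HA _ _
  have hE := gammaHom_euler_none_HA ({i} : Finset (Fin m))
  rw [sum_singleton, ← hf, ← hg] at hE
  have hcj := congrArg (gammaHom m) (cut_join ({i} : Finset (Fin m)))
  rw [splits_singleton, sum_singleton, offDiag_singleton, sum_empty, add_zero, card_singleton,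
    Nat.cast_one, map_mul, map_add, map_mul, map_mul, hE, map_sub, map_one, map_ofNat] at hcj
  change 2 * (euler none f + u m * Qw i * g + (1 - 2) * f) = g * g at hcj
  -- the derivative of the equation in `w_i`
  have hcj' := congrArg (euler (some i)) hcj
  have h2 : ∀ y : Series m, euler (some i) (2 * y) = 2 * euler (some i) y := fun y => by
    have := euler_natCast_mul (some i) 2 y
    simpa using this
  have h12 : ((1 : Series m) - 2) * f = -f := by ring
  have hneg : ∀ y : Series m, euler (some i) (-y) = -euler (some i) y := fun y => by
    simp only [euler, map_neg, mul_neg]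
  have hEc := euler_none_one_sub i
  have hEQ : euler none (u m * Qw i) = u m * Qw i := by
    rw [euler_mul, euler_u, euler_Qw, if_pos rfl, if_neg (by simp)]; ring
  have key : (1 - u m * dQ i) * (euler none δ - δ) = δ * euler (some i) g := by
    rw [h2, h12, euler_add, euler_add, hneg, euler_comm, hD, euler_mul, euler_mul, euler_mul,
      euler_mul, euler_u, euler_Qw, if_neg (Option.some_ne_none i), if_pos rfl, hEc] at hcj'
    rw [hδ, euler_sub, hEQ]
    refine mul_left_cancel₀ two_ne_zero_series ?_
    linear_combination hcj'
  have hδ2 : u m ^ 2 ∣ δ := by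
    have h1 := u_pow_dvd_gammaHom (u_sq_dvd_euler_HA_singleton i)
    rw [map_sub, map_mul, gammaHom_u] at h1
    have h3 : δ = gammaHom m (euler (some i) (HA {i})) - u m * gammaHom m (Qw i) +
        u m * (gammaHom m (Qw i) - Qw i) := by
      rw [hδ, hg, gD]; ring
    rw [h3, pow_two]
    refine dvd_add (by rwa [pow_two] at h1) (mul_dvd_mul_left _ (u_dvd_gammaHom_sub _))
  have hgu : u m ∣ g := by
    have : g = δ + u m * Qw i := by rw [hδ]; ring
    rw [this]
    exact dvd_add (dvd_trans (dvd_pow_self _ two_ne_zero) hδ2) (dvd_mul_right _ _)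
  have hgu' : u m ∣ euler (some i) g := by
    rw [← pow_one (u m)] at hgu ⊢
    exact u_pow_dvd_euler _ hgu
  -- `u ∂δ/∂u - δ` has higher order in `u` than `δ`, but a term of order `n ≥ 2` would survive
  have hall : ∀ n, u m ^ (n + 2) ∣ δ := by
    intro n
    induction n with
    | zero => exact hδ2
    | succ n ih =>
      refine u_pow_succ_dvd_of_euler (k := 1) (by omega) ih ?_
      have h3 : euler none δ - ((1 : ℕ) : Series m) * δ = mu i * (δ * euler (some i) g) := by
        rw [← key, ← mul_assoc, mul_comm (mu i), mul_mu', Nat.cast_one]; ring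
      rw [h3, pow_succ]
      exact (mul_dvd_mul ih hgu').mul_left _
  have hz : δ = 0 := eq_zero_of_u_pow_dvd fun n =>
    dvd_trans (pow_dvd_pow _ (by omega)) (hall n)
  exact sub_eq_zero.1 hz

end OnePart

/-! ### The series with two parts -/

section TwoParts

variable {m : ℕ}

theorem gammaHom_cutSeries {α : Finset (Fin m)} {k l : Fin m} (hk : k ∈ α) (hl : l ∈ α)
    (hkl : k ≠ l) : (xOfW k - xOfW l) * gammaHom m (cutSeries α k l) =
      xOfW l * gD (α.erase l) k - xOfW k * gD (α.erase k) l := by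
  have h := congrArg (gammaHom m) (sub_mul_cutSeries hk hl hkl)
  simpa only [map_mul, map_sub, gammaHom_w, gD] using h

theorem not_u_dvd_w_sub {k l : Fin m} (hkl : k ≠ l) : ¬ u m ∣ w k - w l := by
  classical
  intro h
  have := u_dvd_iff.1 h (Finsupp.single (some k) 1) (by simp)
  rw [map_sub, w, w, MvPowerSeries.coeff_X, MvPowerSeries.coeff_X, if_pos rfl, if_neg, sub_zero]
    at this
  · exact one_ne_zero this
  · intro h'
    have := DFunLike.congr_fun h' (some k)
    simp [Ne.symm hkl] at this

theorem not_u_dvd_xOfW_sub {k l : Fin m} (hkl : k ≠ l) : ¬ u m ∣ xOfW k - xOfW l := by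
  intro h
  apply not_u_dvd_w_sub hkl
  have h1 : w k - w l = (xOfW k - xOfW l) - (xOfW k - w k) + (xOfW l - w l) := by ring
  rw [h1]
  exact dvd_add (dvd_sub h (u_dvd_xOfW_sub k)) (u_dvd_xOfW_sub l)

/-- If `f / b` does not depend on `u` and vanishes at `u = 0`, then it is zero. -/
theorem eq_zero_of_mul_euler {b f : Series m} (hb : ¬ u m ∣ b) (hf : u m ∣ f)
    (h : b * euler none f = f * euler none b) : f = 0 := by
  have hEb : u m ∣ euler none b := dvd_mul_right _ _
  have hall : ∀ n, u m ^ (n + 1) ∣ f := by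
    intro n
    induction n with
    | zero => simpa using hf
    | succ n ih =>
      refine u_pow_succ_dvd_of_euler (k := 0) (by omega) ih ?_
      rw [Nat.cast_zero, zero_mul, sub_zero]
      refine u_pow_dvd_of_mul hb ?_
      rw [h, pow_succ]
      exact mul_dvd_mul ih hEb
  exact eq_zero_of_u_pow_dvd fun n => dvd_trans (pow_dvd_pow _ (by omega)) (hall n)

/-- The two-part series: its derivative in `u`. Every split has a part of size one, so all terms of
the cut-and-join equation are known from `gD_singleton`. -/
theorem mul_euler_none_pair {k l : Fin m} (hkl : k ≠ l) :
    (xOfW k - xOfW l) * euler none (gammaHom m (HA {k, l})) =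
      u m * (xOfW l * Qw k - xOfW k * Qw l) := by
  set α : Finset (Fin m) := {k, l} with hα
  have hk : k ∈ α := mem_insert_self _ _
  have hl : l ∈ α := mem_insert_of_mem (mem_singleton_self _)
  have hc : #α = 2 := card_pair hkl
  have hek : α.erase l = {k} := by
    rw [hα, pair_comm, erase_insert (by simpa using hkl.symm)]
  have hel : α.erase k = {l} := by
    rw [hα, erase_insert (by simpa using hkl)]
  have hoff : α.offDiag = {(k, l), (l, k)} := by
    ext ⟨a, b⟩
    simp only [hα, mem_offDiag, mem_insert, mem_singleton, Prod.mk.injEq]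
    constructor
    · rintro ⟨rfl | rfl, rfl | rfl, h⟩
      exacts [absurd rfl h, Or.inl ⟨rfl, rfl⟩, Or.inr ⟨rfl, rfl⟩, absurd rfl h]
    · rintro (⟨rfl, rfl⟩ | ⟨rfl, rfl⟩)
      exacts [⟨Or.inl rfl, Or.inr rfl, hkl⟩, ⟨Or.inr rfl, Or.inl rfl, hkl.symm⟩]
  have hcj := congrArg (gammaHom m) (cut_join α)
  have hsplit : ∑ t ∈ splits α, euler (some t.2.2) (HA t.1) * euler (some t.2.2) (HA t.2.1) =
      2 * ∑ i ∈ α, euler (some i) (HA {i}) * euler (some i) (HA α) := by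
    have h1 : ∀ t ∈ splits α, (#t.1 = 1 ∧ ¬ #t.2.1 = 1) ∨ (¬ #t.1 = 1 ∧ #t.2.1 = 1) := by
      intro t ht
      have h2 := card_of_mem_splits ht
      obtain ⟨h3, h4, -, -⟩ := mem_of_mem_splits ht
      have h5 : 0 < #t.1 := card_pos.2 ⟨_, h3⟩
      have h6 : 0 < #t.2.1 := card_pos.2 ⟨_, h4⟩
      omega
    rw [two_mul]
    conv_rhs => rw [← sum_splits_card_one α fun t =>
      euler (some t.2.2) (HA t.1) * euler (some t.2.2) (HA t.2.1)]
    rw [← sum_filter_add_sum_filter_not (splits α) fun t => #t.1 = 1]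
    congr 1
    have h7 := sum_splits_swap α (fun a _ => a = 1) fun t =>
      euler (some t.2.2) (HA t.1) * euler (some t.2.2) (HA t.2.1)
    have h8 : {t ∈ splits α | ¬ #t.1 = 1} = {t ∈ splits α | #t.2.1 = 1} := by
      refine filter_congr fun t ht => ?_
      have := h1 t ht
      tauto
    rw [h8, h7]
    exact sum_congr rfl fun t _ => mul_comm _ _
  have hcut : ∑ q ∈ α.offDiag, cutSeries α q.1 q.2 = cutSeries α k l + cutSeries α l k := by
    rw [hoff, sum_pair (by simp [hkl])]
  rw [hsplit, hcut, hc, map_mul, map_add, gammaHom_euler_none_HA,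
    Nat.cast_ofNat, sub_self, zero_mul, map_zero, add_zero, map_add, map_add, map_mul, map_ofNat,
    map_sum] at hcj
  have hsum : ∑ i ∈ α, gammaHom m (euler (some i) (HA {i}) * euler (some i) (HA α)) =
      ∑ i ∈ α, u m * Qw i * gD α i := by
    refine sum_congr rfl fun i _ => ?_
    rw [map_mul, ← gD_singleton]; rfl
  rw [hsum] at hcj
  have h1 := gammaHom_cutSeries hk hl hkl
  have h2 := gammaHom_cutSeries hl hk hkl.symm
  rw [hek, hel, gD_singleton, gD_singleton] at h1 h2
  refine mul_left_cancel₀ two_ne_zero_series ?_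
  linear_combination (xOfW k - xOfW l) * hcj + h1 - h2

/-- The two-part series: its derivatives in the `w_i`. -/
theorem gD_pair {k l : Fin m} (hkl : k ≠ l) :
    (w k - w l) * (xOfW k - xOfW l) * gD {k, l} k =
      mu k * w l * (xOfW k - xOfW l) - xOfW l * (w k - w l) := by
  set f := gammaHom m (HA {k, l}) with hf
  set c := 1 - u m * dQ k with hc
  have hD : euler (some k) f = c * gD {k, l} k := euler_gammaHom_HA _ _
  have hE := mul_euler_none_pair hkl
  rw [← hf] at hE
  -- the mixed derivative of `f` in `w_k` and `u`
  have hDE := congrArg (euler (some k)) hE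
  have hlk : (some k : Option (Fin m)) ≠ some l := fun h => hkl (Option.some_injective _ h)
  have hsn : (some k : Option (Fin m)) ≠ none := Option.some_ne_none k
  have hxk : euler (some k) (xOfW k) = xOfW k * c := by
    rw [euler_xOfW, if_pos rfl, if_neg hsn, sub_zero]
  have hxl : euler (some k) (xOfW l) = 0 := by
    rw [euler_xOfW, if_neg hlk, if_neg hsn, sub_zero, mul_zero]
  have hQk : euler (some k) (Qw k) = dQ k := by rw [euler_Qw, if_pos rfl]
  have hQl : euler (some k) (Qw l) = 0 := by rw [euler_Qw, if_neg hlk]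
  have hu : euler (some k) (u m) = 0 := by rw [euler_u, if_neg hsn]
  rw [euler_mul, euler_mul, euler_sub, euler_sub, euler_mul, euler_mul, hxk, hxl, hQk, hQl, hu,
    euler_comm] at hDE
  -- `u ∂/∂u` of the coefficients
  have hExk : euler none (xOfW k) = -(xOfW k * (u m * Qw k)) := by
    rw [euler_xOfW, if_neg (by simp), if_pos rfl]; ring
  have hExl : euler none (xOfW l) = -(xOfW l * (u m * Qw l)) := by
    rw [euler_xOfW, if_neg (by simp), if_pos rfl]; ring
  have hEw : ∀ i : Fin m, euler none (w i) = 0 := fun i => by rw [euler_w, if_neg (by simp)]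
  have hEc : euler none c = -(u m * dQ k) := euler_none_one_sub k
  set A := w k - w l with hA
  set B := xOfW k - xOfW l with hB
  have hEA : euler none A = 0 := by rw [hA, euler_sub, hEw, hEw, sub_zero]
  have hEB : euler none B = u m * (xOfW l * Qw l - xOfW k * Qw k) := by
    rw [hB, euler_sub, hExk, hExl]; ring
  have hBu : ¬ u m ∣ B := not_u_dvd_xOfW_sub hkl
  have hB0 : B ≠ 0 := fun h => hBu (h ▸ dvd_zero _)
  -- divided by `B`, this combination is independent of `u`, and it vanishes at `u = 0`
  have hy : A * B * euler (some k) f - (w l * B - c * xOfW l * A) = 0 := by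
    refine eq_zero_of_mul_euler hBu ?_ ?_
    · have h1 : u m ∣ euler (some k) f := by
        have := u_pow_dvd_gammaHom (n := 1) (f := HA {k, l})
          (by rw [pow_one]; exact u_dvd_HA (insert_nonempty _ _))
        have := u_pow_dvd_euler (some k) this
        rwa [pow_one] at this
      have h2 : A * B * euler (some k) f - (w l * B - c * xOfW l * A) =
          A * B * euler (some k) f - w l * (xOfW k - w k) + w k * (xOfW l - w l) -
            u m * (dQ k * xOfW l * A) := by
        rw [hA, hB, hc]; ring
      rw [h2]
      exact dvd_sub (dvd_add (dvd_sub (h1.mul_left _) ((u_dvd_xOfW_sub k).mul_left _))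
        ((u_dvd_xOfW_sub l).mul_left _)) (dvd_mul_right _ _)
    · rw [euler_sub, euler_sub, euler_mul, euler_mul, euler_mul, euler_mul, euler_mul, hEA, hEB,
        hEw, hEc, hExl]
      refine mul_left_cancel₀ hB0 ?_
      clear_value B
      subst hB
      linear_combination A * (xOfW k - xOfW l) ^ 2 * hDE -
        A * (xOfW k - xOfW l) * xOfW k * c * hE
  rw [hD] at hy
  have hcm : c * mu k = 1 := mul_mu' k
  have hc0 : c ≠ 0 := left_ne_zero_of_mul_eq_one hcm
  refine mul_left_cancel₀ hc0 ?_
  linear_combination hy - w l * B * hcm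

end TwoParts

/-! ### The recursion -/

section Recursion

variable {m : ℕ}

theorem h_eq_gammaHom (hm : (univ : Finset (Fin m)).Nonempty) : h 0 m = gammaHom m (HA univ) := by
  have hs : symH 0 m = HA univ := by
    ext1 e
    rw [coeff_HA_eq_factSum hm e (fun i hi => absurd (mem_univ i) hi), coeff_symH_eq_factSum,
      card_univ, Fintype.card_fin]
  rw [h, hs, gammaHom_apply]

theorem mu_mul_hAtD {α : Finset (Fin m)} (hα : α.Nonempty) (i : Fin m) :
    mu i * hAtD 0 α i = gD α i := hAtD_eq hα i

theorem euler_none_integralU (f : Series m) : euler none (integralU f) = u m * f := by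
  ext1 e
  have h1 : MvPowerSeries.coeff e (integralU f) = if e none = 0 then 0
    else (e none : ℚ)⁻¹ • MvPowerSeries.coeff (e - Finsupp.single none 1) f := rfl
  rw [coeff_euler, h1, u, coeff_X_mul']
  split_ifs with h
  · rw [smul_zero]
  · rw [smul_smul, mul_inv_cancel₀ (by exact_mod_cast h), one_smul]

theorem u_dvd_integralU (f : Series m) : u m ∣ integralU f := by
  rw [u_dvd_iff]
  intro e he
  change (if e none = 0 then 0
    else (e none : ℚ)⁻¹ • MvPowerSeries.coeff (e - Finsupp.single none 1) f) = 0
  rw [if_pos he]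

/-- A series vanishing at `u = 0` is determined by its derivative in `u`. -/
theorem eq_of_euler_none_eq {f g : Series m} (hf : u m ∣ f) (hg : u m ∣ g)
    (h : euler none f = euler none g) : f = g := by
  ext1 e
  by_cases he : e none = 0
  · rw [u_dvd_iff.1 hf e he, u_dvd_iff.1 hg e he]
  · have h1 := congrArg (MvPowerSeries.coeff e) h
    rw [coeff_euler, coeff_euler] at h1
    exact smul_right_injective _ (Nat.cast_ne_zero.2 he) h1

theorem euler_none_u_pow (n : ℕ) : euler none (u m ^ n) = (n : Series m) * u m ^ n := by
  induction n with
  | zero =>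
    rw [pow_zero, Nat.cast_zero, zero_mul, euler, Derivation.map_one_eq_zero, mul_zero]
  | succ n ih =>
    rw [pow_succ, euler_mul, ih, euler_u, if_pos rfl]
    push_cast; ring

/-- Integration of the recursion in `u`. -/
theorem u_pow_mul_eq_integralU (n : ℕ) {f : Series m} (hf : u m ∣ f) :
    u m ^ (n + 1) * f = integralU ((euler none f + ((n + 1 : ℕ) : Series m) * f) * u m ^ n) := by
  refine eq_of_euler_none_eq (hf.mul_left _) (u_dvd_integralU _) ?_
  rw [euler_none_integralU, euler_mul, euler_none_u_pow]
  ring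

/-- The quadratic terms of the cut-and-join equation, sorted by the sizes of the two parts. -/
theorem sum_splits_univ (hm : 4 ≤ m) (F : Finset (Fin m) → Finset (Fin m) → Fin m → Series m)
    (hF : ∀ β ζ i, F β ζ i = F ζ β i) :
    ∑ t ∈ splits (univ : Finset (Fin m)), F t.1 t.2.1 t.2.2 =
      2 * ∑ i, F {i} univ i + 2 * ∑ q ∈ univ.offDiag, F {q.1, q.2} (univ.erase q.2) q.1 +
        ∑ t ∈ splits univ with 3 ≤ #t.1 ∧ 3 ≤ #t.2.1, F t.1 t.2.1 t.2.2 := by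
  have hone := sum_splits_card_one (univ : Finset (Fin m)) fun t => F t.1 t.2.1 t.2.2
  have htwo := sum_splits_card_two (univ : Finset (Fin m)) fun t => F t.1 t.2.1 t.2.2
  have hone' := (sum_splits_swap (univ : Finset (Fin m)) (fun a _ => a = 1)
    fun t => F t.1 t.2.1 t.2.2).trans ((sum_congr rfl fun t _ => hF _ _ _).trans hone)
  have htwo' := (sum_splits_swap (univ : Finset (Fin m)) (fun a _ => a = 2)
    fun t => F t.1 t.2.1 t.2.2).trans ((sum_congr rfl fun t _ => hF _ _ _).trans htwo)
  rw [two_mul, two_mul]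
  nth_rewrite 1 [← hone]
  rw [← hone']
  nth_rewrite 1 [← htwo]
  rw [← htwo']
  simp only [sum_filter]
  simp only [← sum_add_distrib]
  refine sum_congr rfl fun t ht => ?_
  have h1 := card_of_mem_splits ht
  obtain ⟨h3, h4, -, -⟩ := mem_of_mem_splits ht
  have h5 : 0 < #t.1 := card_pos.2 ⟨_, h3⟩
  have h6 : 0 < #t.2.1 := card_pos.2 ⟨_, h4⟩
  rw [card_univ, Fintype.card_fin] at h1
  split_ifs <;> first | (exfalso; omega) | simp

/-- A sum over ordered pairs of distinct elements is twice the sum over unordered pairs. -/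
theorem sum_mul_eq_two_mul_sum_sym2 {T R : Type*} [DecidableEq T] [CommSemiring R]
    (P : Finset (T × T)) (hswap : ∀ p ∈ P, p.swap ∈ P) (hne : ∀ p ∈ P, p.1 ≠ p.2) (g : T → R) :
    ∑ p ∈ P, g p.1 * g p.2 = 2 * ∑ z ∈ P.image (fun p : T × T => s(p.1, p.2)), (z.map g).mul := by
  rw [mul_sum]
  symm
  refine sum_image' (fun p : T × T => g p.1 * g p.2) fun p hp => ?_
  have hfib : ({p' ∈ P | s(p'.1, p'.2) = s(p.1, p.2)} : Finset (T × T)) = {p, p.swap} := by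
    ext p'
    rw [mem_filter, mem_insert, mem_singleton, Sym2.eq_iff, Prod.ext_iff, Prod.ext_iff]
    refine ⟨And.right, fun h => ⟨?_, h⟩⟩
    rcases h with h | h
    · rw [Prod.ext h.1 h.2]; exact hp
    · rw [show p' = p.swap from Prod.ext h.1 h.2]; exact hswap p hp
  rw [hfib, sum_pair (fun h => hne p hp (congrArg Prod.fst h)), Prod.fst_swap, Prod.snd_swap,
    Sym2.map_mk, Sym2.mul_mk, mul_comm (g p.2), two_mul]

/-- The ordered pairs in `splits` count every unordered pair of `Omega` twice. -/
theorem sum_splits_eq_sum_Omega (G : Fin m → Finset (Fin m) → Series m) :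
    ∑ t ∈ splits (univ : Finset (Fin m)) with 3 ≤ #t.1 ∧ 3 ≤ #t.2.1, G t.2.2 t.1 * G t.2.2 t.2.1 =
      2 * ∑ i, ∑ p ∈ Omega m i, (p.map (G i)).mul := by
  rw [← sum_fiberwise (g := fun t => t.2.2), mul_sum]
  refine sum_congr rfl fun i _ => ?_
  rw [Omega, ← sum_mul_eq_two_mul_sum_sym2]
  · refine sum_nbij' (fun t => (t.1, t.2.1)) (fun p => (p.1, p.2, i)) ?_ ?_ ?_ ?_ ?_
    · intro t ht
      rw [mem_filter, mem_filter, mem_splits] at ht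
      obtain ⟨⟨⟨h1, h2⟩, h3⟩, rfl⟩ := ht
      rw [mem_filter]
      exact ⟨mem_univ _, h1, h2, h3⟩
    · intro p hp
      obtain ⟨-, h1, h2, h3⟩ := mem_filter.1 hp
      rw [mem_filter, mem_filter, mem_splits]
      exact ⟨⟨⟨h1, h2⟩, h3⟩, rfl⟩
    · intro t ht
      rw [mem_filter] at ht
      rw [← ht.2]
    · exact fun _ _ => rfl
    · intro t ht
      rw [mem_filter] at ht
      rw [ht.2]
  · intro p hp
    obtain ⟨-, h1, h2, h3, h4⟩ := mem_filter.1 hp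
    rw [mem_filter, Prod.fst_swap, Prod.snd_swap, union_comm, inter_comm]
    exact ⟨mem_univ _, h1, h2, h4, h3⟩
  · intro p hp h
    obtain ⟨-, -, h2, h3, -⟩ := mem_filter.1 hp
    rw [← h, inter_self] at h2
    rw [h2, card_singleton] at h3
    omega

theorem toFrac_ne_zero {f : Series m} (hf : ¬ u m ∣ f) : toFrac f ≠ 0 := by
  intro h
  have h1 : f = 0 := IsFractionRing.injective (Series m) (FractionRing (Series m))
    (h.trans (map_zero _).symm)
  exact hf (h1 ▸ dvd_zero _)

/-- The cut terms: `sub_mul_cutSeries`, symmetrized by exchanging `k` and `l`. -/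
theorem toFrac_sum_cut :
    ∑ q ∈ (univ : Finset (Fin m)).offDiag, toFrac (gammaHom m (cutSeries univ q.1 q.2)) =
      2 * ∑ q ∈ (univ : Finset (Fin m)).offDiag,
        toFrac (xOfW q.2) / toFrac (xOfW q.1 - xOfW q.2) * toFrac (gD (univ.erase q.2) q.1) := by
  have hswap : ∀ f : Fin m × Fin m → FractionRing (Series m),
      ∑ q ∈ (univ : Finset (Fin m)).offDiag, f q.swap = ∑ q ∈ univ.offDiag, f q := by
    intro f
    refine sum_nbij' Prod.swap Prod.swap ?_ ?_ (fun _ _ => rfl) (fun _ _ => rfl) (fun _ _ => rfl)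
    all_goals
      intro q hq
      rw [mem_offDiag] at hq ⊢
      exact ⟨hq.2.1, hq.1, hq.2.2.symm⟩
  rw [two_mul]
  nth_rewrite 2 [← hswap]
  rw [← sum_add_distrib]
  refine sum_congr rfl fun q hq => ?_
  have hkl : q.1 ≠ q.2 := (mem_offDiag.1 hq).2.2
  have h1 := congrArg (toFrac (m := m)) (gammaHom_cutSeries (mem_univ q.1) (mem_univ q.2) hkl)
  have h2 := toFrac_ne_zero (not_u_dvd_xOfW_sub hkl)
  have h3 := toFrac_ne_zero (not_u_dvd_xOfW_sub hkl.symm)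
  simp only [toFrac, map_mul, map_sub, Prod.fst_swap, Prod.snd_swap] at h1 h2 h3 ⊢
  have h4 : algebraMap (Series m) (FractionRing (Series m)) (xOfW q.2) -
      algebraMap (Series m) (FractionRing (Series m)) (xOfW q.1) =
      -(algebraMap (Series m) (FractionRing (Series m)) (xOfW q.1) -
      algebraMap (Series m) (FractionRing (Series m)) (xOfW q.2)) := by ring
  rw [h4, div_neg]
  field_simp
  linear_combination h1

/-- The two-part contribution combines with the cut into the kernel of the recursion. -/
theorem toFrac_gD_pair_add {k l : Fin m} (hkl : k ≠ l) :
    toFrac (gD {k, l} k) + toFrac (xOfW l) / toFrac (xOfW k - xOfW l) =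
      toFrac (mu k * w l) / toFrac (w k - w l) := by
  have h1 := congrArg (toFrac (m := m)) (gD_pair hkl)
  have h2 := toFrac_ne_zero (not_u_dvd_xOfW_sub hkl)
  have h3 := toFrac_ne_zero (not_u_dvd_w_sub hkl)
  generalize w k - w l = A at *
  generalize xOfW k - xOfW l = B at *
  simp only [toFrac, map_mul, map_sub] at h1 h2 h3 ⊢
  field_simp
  linear_combination h1

/-- The cut-and-join equation in the variables `w_i`. The splits with a part of size one cancel the
terms `u Q_i` from the change of variables, and those with a part of size two combine with the cut
terms. -/
theorem recursion (hm : 4 ≤ m) :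
    toFrac (euler none (gammaHom m (HA univ)) + ((m : Series m) - 2) * gammaHom m (HA univ)) =
      (∑ i : Fin m, ∑ p ∈ Omega m i, toFrac (mu i ^ 2 * (p.map fun α => hAtD 0 α i).mul)) +
        (∑ k : Fin m, ∑ l ∈ Finset.univ.erase k,
          toFrac (mu k ^ 2 * w l) / toFrac (w k - w l) *
            toFrac (hAtD 0 (Finset.univ.erase l) k)) := by
  have hΩ : ∀ i, ∀ p ∈ Omega m i, mu i ^ 2 * (p.map fun α => hAtD 0 α i).mul =
      (p.map fun α => gD α i).mul := by
    intro i p hp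
    obtain ⟨⟨β, ζ⟩, h, rfl⟩ := mem_image.1 hp
    obtain ⟨-, -, -, h1, h2⟩ := mem_filter.1 h
    change mu i ^ 2 * (hAtD 0 β i * hAtD 0 ζ i) = gD β i * gD ζ i
    change 3 ≤ #β at h1
    change 3 ≤ #ζ at h2
    rw [← mu_mul_hAtD (card_pos.1 (by omega)), ← mu_mul_hAtD (card_pos.1 (by omega))]
    ring
  have hkl : ∑ k : Fin m, ∑ l ∈ univ.erase k, toFrac (mu k ^ 2 * w l) / toFrac (w k - w l) *
      toFrac (hAtD 0 (univ.erase l) k) = ∑ q ∈ (univ : Finset (Fin m)).offDiag,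
        (toFrac (gD {q.1, q.2} q.1) + toFrac (xOfW q.2) / toFrac (xOfW q.1 - xOfW q.2)) *
          toFrac (gD (univ.erase q.2) q.1) := by
    rw [← sum_finset_product (r := (univ : Finset (Fin m)).offDiag) (s := univ)
      (t := fun k => univ.erase k) (f := fun q => toFrac (mu q.1 ^ 2 * w q.2) /
        toFrac (w q.1 - w q.2) * toFrac (hAtD 0 (univ.erase q.2) q.1))]
    · refine sum_congr rfl fun q hq => ?_
      have hq := (mem_offDiag.1 hq).2.2
      rw [toFrac_gD_pair_add hq, ← mu_mul_hAtD ⟨q.1, mem_erase.2 ⟨hq, mem_univ _⟩⟩]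
      simp only [toFrac, map_mul, map_pow]
      ring
    · intro q
      simp only [mem_offDiag, mem_univ, mem_erase, true_and, and_true, ne_comm]
  have hcj := congrArg (gammaHom m) (cut_join (univ : Finset (Fin m)))
  rw [map_mul, map_add, gammaHom_euler_none_HA, map_mul, map_sub, map_natCast, map_ofNat, map_add,
    map_sum, map_sum, card_univ, Fintype.card_fin] at hcj
  have hs := sum_splits_univ hm (fun β ζ i => gD β i * gD ζ i) (fun _ _ _ => mul_comm _ _)
  rw [sum_splits_eq_sum_Omega (fun i α => gD α i)] at hs
  have hquad : ∑ t ∈ splits (univ : Finset (Fin m)),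
      gammaHom m (euler (some t.2.2) (HA t.1) * euler (some t.2.2) (HA t.2.1)) =
      ∑ t ∈ splits univ, gD t.1 t.2.2 * gD t.2.1 t.2.2 :=
    sum_congr rfl fun t _ => map_mul _ _ _
  rw [hquad, hs] at hcj
  simp only [gD_singleton] at hcj
  have hcut := toFrac_sum_cut (m := m)
  rw [hkl, sum_congr rfl fun i _ => sum_congr rfl fun p hp => congrArg toFrac (hΩ i p hp)]
  simp only [add_mul, sum_add_distrib]
  have hfr := congrArg (toFrac (m := m)) hcj
  simp only [toFrac, map_add, map_mul, map_sum, map_ofNat] at hfr hcut ⊢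
  rw [hcut] at hfr
  have h20 : (2 : FractionRing (Series m)) ≠ 0 := by
    have := toFrac_ne_zero (f := (2 : Series m)) (by
      intro h
      have := u_dvd_iff.1 h 0 rfl
      rw [MvPowerSeries.coeff_zero_eq_constantCoeff_apply, map_ofNat] at this
      exact two_ne_zero this)
    rwa [toFrac, map_ofNat] at this
  refine mul_left_cancel₀ h20 ?_
  linear_combination hfr

end Recursion

end DoubleHurwitz

open DoubleHurwitz in
theorem theorem5p6 (m : ℕ) (hm : 4 ≤ m) :
    ∃ F : Series m,
      toFrac F =
        (∑ i : Fin m, ∑ p ∈ Omega m i,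
          toFrac (mu i ^ 2 * (p.map fun α => hAtD 0 α i).mul)) +
        (∑ k : Fin m, ∑ l ∈ Finset.univ.erase k,
          toFrac (mu k ^ 2 * w l) / toFrac (w k - w l) * toFrac (hAtD 0 (Finset.univ.erase l) k)) ∧
      toFrac (h 0 m) = toFrac (u m) ^ (2 - (m : ℤ)) * toFrac (integralU (F * u m ^ (m - 3))) := by
  refine ⟨_, recursion hm, ?_⟩
  have hu : toFrac (u m) ≠ 0 := by
    intro h0
    have h1 : u m = 0 := (IsFractionRing.injective (Series m) (FractionRing (Series m)))
      (h0.trans (map_zero _).symm)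
    have h2 := congrArg (MvPowerSeries.coeff (Finsupp.single none 1)) h1
    rw [u, MvPowerSeries.coeff_index_single_self_X, map_zero] at h2
    exact one_ne_zero h2
  have hne : (Finset.univ : Finset (Fin m)).Nonempty := ⟨⟨0, by omega⟩, Finset.mem_univ _⟩
  have hd : u m ∣ gammaHom m (HA (Finset.univ : Finset (Fin m))) := by
    have := u_pow_dvd_gammaHom (n := 1) (f := HA (Finset.univ : Finset (Fin m)))
      (by rw [pow_one]; exact u_dvd_HA hne)
    rwa [pow_one] at this
  have hint := u_pow_mul_eq_integralU (m - 3) hd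
  have h2 : ((m - 3 + 1 : ℕ) : Series m) = (m : Series m) - 2 := by
    have : m - 3 + 1 + 2 = m := by omega
    rw [eq_sub_iff_add_eq]
    exact_mod_cast congrArg (Nat.cast : ℕ → Series m) this
  rw [h2] at hint
  have h4 : ∀ (n : ℕ) (f : Series m), toFrac (u m ^ n * f) = toFrac (u m) ^ (n : ℤ) * toFrac f :=
    fun n f => by rw [toFrac, map_mul, map_pow, zpow_natCast]
  rw [← hint, h_eq_gammaHom hne, h4, ← mul_assoc, ← zpow_add₀ hu]
  have h3 : 2 - (m : ℤ) + ((m - 3 + 1 : ℕ) : ℤ) = 0 := by omega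
  rw [h3, zpow_zero, one_mul]
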